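/- Graphs are finite and undirected; loops and parallel edges are allowed. A cycle of a graph $G=(V,E)$ is a simple cycle, regarded as a subset of $E$ (a loop is a cycle of length $1$, two parallel edges form a cycle of length $2$), and its length is its number of edges. For $A\subseteq E$ let $\chi_A\in\mathbb{Z}^E$ be the characteristic vector. The cycle lattice of $G$ is the set of all integer linear combinations of the vectors $\chi_C$, $C$ a cycle of $G$. A lattice cycle basis of $G$ is a collection of cycles of $G$ whose characteristic vectors form a $\mathbb{Z}$-basis of the cycle lattice. For a spanning tree $T\subseteq E$, $\operatorname{diam}(T)$ is the largest distance between two vertices in the tree $(V,T)$. The computational model is the unit-cost random access machine with addition, truncated subtraction, zero tests and indirect addressing, whose stored words, on a graph with $n$ vertices and $m$ edges, are natural numbers bounded by a fixed polynomial in $n+m$ (that is, have $O(\log(n+m))$ bits). The input is an adjacency list of $G$ (for each vertex $v$, in any order, the pairs $(e,w)$ such that the edge $e$ joins $v$ and $w$) together with the indicator function of $T$; the output is a list of cycles, each given as a list of its edges without repetition. **Theorem.** There are a program and a constant $c$ such that for every connected graph $G=(V,E)$ with $n\ge 2$ vertices and $m$ edges and every spanning tree $T$ of $G$, the program, given $G$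 and $T$, halts after at most $c\,mn$ steps and outputs a lattice cycle basis of $G$ in which each cycle has length at most $2\operatorname{diam}(T)$. -/

import Mathlib

namespace CycleLattice

/-! ### Cycles and the cycle lattice of a multigraph -/

/-- `C` is the edge set of a (simple) cycle of `G`: there are distinct vertices `x 0, …, x k` and
distinct edges `e 0, …, e k` such that `e i` joins `x i` and `x (i + 1)`, indices being taken
modulo `k + 1`. A loop is a cycle of length one (`k = 0`), and two parallel edges form a cycle of
length two (`k = 1`). -/
def IsCycle {α β : Type*} (G : Graph α β) (C : Set β) : Prop :=
  ∃ (k : ℕ) (x : Fin (k + 1) → α) (e : Fin (k + 1) → β),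
    Function.Injective x ∧ Function.Injective e ∧
      (∀ i, G.IsLink (e i) (x i) (x (i + 1))) ∧ C = Set.range e

/-- The characteristic vector in `ℤ^E` of a set of edges. -/
noncomputable def indVec {α β : Type*} (G : Graph α β) (A : Set β) : G.edgeSet → ℤ :=
  fun e => A.indicator 1 e.1

/-- The cycle lattice of `G`: all integer linear combinations of characteristic vectors of
cycles. -/
def cycleLattice {α β : Type*} (G : Graph α β) : Submodule ℤ (G.edgeSet → ℤ) :=
  Submodule.span ℤ (indVec G '' {C | IsCycle G C})

/-- The sets `C i` are cycles of `G` whose characteristic vectors form a `ℤ`-basis of the cycle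
lattice (in particular the `C i` are pairwise distinct). -/
def IsLatticeCycleBasis {α β ι : Type*} (G : Graph α β) (C : ι → Set β) : Prop :=
  (∀ i, IsCycle G (C i)) ∧
    LinearIndependent ℤ (fun i => indVec G (C i)) ∧
      Submodule.span ℤ (Set.range fun i => indVec G (C i)) = cycleLattice G

/-! ### Connectedness, spanning trees and diameter

Forgetting loops and multiplicities of edges (`Graph.toSimpleGraph`) changes neither which vertices
are joined by a path nor the distances between vertices. -/

/-- Any two vertices of `G` are joined by a path (and there is a vertex). -/
def IsConnected {α β : Type*} (G : Graph α β) : Prop := G.toSimpleGraph.Connected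

/-- The edge set `T` is a spanning tree of `G`: the subgraph `(V, T)` is connected and contains no
cycle. -/
def IsSpanningTree {α β : Type*} (G : Graph α β) (T : Set β) : Prop :=
  T ⊆ G.edgeSet ∧ IsConnected (G.restrict T) ∧ ∀ C, IsCycle G C → ¬ C ⊆ T

/-- The largest distance between two vertices in the subgraph `(V, T)` of `G`. -/
noncomputable def treeDiam {α β : Type*} (G : Graph α β) (T : Set β) : ℕ :=
  (G.restrict T).toSimpleGraph.diam

/-! ### The machine model: a word RAM with unit costs

A program uses finitely many registers and finitely many arrays, all holding natural numbers, and
is built from assignments, array writes, sequencing, conditionals and loops. Every operation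
(constant, register access, array access, addition, truncated subtraction, assignment, test) costs
one unit of time. Only words of size at most `W` can be stored: a program that tries to store a
bigger number, or to write to a bigger address, has no execution. -/

structure State where
  reg : ℕ → ℕ
  arr : ℕ → ℕ → ℕ

inductive Expr where
  | const (k : ℕ)
  | reg (x : ℕ)
  | read (a : ℕ) (i : Expr)
  | add (p q : Expr)
  | sub (p q : Expr)

def Expr.eval (s : State) : Expr → ℕ
  | .const k => k
  | .reg x => s.reg x
  | .read a i => s.arr a (i.eval s)
  | .add p q => p.eval s + q.eval s
  | .sub p q => p.eval s - q.eval s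

/-- The time needed to evaluate an expression: its number of operations. -/
def Expr.cost : Expr → ℕ
  | .const _ => 1
  | .reg _ => 1
  | .read _ i => i.cost + 1
  | .add p q => p.cost + q.cost + 1
  | .sub p q => p.cost + q.cost + 1

/-- Programs. The tests of `cond` and `loop` ask whether the expression is nonzero. -/
inductive Prog where
  | skip
  | assign (x : ℕ) (p : Expr)
  | write (a : ℕ) (i p : Expr)
  | seq (P Q : Prog)
  | cond (p : Expr) (P Q : Prog)
  | loop (p : Expr) (P : Prog)

def State.setReg (s : State) (x v : ℕ) : State :=
  { s with reg := Function.update s.reg x v }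

def State.setArr (s : State) (a i v : ℕ) : State :=
  { s with arr := Function.update s.arr a (Function.update (s.arr a) i v) }

/-- `Exec W P s t s'`: with words of size at most `W`, the program `P` started in state `s` halts
after exactly `t` units of time in state `s'`. -/
inductive Exec (W : ℕ) : Prog → State → ℕ → State → Prop
  | skip (s : State) : Exec W .skip s 1 s
  | assign (s : State) (x : ℕ) (p : Expr) (hp : p.eval s ≤ W) :
      Exec W (.assign x p) s (p.cost + 1) (s.setReg x (p.eval s))
  | write (s : State) (a : ℕ) (i p : Expr) (hi : i.eval s ≤ W) (hp : p.eval s ≤ W) :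
      Exec W (.write a i p) s (i.cost + p.cost + 1) (s.setArr a (i.eval s) (p.eval s))
  | seq {P Q : Prog} {s s₁ s₂ : State} {t₁ t₂ : ℕ}
      (h₁ : Exec W P s t₁ s₁) (h₂ : Exec W Q s₁ t₂ s₂) : Exec W (.seq P Q) s (t₁ + t₂) s₂
  | condTrue {p : Expr} {P Q : Prog} {s s₁ : State} {t : ℕ}
      (hp : p.eval s ≠ 0) (h : Exec W P s t s₁) : Exec W (.cond p P Q) s (p.cost + 1 + t) s₁
  | condFalse {p : Expr} {P Q : Prog} {s s₁ : State} {t : ℕ}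
      (hp : p.eval s = 0) (h : Exec W Q s t s₁) : Exec W (.cond p P Q) s (p.cost + 1 + t) s₁
  | loopTrue {p : Expr} {P : Prog} {s s₁ s₂ : State} {t₁ t₂ : ℕ}
      (hp : p.eval s ≠ 0) (h₁ : Exec W P s t₁ s₁) (h₂ : Exec W (.loop p P) s₁ t₂ s₂) :
      Exec W (.loop p P) s (p.cost + 1 + t₁ + t₂) s₂
  | loopFalse {p : Expr} {P : Prog} {s : State}
      (hp : p.eval s = 0) : Exec W (.loop p P) s (p.cost + 1) s

/-! ### Input and output -/

/-- An adjacency list of `G` whose vertices and edges are numbered by `vtx` and `edg`: the list of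
the vertex `v` contains exactly once each pair `(e, w)` such that the edge `e` joins `v` and
`w`. -/
def IsAdjList {α β : Type*} {n m : ℕ} (G : Graph α β) (vtx : Fin n ≃ G.vertexSet)
    (edg : Fin m ≃ G.edgeSet) (adj : Fin n → List (Fin m × Fin n)) : Prop :=
  ∀ v, (adj v).Nodup ∧ ∀ e w, (e, w) ∈ adj v ↔ G.IsLink (edg e).1 (vtx v).1 (vtx w).1

/-- The positions at which the members of `L` start in the concatenation of `L`, followed by the
total length: `[0, |L₀|, |L₀| + |L₁|, …]`. -/
def offsets {γ : Type*} (L : List (List γ)) : List ℕ :=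
  (L.map List.length).scanl (· + ·) 0

/-- The array that holds a list, followed by zeros. -/
def ofList (l : List ℕ) : ℕ → ℕ := fun i => l.getD i 0

/-- The initial state of the machine. Registers `0` and `1` hold the numbers of vertices and edges.
The adjacency lists are concatenated in the order of the vertices: array `0` holds the positions
at which they start, array `1` the neighbours and array `2` the edges. Array `3` holds the indicator
function of the tree. Everything else is zero. -/
noncomputable def inputState {n m : ℕ} (adj : Fin n → List (Fin m × Fin n)) (tree : Set (Fin m)) :
    State where
  reg := ofList [n, m]
  arr a :=
    match a with
    | 0 => ofList (offsets (List.ofFn adj))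
    | 1 => ofList ((List.ofFn adj).flatten.map fun q => (q.2 : ℕ))
    | 2 => ofList ((List.ofFn adj).flatten.map fun q => (q.1 : ℕ))
    | 3 => ofList (List.ofFn fun e : Fin m => tree.indicator 1 e)
    | _ => fun _ => 0

/-- The array `f` starts with the list `l`. -/
def StartsWith (f : ℕ → ℕ) (l : List ℕ) : Prop := ∀ i (h : i < l.length), f i = l[i]

/-- The output of the machine is the list `L` of lists of edges: register `2` holds its length,
array `5` the concatenation of its members, and array `4` the positions at which they start. -/
def IsOutput {m : ℕ} (s : State) (L : List (List (Fin m))) : Prop :=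
  s.reg 2 = L.length ∧ StartsWith (s.arr 4) (offsets L) ∧
    StartsWith (s.arr 5) (L.flatten.map fun e => (e : ℕ))

/-- The set of edges whose numbers are listed in `l`. -/
def edgesOf {α β : Type*} {m : ℕ} {G : Graph α β} (edg : Fin m ≃ G.edgeSet) (l : List (Fin m)) :
    Set β :=
  {e | ∃ i ∈ l, (edg i).1 = e}

end CycleLattice

/-! Root the tree and name each tree edge by its lower end. An edge `f` outside the tree covers the
tree edges on the tree path between its ends; `sig i v` is the set of edges numbered below `i` that
cover `v`. A cycle meets the cut of every tree edge in an even number of edges. It is therefore the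
sum of the fundamental cycles of its edges outside the tree, minus twice the function that counts,
at each tree edge, the covering edges in the cycle, halved and rounded down (`indVec_cycle`). This
function depends only on `sig m` and vanishes where at most one edge covers, so it belongs to `lat
m`. Conversely, if the tree paths of `f` and `j` overlap, the symmetric difference of their
fundamental cycles is again a simple cycle (`isCycle_pair`), and its vector is the sum of the two
fundamental vectors minus twice the overlap (`pairVec_eq`). Hence the fundamental cycles, together
with pairs whose overlaps form a basis of `lat m`, form a lattice cycle basis (`span_gens`,
`linearIndepOn_gens`). A shared tree edge saves two edges, which pays for the two edges outside the
tree in the length bound.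

The basis of `lat` grows edge by edge (`IsPairBasis.succ`). Passing from `lat f` to `lat (f + 1)`
frees one value for each class of tree edges on the path of `f` that so far was covered exactly
once, or was covered and is now split. If `R` represents these classes, the quotient is `ℤ^R`, and
the overlap of `f` and `j` becomes the path of `j` restricted to `R`. Along the path of `f` the set
`R` is linearly ordered and this restriction is an interval, that is, a link between two of `R.card
+ 1` points on a line. A spanning tree of links gives a basis of `ℤ^R` (`IsMerged.basis`). That the
links connect all points is the combinatorial core (`LineLinks.lab_eq`): each gap is crossed by a
link, all links across one gap are in one class, and any two gaps are distinguished by some link.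
The second fact holds because such a link is unique or all of them run through one branch that
leaves the path of `f`.

For the running time, an ancestor matrix tests in constant time whether a tree edge is on a path.
Independence in `ℤ^n` allows at most `n` pairs. Each edge outside the tree costs `O(n)` for its
fundamental cycle and the refinement of classes. The scan of the earlier edges is made only if `R`
is nonempty, and then yields at least `R.card` pairs, so it and the work on `R` are charged to the
pairs, `O(n + m)` each. As `n ≤ m + 1`, all this is `O(mn)` (`runs_mainStep`, `runs_main`,
`runs_basisProg`). -/

namespace CycleLattice

/-! ### Running programs -/

/-- With words of size at most `W`, the program `P` started in `s` halts, and its running time and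
final state satisfy `Q`. -/
def Runs (W : ℕ) (P : Prog) (s : State) (Q : ℕ → State → Prop) : Prop :=
  ∃ t s', Exec W P s t s' ∧ Q t s'

namespace Runs

variable {W : ℕ} {P P' : Prog} {s : State} {Q Q' : ℕ → State → Prop}

theorem mono (h : Runs W P s Q) (hQ : ∀ t s', Q t s' → Q' t s') : Runs W P s Q' := by
  obtain ⟨t, s', he, hq⟩ := h
  exact ⟨t, s', he, hQ _ _ hq⟩

theorem skip (h : Q 1 s) : Runs W .skip s Q := ⟨_, _, .skip s, h⟩

theorem assign {x : ℕ} {p : Expr} (hp : p.eval s ≤ W) (h : Q (p.cost + 1) (s.setReg x (p.eval s))) :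
    Runs W (.assign x p) s Q := ⟨_, _, .assign s x p hp, h⟩

theorem write {a : ℕ} {i p : Expr} (hi : i.eval s ≤ W) (hp : p.eval s ≤ W)
    (h : Q (i.cost + p.cost + 1) (s.setArr a (i.eval s) (p.eval s))) :
    Runs W (.write a i p) s Q := ⟨_, _, .write s a i p hi hp, h⟩

theorem seq (h : Runs W P s fun t s' => Runs W P' s' fun t' => Q (t + t')) :
    Runs W (.seq P P') s Q := by
  obtain ⟨t, s', he, t', s'', he', hq⟩ := h
  exact ⟨_, _, .seq he he', hq⟩

theorem cond {p : Expr} (h₁ : p.eval s ≠ 0 → Runs W P s fun t => Q (p.cost + 1 + t))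
    (h₂ : p.eval s = 0 → Runs W P' s fun t => Q (p.cost + 1 + t)) :
    Runs W (.cond p P P') s Q := by
  by_cases hp : p.eval s = 0
  · obtain ⟨t, s', he, hq⟩ := h₂ hp
    exact ⟨_, _, .condFalse hp he, hq⟩
  · obtain ⟨t, s', he, hq⟩ := h₁ hp
    exact ⟨_, _, .condTrue hp he, hq⟩

end Runs

/-! ### Registers and arrays that a program does not touch -/

def Prog.writesReg : Prog → ℕ → Bool
  | .skip, _ => false
  | .assign x _, y => x == y
  | .write _ _ _, _ => false
  | .seq P Q, y => P.writesReg y || Q.writesReg y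
  | .cond _ P Q, y => P.writesReg y || Q.writesReg y
  | .loop _ P, y => P.writesReg y

def Prog.writesArr : Prog → ℕ → Bool
  | .skip, _ => false
  | .assign _ _, _ => false
  | .write a _ _, b => a == b
  | .seq P Q, y => P.writesArr y || Q.writesArr y
  | .cond _ P Q, y => P.writesArr y || Q.writesArr y
  | .loop _ P, y => P.writesArr y

/-- The states agree on all registers and arrays that `P` does not mention as a target. -/
structure Frame (P : Prog) (s s' : State) : Prop where
  reg : ∀ x, P.writesReg x = false → s'.reg x = s.reg x
  arr : ∀ a, P.writesArr a = false → s'.arr a = s.arr a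

theorem Frame.refl (P : Prog) (s : State) : Frame P s s := ⟨fun _ _ => rfl, fun _ _ => rfl⟩

theorem Frame.trans {P : Prog} {s s' s'' : State} (h : Frame P s s') (h' : Frame P s' s'') :
    Frame P s s'' :=
  ⟨fun x hx => (h'.reg x hx).trans (h.reg x hx), fun x hx => (h'.arr x hx).trans (h.arr x hx)⟩

theorem Frame.of_writes {P P' : Prog} {s s' : State} (h : Frame P s s')
    (hr : ∀ x, P'.writesReg x = false → P.writesReg x = false)
    (ha : ∀ x, P'.writesArr x = false → P.writesArr x = false) : Frame P' s s' :=
  ⟨fun x hx => h.reg x (hr x hx), fun x hx => h.arr x (ha x hx)⟩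

/-- Write sets are computed syntactically, so that a register or array is seen to be untouched by
`rfl` and loop invariants need only mention what the body changes. -/
theorem Exec.frame {W : ℕ} {P : Prog} {s s' : State} {t : ℕ} (h : Exec W P s t s') :
    Frame P s s' := by
  induction h with
  | skip s => exact .refl _ _
  | assign s x p hp =>
    refine ⟨fun y hy => ?_, fun _ _ => rfl⟩
    simp only [Prog.writesReg, beq_eq_false_iff_ne] at hy
    simp [State.setReg, Function.update_of_ne hy.symm]
  | write s a i p hi hp =>
    refine ⟨fun _ _ => rfl, fun y hy => ?_⟩
    simp only [Prog.writesArr, beq_eq_false_iff_ne] at hy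
    simp [State.setArr, Function.update_of_ne hy.symm]
  | seq h₁ h₂ ih₁ ih₂ =>
    exact (ih₁.of_writes (by simp +contextual [Prog.writesReg])
      (by simp +contextual [Prog.writesArr])).trans
      (ih₂.of_writes (by simp +contextual [Prog.writesReg]) (by simp +contextual [Prog.writesArr]))
  | condTrue hp h ih =>
    exact ih.of_writes (by simp +contextual [Prog.writesReg]) (by simp +contextual [Prog.writesArr])
  | condFalse hp h ih =>
    exact ih.of_writes (by simp +contextual [Prog.writesReg]) (by simp +contextual [Prog.writesArr])
  | loopTrue hp h₁ h₂ ih₁ ih₂ =>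
    exact (ih₁.of_writes (by simp +contextual [Prog.writesReg])
      (by simp +contextual [Prog.writesArr])).trans ih₂
  | loopFalse hp => exact .refl _ _

theorem Runs.frame {W : ℕ} {P : Prog} {s : State} {Q : ℕ → State → Prop} (h : Runs W P s Q) :
    Runs W P s fun t s' => Q t s' ∧ Frame P s s' := by
  obtain ⟨t, s', he, hq⟩ := h
  exact ⟨t, s', he, hq, he.frame⟩

/-! ### Counting loops -/

/-- Runs `body` with register `x` set to `0, 1, …`, as long as it is smaller than `b`. -/
def Prog.for (x : ℕ) (b : Expr) (body : Prog) : Prog :=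
  .seq (.assign x (.const 0))
    (.loop (.sub b (.reg x)) (.seq body (.assign x (.add (.reg x) (.const 1)))))

@[simp] theorem Prog.writesReg_for (x : ℕ) (b : Expr) (body : Prog) (y : ℕ) :
    (Prog.for x b body).writesReg y = (x == y || body.writesReg y) := by
  simp [Prog.for, Prog.writesReg]
  cases x == y <;> simp

@[simp] theorem Prog.writesArr_for (x : ℕ) (b : Expr) (body : Prog) (y : ℕ) :
    (Prog.for x b body).writesArr y = body.writesArr y := by
  simp [Prog.for, Prog.writesArr]

@[simp] theorem State.setReg_reg (s : State) (x v y : ℕ) :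
    (s.setReg x v).reg y = if y = x then v else s.reg y := by
  simp [State.setReg, Function.update_apply]

@[simp] theorem State.setReg_arr (s : State) (x v : ℕ) : (s.setReg x v).arr = s.arr := rfl

@[simp] theorem State.setArr_reg (s : State) (a i v : ℕ) : (s.setArr a i v).reg = s.reg := rfl

@[simp] theorem State.setArr_arr (s : State) (a i v b j : ℕ) :
    (s.setArr a i v).arr b j = if b = a ∧ j = i then v else s.arr b j := by
  by_cases hb : b = a
  · subst hb; simp [State.setArr, Function.update_apply]
  · simp [State.setArr, hb]

/-- Induction on the number `d` of remaining rounds. The overhead of a round is `b.cost + 3` for the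
test and `4` for the increment; the failing test at the end costs another `b.cost + 3`. The bound `N
≤ W` makes the counter storable. -/
theorem Runs.loop_count {W x N : ℕ} {b : Expr} {body : Prog} {I : ℕ → ℕ → State → Prop}
    (hN : N ≤ W)
    (hb : ∀ k t s, k ≤ N → I k t s → b.eval s = N ∧ s.reg x = k)
    (hstep : ∀ k t s, k < N → I k t s → Runs W body s fun t' s' => s'.reg x = k ∧
      I (k + 1) (t + t' + (b.cost + 7)) (s'.setReg x (k + 1)))
    {Q : ℕ → State → Prop} {t₀ : ℕ}
    (hpost : ∀ t s, I N t s → Q (t - t₀ + b.cost + 3) s) :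
    ∀ d k t s, k + d = N → t₀ ≤ t → I k t s →
      Runs W (.loop (.sub b (.reg x)) (.seq body (.assign x (.add (.reg x) (.const 1))))) s
        fun t' s' => Q (t - t₀ + t') s' := by
  intro d
  induction d with
  | zero =>
    intro k t s hk ht hI
    obtain ⟨h1, h2⟩ := hb k t s (by omega) hI
    refine ⟨_, s, .loopFalse (by simp [Expr.eval]; omega), ?_⟩
    obtain rfl : k = N := by omega
    have := hpost t s hI
    simpa [Expr.cost, add_assoc] using this
  | succ d ih =>
    intro k t s hk ht hI
    obtain ⟨h1, h2⟩ := hb k t s (by omega) hI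
    obtain ⟨t', s', he, hx, hI'⟩ := hstep k t s (by omega) hI
    obtain ⟨t'', s'', he', hQ⟩ := ih (k + 1) _ _ (by omega) (by omega) hI'
    have hW : (Expr.add (.reg x) (.const 1)).eval s' ≤ W := by simp [Expr.eval, hx]; omega
    refine ⟨_, s'', .loopTrue (by simp [Expr.eval]; omega) (.seq he (.assign s' x _ hW))
      (by simpa [Expr.eval, hx] using he'), ?_⟩
    convert hQ using 1
    simp [Expr.cost]
    omega

/-- Rule for counting loops. The invariant speaks about the number of finished rounds, the time used
by them and the state. -/
theorem Runs.for {W x N : ℕ} {b : Expr} {body : Prog} {s₀ : State} {Q : ℕ → State → Prop}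
    (I : ℕ → ℕ → State → Prop) (hN : N ≤ W)
    (hb : ∀ s, Frame (Prog.for x b body) s₀ s → b.eval s = N)
    (h0 : I 0 0 (s₀.setReg x 0))
    (hstep : ∀ k t s, k < N → I k t s → s.reg x = k → Frame (Prog.for x b body) s₀ s →
      Runs W body s fun t' s' => s'.reg x = k ∧
        I (k + 1) (t + t' + (b.cost + 7)) (s'.setReg x (k + 1)))
    (hpost : ∀ t s, I N t s → Frame (Prog.for x b body) s₀ s → Q (t + b.cost + 5) s) :
    Runs W (Prog.for x b body) s₀ Q := by
  refine Runs.seq (Runs.assign (Nat.zero_le _) ?_)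
  have hset : ∀ (s : State) v, Frame (Prog.for x b body) s (s.setReg x v) := by
    intro s v
    refine ⟨fun y hy => ?_, fun _ _ => rfl⟩
    have : y ≠ x := by rintro rfl; simp at hy
    simp [this]
  -- The value of the counter and the frame are added to the invariant here, once for all loops. The
  -- initial assignment costs `2`.
  have := Runs.loop_count (W := W) (x := x) (N := N) (b := b) (body := body)
    (I := fun k t s => I k t s ∧ s.reg x = k ∧ Frame (Prog.for x b body) s₀ s)
    (Q := fun t s => Q (t + 2) s) (t₀ := 0) hN
    (fun k t s _ h => ⟨hb s h.2.2, h.2.1⟩)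
    (fun k t s hk h => by
      refine (hstep k t s hk h.1 h.2.1 h.2.2).frame.mono ?_
      rintro t' s' ⟨⟨h1, h2⟩, h3⟩
      refine ⟨h1, h2, by simp, (h.2.2.trans (h3.of_writes ?_ ?_)).trans (hset _ _)⟩ <;>
        simp +contextual)
    (fun t s h => hpost t s h.1 h.2.2) N 0 0 (s₀.setReg x 0) (by omega) le_rfl
    ⟨h0, by simp, hset _ _⟩
  refine this.mono fun t s h => ?_
  simpa [Expr.cost, add_comm] using h

end CycleLattice

namespace CycleLattice

/-! ### Intervals on a line -/

/-- Links between points on a line, where `pos v` is the position of `v`, and classes `lab` of points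
connected by these links (points in the same position being identified). -/
structure LineLinks {V E : Type*} (pos lab : V → ℕ) (J : Set E) (a b : E → V) (q : ℕ) : Prop where
  pos_le : ∀ v, pos v ≤ q
  exists_pos : ∀ t ≤ q, ∃ v, pos v = t
  lab_of_pos : ∀ u v, pos u = pos v → lab u = lab v
  lab_link : ∀ j ∈ J, lab (a j) = lab (b j)
  finest : ∀ S : V → Prop, (∀ u v, pos u = pos v → (S u ↔ S v)) → (∀ j ∈ J, (S (a j) ↔ S (b j))) →
    ∀ u v, lab u = lab v → (S u ↔ S v)
  exists_cross : ∀ t, 1 ≤ t → t ≤ q → ∃ j ∈ J, ¬ (t ≤ pos (a j) ↔ t ≤ pos (b j))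
  lab_cross : ∀ t, 1 ≤ t → t ≤ q → ∀ i ∈ J, ∀ j ∈ J, ¬ (t ≤ pos (a i) ↔ t ≤ pos (b i)) →
    ¬ (t ≤ pos (a j) ↔ t ≤ pos (b j)) → lab (a i) = lab (a j)
  separate : ∀ t t', 1 ≤ t → t < t' → t' ≤ q → ∃ j ∈ J,
    ¬ ((t ≤ pos (a j) ↔ t ≤ pos (b j)) ↔ (t' ≤ pos (a j) ↔ t' ≤ pos (b j)))

namespace LineLinks

variable {V E : Type*} {pos lab : V → ℕ} {J : Set E} {a b : E → V} {q : ℕ}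

/-- Reversing the line turns the cut at `t` into the cut at `q + 1 - t`, so that a result about the
point after a cut also covers the point before it. -/
theorem mirror (h : LineLinks pos lab J a b q) :
    LineLinks (fun v => q - pos v) lab J a b q := by
  have key : ∀ t, 1 ≤ t → t ≤ q → ∀ v, (t ≤ q - pos v ↔ ¬ (q + 1 - t ≤ pos v)) := by
    intro t h1 h2 v
    have := h.pos_le v
    omega
  have heq : ∀ u v, q - pos u = q - pos v ↔ pos u = pos v := by
    intro u v
    have := h.pos_le v
    have := h.pos_le u
    omega
  refine ⟨fun v => by omega, fun t ht => ?_, fun u v huv => h.lab_of_pos u v ((heq u v).1 huv),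
    h.lab_link, fun S hS => h.finest S fun u v huv => hS u v ((heq u v).2 huv), ?_, ?_, ?_⟩
  · obtain ⟨v, hv⟩ := h.exists_pos (q - t) (by omega)
    exact ⟨v, by omega⟩
  · intro t h1 h2
    simp only [key t h1 h2, not_iff_not]
    exact h.exists_cross _ (by omega) (by omega)
  · intro t h1 h2
    simp only [key t h1 h2, not_iff_not]
    exact h.lab_cross _ (by omega) (by omega)
  · intro t t' h1 h2 h3
    simp only [key t h1 (by omega), key t' (by omega) h3, not_iff_not]
    obtain ⟨j, hj, hj'⟩ := h.separate (q + 1 - t') (q + 1 - t) (by omega) (by omega) (by omega)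
    exact ⟨j, hj, fun hh => hj' hh.symm⟩

/-- Suppose the class of `v` is not the one that crosses the cut at `t`. Then it stays on its side
of this cut. The crossing class has points on both sides but none at position `t`, so it also
crosses the cut at `t + 1`, which the class of `v` therefore cannot cross either. Thus the class of
`v` is confined to position `t`, every link crosses both cuts or neither, and `separate` is
violated. -/
theorem lab_eq_of_cross (h : LineLinks pos lab J a b q) {t : ℕ} (h1 : 1 ≤ t) (h2 : t ≤ q) {i : E}
    (hi : i ∈ J) (hc : ¬ (t ≤ pos (a i) ↔ t ≤ pos (b i))) {v : V} (hv : pos v = t) :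
    lab v = lab (a i) := by
  by_contra hne
  have hcross := h.lab_cross t h1 h2
  -- No link of this class crosses the cut, so its part beyond the cut is closed under links.
  have above : ∀ u, lab u = lab v → t ≤ pos u := by
    intro u hu
    have := h.finest (fun w => t ≤ pos w ∧ lab w = lab v)
      (fun x y hxy => by rw [hxy, h.lab_of_pos x y hxy])
      (fun j hj => by
        have hl := h.lab_link j hj
        have := hcross i hi j hj hc
        rw [← hl]
        by_cases hjv : lab (a j) = lab v
        · have : (t ≤ pos (a j) ↔ t ≤ pos (b j)) := by
            by_contra hh
            exact hne (hjv ▸ (this hh).symm)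
          rw [this]
        · simp [hjv]) v u hu.symm
    exact (this.1 ⟨hv.ge, rfl⟩).1
  obtain ⟨k, hk, hkt⟩ : ∃ k, lab k = lab (a i) ∧ pos k < t := by
    by_cases hp : t ≤ pos (a i)
    · exact ⟨b i, (h.lab_link i hi).symm, by by_contra hh; exact hc ⟨fun _ => by omega, fun _ => hp⟩⟩
    · exact ⟨a i, rfl, by omega⟩
  obtain ⟨l, hl, hlt⟩ : ∃ k, lab k = lab (a i) ∧ t + 1 ≤ pos k := by
    have : ∃ k, lab k = lab (a i) ∧ t ≤ pos k := by
      by_cases hp : t ≤ pos (a i)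
      · exact ⟨a i, rfl, hp⟩
      · exact ⟨b i, (h.lab_link i hi).symm, by
          by_contra hh; exact hc ⟨fun _ => by omega, fun _ => by omega⟩⟩
    obtain ⟨l, hl, hlt⟩ := this
    refine ⟨l, hl, ?_⟩
    -- Points in the same position carry the same label, so the crossing class has to skip position
    -- `t`.
    have : pos l ≠ pos v := fun e => hne ((h.lab_of_pos _ _ e).symm.trans hl)
    omega
  have hq : t + 1 ≤ q := hlt.trans (h.pos_le l)
  obtain ⟨j, hj, hjc, hjl⟩ : ∃ j ∈ J, ¬ (t + 1 ≤ pos (a j) ↔ t + 1 ≤ pos (b j)) ∧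
      lab (a j) = lab (a i) := by
    by_contra! hno
    have := h.finest (fun w => t + 1 ≤ pos w ∧ lab w = lab (a i))
      (fun x y hxy => by rw [hxy, h.lab_of_pos x y hxy])
      (fun j hj => by
        have hl := h.lab_link j hj
        rw [← hl]
        by_cases hjv : lab (a j) = lab (a i)
        · have : (t + 1 ≤ pos (a j) ↔ t + 1 ≤ pos (b j)) := by
            by_contra hh
            exact hno j hj (by omega) hjv
          rw [this]
        · simp [hjv]) l k (hl.trans hk.symm)
    have := (this.1 ⟨hlt, hl⟩).1
    omega
  have below : ∀ u, lab u = lab v → pos u = t := by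
    intro u hu
    have h3 := above u hu
    have := h.finest (fun w => ¬ (t + 1 ≤ pos w) ∧ lab w = lab v)
      (fun x y hxy => by rw [hxy, h.lab_of_pos x y hxy])
      (fun j' hj' => by
        have hl := h.lab_link j' hj'
        rw [← hl]
        by_cases hjv : lab (a j') = lab v
        · have : (t + 1 ≤ pos (a j') ↔ t + 1 ≤ pos (b j')) := by
            by_contra hh
            have := h.lab_cross (t + 1) (by omega) hq j hj j' hj' hjc hh
            exact hne (hjv ▸ (this.symm.trans hjl))
          rw [this]
        · simp [hjv]) v u hu.symm
    have := (this.1 ⟨by omega, rfl⟩).1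
    omega
  obtain ⟨j', hj', hsep⟩ := h.separate t (t + 1) h1 (by omega) hq
  have hl := h.lab_link j' hj'
  have hx : ∀ x : V, ∀ y : V, lab x = lab y → pos x = t → pos y = t := fun x y hxy hxt =>
    below y (hxy.symm.trans (h.lab_of_pos _ _ (hxt.trans hv.symm)))
  have h5 := hx _ _ hl
  have h6 := hx _ _ hl.symm
  by_cases h7 : pos (a j') = t
  · have := h5 h7
    exact hsep (by simp [h7, this])
  · have : pos (b j') ≠ t := fun hh => h7 (h6 hh)
    apply hsep
    omega

/-- Both points next to a gap belong to the class of a link across it: one by `lab_eq_of_cross`, the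
other by its mirror image. -/
theorem lab_eq (h : LineLinks pos lab J a b q) (u v : V) : lab u = lab v := by
  have step : ∀ t, t < q → ∀ u v, pos u = t → pos v = t + 1 → lab u = lab v := by
    intro t ht u v hu hv
    obtain ⟨i, hi, hc⟩ := h.exists_cross (t + 1) (by omega) (by omega)
    rw [h.lab_eq_of_cross (by omega) (by omega) hi hc hv]
    have hpa := h.pos_le (a i)
    have hpb := h.pos_le (b i)
    exact h.mirror.lab_eq_of_cross (t := q - t) (by omega) (by omega) hi
      (fun hh => hc (by omega)) (by show q - pos u = _; rw [hu])
  obtain ⟨r, hr⟩ := h.exists_pos 0 (by omega)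
  have all : ∀ t ≤ q, ∀ v, pos v = t → lab v = lab r := by
    intro t
    induction t with
    | zero => exact fun _ v hv => h.lab_of_pos _ _ (hv.trans hr.symm)
    | succ t ih =>
      intro ht v hv
      obtain ⟨w, hw⟩ := h.exists_pos t (by omega)
      rw [← step t (by omega) w v hw hv, ih (by omega) w hw]
  rw [all _ (h.pos_le u) u rfl, all _ (h.pos_le v) v rfl]

end LineLinks

end CycleLattice

namespace CycleLattice

/-! ### Chains of sets -/

open Classical in
-- The rank of `e` is the number of sets of the chain that contain the set of `e`, so a point is in
-- this set if and only if it lies in at least that many sets. The pairs in `ends` differ in one set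
-- only; hence the sets are distinct, the ranks fill `1, …, R.card`, and every position occurs.
theorem exists_rank_of_chain {ι V : Type*} (R : Finset ι) (far : ι → V → Prop) (pos : V → ℕ)
    (hpos : ∀ v, pos v = {e ∈ R | far e v}.card)
    (chain : ∀ e ∈ R, ∀ e' ∈ R, (∀ v, far e v → far e' v) ∨ ∀ v, far e' v → far e v)
    (ends : ∀ e ∈ R, ∃ p q, far e q ∧ ¬ far e p ∧ ∀ e' ∈ R, e' ≠ e → (far e' p ↔ far e' q)) :
    ∃ rank : ι → ℕ, (∀ e ∈ R, 1 ≤ rank e ∧ rank e ≤ R.card ∧ ∀ v, far e v ↔ rank e ≤ pos v) ∧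
      (∀ t, 1 ≤ t → t ≤ R.card → ∃ e ∈ R, rank e = t) ∧
      (R.Nonempty → ∀ t ≤ R.card, ∃ v, pos v = t) := by
  let rank : ι → ℕ := fun e => {e' ∈ R | ∀ v, far e v → far e' v}.card
  have h1 : ∀ e ∈ R, 1 ≤ rank e ∧ rank e ≤ R.card := fun e he =>
    ⟨Finset.card_pos.2 ⟨e, by simp [he]⟩, Finset.card_filter_le _ _⟩
  have h2 : ∀ e ∈ R, ∀ v, far e v ↔ rank e ≤ pos v := by
    intro e he v
    rw [hpos]
    refine ⟨fun h => Finset.card_le_card fun e' he' => ?_, fun h => ?_⟩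
    · simp only [Finset.mem_filter] at he' ⊢
      exact ⟨he'.1, he'.2 v h⟩
    · by_contra hv
      refine absurd h (not_le.2 (Finset.card_lt_card ⟨fun e' he' => ?_, fun hh => ?_⟩))
      · simp only [Finset.mem_filter] at he' ⊢
        refine ⟨he'.1, (chain e he e' he'.1).resolve_right fun hc => hv (hc v he'.2)⟩
      · have := hh (show e ∈ _ by simp [he])
        simp [hv] at this
  have inj : Set.InjOn rank R := by
    intro e he e' he' hr
    by_contra hne
    obtain ⟨p, q, hq, hp, hpq⟩ := ends e he
    have := hpq e' he' (Ne.symm hne)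
    rw [h2 e' he', h2 e' he', ← hr, ← h2 e he, ← h2 e he] at this
    exact hp (this.2 hq)
  have surj : ∀ t, 1 ≤ t → t ≤ R.card → ∃ e ∈ R, rank e = t := by
    intro t ht ht'
    have himg : R.image rank = Finset.Icc 1 R.card := by
      apply Finset.eq_of_subset_of_card_le
      · intro x hx
        obtain ⟨e, he, rfl⟩ := Finset.mem_image.1 hx
        exact Finset.mem_Icc.2 (h1 e he)
      · rw [Finset.card_image_of_injOn inj]
        simp
    have := himg.symm ▸ Finset.mem_Icc.2 ⟨ht, ht'⟩
    simpa using this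
  refine ⟨rank, fun e he => ⟨(h1 e he).1, (h1 e he).2, h2 e he⟩, surj, fun hR t ht => ?_⟩
  have hle : ∀ v, pos v ≤ R.card := fun v => hpos v ▸ Finset.card_filter_le _ _
  rcases Nat.eq_zero_or_pos t with rfl | htp
  · obtain ⟨e, he, hr⟩ := surj 1 le_rfl (Finset.card_pos.2 hR)
    obtain ⟨p, q, hq, hp, hpq⟩ := ends e he
    exact ⟨p, by rw [h2 e he, hr] at hp; omega⟩
  · obtain ⟨e, he, hr⟩ := surj t htp ht
    obtain ⟨p, q, hq, hp, hpq⟩ := ends e he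
    rw [h2 e he, hr] at hp hq
    refine ⟨q, le_antisymm ?_ hq⟩
    -- Otherwise the set of rank `t + 1` contains `q` and therefore also `p`, whose position is
    -- below `t`.
    by_contra hlt
    obtain ⟨e', he', hr'⟩ := surj (t + 1) (by omega) (by have := hle q; omega)
    have := hpq e' he' (by rintro rfl; omega)
    rw [h2 e' he', h2 e' he', hr'] at this
    omega

/-! ### Rooted trees and the edges outside -/

/-- A rooted tree on `Fin n` and the ends of the members of `Fin m`, some of which are marked as
tree edges. The tree edge from `w` to its parent is denoted by `w`; `anc v w` says that it lies on the
path from `v` to the root. -/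
structure RootedTree (n m : ℕ) where
  root : Fin n
  par : Fin n → Fin n
  anc : Fin n → Fin n → Prop
  src : Fin m → Fin n
  tgt : Fin m → Fin n
  tree : Fin m → Prop
  anc_root : ∀ v, ¬ anc root v
  anc_iff : ∀ v, v ≠ root → ∀ w, anc v w ↔ w = v ∨ anc (par v) w
  anc_par : ∀ v, v ≠ root → ¬ anc (par v) v

namespace RootedTree

variable {n m : ℕ} (D : RootedTree n m)

open Classical in
noncomputable def depth (v : Fin n) : ℕ := Finset.card {w | D.anc v w}

theorem depth_par {v : Fin n} (hv : v ≠ D.root) : D.depth (D.par v) + 1 = D.depth v := by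
  classical
  have : (Finset.univ.filter fun w => D.anc v w) =
      insert v (Finset.univ.filter fun w => D.anc (D.par v) w) := by
    ext w
    simp [D.anc_iff v hv w]
  rw [depth, depth, this, Finset.card_insert_of_notMem (by simp [D.anc_par v hv])]

/-- The depth, being the number of ancestors, drops by one at each step to the parent. -/
theorem induction_par {C : Fin n → Prop} (hr : C D.root)
    (hs : ∀ v, v ≠ D.root → C (D.par v) → C v) (v : Fin n) : C v := by
  suffices ∀ d v, D.depth v = d → C v from this _ v rfl
  intro d
  induction d with
  | zero =>
    intro v hv
    by_cases h : v = D.root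
    · exact h ▸ hr
    · have := D.depth_par h
      omega
  | succ d ih =>
    intro v hv
    by_cases h : v = D.root
    · exact h ▸ hr
    · have := D.depth_par h
      exact hs v h (ih _ (by omega))

theorem not_anc_root (v : Fin n) : ¬ D.anc v D.root := by
  induction v using D.induction_par with
  | hr => exact D.anc_root _
  | hs v hv ih =>
    rw [D.anc_iff v hv]
    rintro (h | h)
    · exact hv h.symm
    · exact ih h

theorem anc_trans {u v w : Fin n} (h : D.anc u v) (h' : D.anc v w) : D.anc u w := by
  induction u using D.induction_par with
  | hr => exact absurd h (D.anc_root _)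
  | hs u hu ih =>
    rw [D.anc_iff u hu] at h ⊢
    rcases h with rfl | h
    · rwa [D.anc_iff v hu] at h'
    · exact .inr (ih h)

/-- The sets are the vertex sets of subtrees. Two tree edges above a common vertex both lie on its
path to the root and are comparable there. -/
theorem laminar (e e' : Fin n) : (∀ v, D.anc v e → D.anc v e') ∨ (∀ v, D.anc v e' → D.anc v e) ∨
    ∀ v, ¬ (D.anc v e ∧ D.anc v e') := by
  by_cases h : ∃ v, D.anc v e ∧ D.anc v e'
  · obtain ⟨v, hv⟩ := h
    have : D.anc e e' ∨ D.anc e' e ∨ e = e' := by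
      induction v using D.induction_par with
      | hr => exact absurd hv.1 (D.anc_root _)
      | hs v hv' ih =>
        by_cases h1 : e = v
        · subst h1
          by_cases h2 : e' = e
          · exact .inr (.inr h2.symm)
          · exact .inl hv.2
        · by_cases h2 : e' = v
          · subst h2
            exact .inr (.inl hv.1)
          · rw [D.anc_iff v hv', D.anc_iff v hv'] at hv
            exact ih ⟨hv.1.resolve_left h1, hv.2.resolve_left h2⟩
    rcases this with h | h | rfl
    · exact .inl fun v hv => D.anc_trans hv h
    · exact .inr (.inl fun v hv => D.anc_trans hv h)
    · exact .inl fun v hv => hv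
  · exact .inr (.inr fun v hv => h ⟨v, hv⟩)

/-- The edge `f` is outside the tree, and the tree edge `v` lies on the tree path between its ends. -/
def cov (f : Fin m) (v : Fin n) : Prop := ¬ D.tree f ∧ ¬ (D.anc (D.src f) v ↔ D.anc (D.tgt f) v)

open Classical in
/-- The edges with number less than `i` that cover the tree edge `v`. -/
noncomputable def sig (i : ℕ) (v : Fin n) : Finset (Fin m) := {f | f.val < i ∧ D.cov f v}

theorem mem_sig {i : ℕ} {v : Fin n} {f : Fin m} : f ∈ D.sig i v ↔ f.val < i ∧ D.cov f v := by
  simp [sig]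

open Classical in
/-- The tree edges that are covered by both members of a pair. -/
noncomputable def overlap (p : Fin m × Fin m) : Fin n → ℤ :=
  fun v => if D.cov p.1 v ∧ D.cov p.2 v then 1 else 0

/-- The functions on the tree edges that depend only on the set of covering edges with number less
than `i` and vanish if there are fewer than two. -/
noncomputable def lat (i : ℕ) : Submodule ℤ (Fin n → ℤ) where
  carrier := {z | (∀ v, (D.sig i v).card ≤ 1 → z v = 0) ∧ ∀ v w, D.sig i v = D.sig i w → z v = z w}
  add_mem' := fun {x y} hx hy => ⟨fun v hv => by simp [hx.1 v hv, hy.1 v hv],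
    fun v w h => by simp [hx.2 v w h, hy.2 v w h]⟩
  zero_mem' := ⟨fun _ _ => rfl, fun _ _ _ => rfl⟩
  smul_mem' := fun c x hx => ⟨fun v hv => by simp [hx.1 v hv], fun v w h => by simp [hx.2 v w h]⟩

variable {D}

theorem mem_lat {i : ℕ} {z : Fin n → ℤ} : z ∈ D.lat i ↔
    (∀ v, (D.sig i v).card ≤ 1 → z v = 0) ∧ ∀ v w, D.sig i v = D.sig i w → z v = z w := Iff.rfl

open Classical in
theorem sig_succ (f : Fin m) (v : Fin n) :
    D.sig (f + 1) v = if D.cov f v then insert f (D.sig f v) else D.sig f v := by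
  ext g
  have : g.val < f.val + 1 ↔ g.val < f.val ∨ g = f := by rw [Fin.ext_iff]; omega
  split_ifs with h <;> simp only [mem_sig, this, Finset.mem_insert]
  · constructor
    · rintro ⟨h1 | rfl, h2⟩ <;> tauto
    · rintro (rfl | h1) <;> tauto
  · constructor
    · rintro ⟨h1 | rfl, h2⟩ <;> tauto
    · tauto

theorem sig_subset_succ (f : Fin m) (v : Fin n) : D.sig f v ⊆ D.sig (f + 1) v := by
  intro g
  simp only [mem_sig]
  exact fun h => ⟨by omega, h.2⟩

theorem sig_eq_of_succ {f : Fin m} {v w : Fin n} (h : D.sig (f + 1) v = D.sig (f + 1) w) :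
    D.sig f v = D.sig f w ∧ (D.cov f v ↔ D.cov f w) := by
  simp only [Finset.ext_iff, mem_sig] at h ⊢
  refine ⟨fun g => ?_, ?_⟩
  · have := h g
    by_cases hg : g.val < f.val
    · simpa [hg, Nat.lt_succ_of_lt hg] using this
    · simp [hg]
  · simpa using h f

theorem sig_succ_eq {f : Fin m} {v w : Fin n} (h : D.sig f v = D.sig f w)
    (h' : D.cov f v ↔ D.cov f w) : D.sig (f + 1) v = D.sig (f + 1) w := by
  classical
  rw [sig_succ, sig_succ, h]
  simp [h']

theorem lat_le_succ (f : Fin m) : D.lat f ≤ D.lat (f + 1) := fun _ hz =>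
  ⟨fun v hv => hz.1 v ((Finset.card_le_card (sig_subset_succ f v)).trans hv),
    fun v w h => hz.2 v w (sig_eq_of_succ h).1⟩

/-- Where both edges cover, there are two covering edges; and whether they cover can be read off
from `sig (f + 1)`. -/
theorem overlap_mem_lat {f j : Fin m} (hj : j < f) : D.overlap (f, j) ∈ D.lat (f + 1) := by
  classical
  refine ⟨fun v hv => ?_, fun v w h => ?_⟩
  · simp only [overlap, ite_eq_right_iff, one_ne_zero, imp_false]
    rintro ⟨h1, h2⟩
    have : ({f, j} : Finset (Fin m)) ⊆ D.sig (f + 1) v := by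
      intro g hg
      simp only [Finset.mem_insert, Finset.mem_singleton] at hg
      rcases hg with rfl | rfl
      · exact mem_sig _ |>.2 ⟨by omega, h1⟩
      · exact mem_sig _ |>.2 ⟨by omega, h2⟩
    have := Finset.card_le_card this
    rw [Finset.card_pair hj.ne'] at this
    omega
  · simp only [Finset.ext_iff, mem_sig] at h
    have h1 := h f
    have h2 := h j
    have : j.val < f.val + 1 := by omega
    simp only [Nat.lt_succ_self, this, true_and] at h1 h2
    exact if_congr (and_congr h1 h2) rfl rfl

variable (D) in
/-- The overlaps of the pairs in `Q` form a basis of `D.lat i`. -/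
def IsPairBasis (i : ℕ) (Q : Finset (Fin m × Fin m)) : Prop :=
  LinearIndepOn ℤ D.overlap (Q : Set (Fin m × Fin m)) ∧
    Submodule.span ℤ (D.overlap '' Q) = D.lat i

theorem IsPairBasis.zero : D.IsPairBasis 0 ∅ := by
  refine ⟨by simp, ?_⟩
  simp only [Finset.coe_empty, Set.image_empty, Submodule.span_empty]
  refine (Submodule.eq_bot_iff _).2 (fun _ hz => ?_) |>.symm
  funext v
  exact hz.1 v (by simp [sig])

/-- The rank of `ℤ^n` limits the number of pairs, and with it the number of expensive scans of the
program. -/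
theorem IsPairBasis.card_le {i : ℕ} {Q : Finset (Fin m × Fin m)} (h : D.IsPairBasis i Q) :
    Q.card ≤ n := by
  have h1 : LinearIndependent ℤ (fun x : Q => D.overlap x) := h.1
  have := h1.fintype_card_le_finrank
  simpa using this

theorem IsPairBasis.succ_of_tree {f : Fin m} {Q : Finset (Fin m × Fin m)}
    (h : D.IsPairBasis f Q) (hf : D.tree f) : D.IsPairBasis (f + 1) Q := by
  have : D.lat (f + 1) = D.lat f := by
    have : ∀ v, D.sig (f + 1) v = D.sig f v := by
      classical
      intro v
      simp [sig_succ, cov, hf]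
    ext z
    simp [mem_lat, this]
  exact ⟨h.1, this ▸ h.2⟩

variable (D) in
/-- A set of representatives of those classes of tree edges that are split if the edge `f` is added. -/
structure IsRepSet (f : Fin m) (R : Finset (Fin n)) : Prop where
  cov : ∀ e ∈ R, D.cov f e
  nonempty : ∀ e ∈ R, (D.sig f e).Nonempty
  inj : ∀ e ∈ R, ∀ e' ∈ R, D.sig f e = D.sig f e' → e = e'
  single_or : ∀ e ∈ R, (D.sig f e).card = 1 ∨ ∃ y, ¬ D.cov f y ∧ D.sig f y = D.sig f e
  exists_rep : ∀ v, D.cov f v → ((D.sig f v).card = 1 ∨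
    1 < (D.sig f v).card ∧ ∃ y, ¬ D.cov f y ∧ D.sig f y = D.sig f v) →
    ∃ e ∈ R, D.sig f e = D.sig f v

variable (D) in
open Classical in
/-- The incidence vector of the tree path of `j`, restricted to `R`. -/
noncomputable def row (R : Finset (Fin n)) (j : Fin m) : R → ℤ := fun e => if D.cov j e then 1 else 0

/-- The map `δ` compares the value at a representative `e` with the value that `lat f` prescribes
for it: zero if `e` was covered once, otherwise the value at a member `y e` of the same old class
off the path of `f`. On `lat (f + 1)` its kernel is exactly `lat f`, and it sends the overlap of `f`
and `j` to the row of `j`. So a basis of `lat f` and preimages of a basis of `ℤ^R` combine to a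
basis of `lat (f + 1)`. -/
theorem IsPairBasis.succ {f : Fin m} {Q : Finset (Fin m × Fin m)} {R : Finset (Fin n)}
    {M : Finset (Fin m)} (h : D.IsPairBasis f Q) (hR : D.IsRepSet f R) (hM : ∀ j ∈ M, j < f)
    (hi : LinearIndepOn ℤ (D.row R) (M : Set (Fin m)))
    (hs : Submodule.span ℤ (D.row R '' M) = ⊤) :
    D.IsPairBasis (f + 1) (Q ∪ {f} ×ˢ M) := by
  classical
  choose! y hy using fun e (he : e ∈ R ∧ (D.sig f e).card ≠ 1) =>
    (hR.single_or e he.1).resolve_left he.2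
  let δ : (Fin n → ℤ) →ₗ[ℤ] (R → ℤ) :=
    { toFun := fun z e => z e - if (D.sig f e).card = 1 then 0 else z (y e)
      map_add' := fun a b => by
        funext e
        simp only [Pi.add_apply]
        split_ifs <;> ring
      map_smul' := fun a b => by
        funext e
        simp only [Pi.smul_apply, smul_eq_mul, eq_intCast, Int.cast_id]
        split_ifs <;> ring }
  have hδ : ∀ z e, δ z e = z e - if (D.sig f e).card = 1 then 0 else z (y e) := fun _ _ => rfl
  have hker : ∀ z ∈ D.lat f, δ z = 0 := by
    intro z hz
    funext e
    rw [hδ]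
    split_ifs with h1
    · simp [hz.1 e h1.le]
    · simp [hz.2 _ _ (hy e ⟨e.2, h1⟩).2]
  have hrow : ∀ j, δ (D.overlap (f, j)) = D.row R j := by
    intro j
    funext e
    rw [hδ]
    have h1 := hR.cov e e.2
    split_ifs with h2
    · simp [overlap, row, h1]
    · simp [overlap, row, h1, (hy e ⟨e.2, h2⟩).1]
  have himg : D.overlap '' ((Q ∪ {f} ×ˢ M : Finset (Fin m × Fin m)) : Set (Fin m × Fin m)) =
      D.overlap '' Q ∪ (fun j => D.overlap (f, j)) '' M := by
    ext z
    simp only [Finset.coe_union, Finset.coe_product, Finset.coe_singleton, Set.image_union,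
      Set.mem_union, Set.mem_image, Set.mem_prod, Set.mem_singleton_iff, Finset.mem_coe, Prod.exists]
    constructor
    · rintro (h | ⟨a, b, ⟨rfl, hb⟩, rfl⟩)
      · exact .inl h
      · exact .inr ⟨b, hb, rfl⟩
    · rintro (h | ⟨b, hb, rfl⟩)
      · exact .inl h
      · exact .inr ⟨f, b, ⟨rfl, hb⟩, rfl⟩
  have hcomp : LinearIndependent ℤ (δ ∘ fun j : M => D.overlap (f, j)) := by
    have : (δ ∘ fun j : M => D.overlap (f, j)) = fun j : M => D.row R j := funext fun j => hrow j
    rw [this]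
    exact hi
  refine ⟨?_, ?_⟩
  · rw [Finset.coe_union]
    refine h.1.union ?_ ?_
    · have h1 : LinearIndepOn ℤ (fun j => D.overlap (f, j)) (M : Set (Fin m)) := hcomp.of_comp
      have h2 : (({f} ×ˢ M : Finset (Fin m × Fin m)) : Set (Fin m × Fin m)) =
          (fun j => (f, j)) '' (M : Set (Fin m)) := by
        ext ⟨a, b⟩
        simp only [Finset.coe_product, Finset.coe_singleton, Set.mem_prod, Set.mem_singleton_iff,
          Finset.mem_coe, Set.mem_image, Prod.mk.injEq]
        constructor
        · rintro ⟨rfl, hb⟩; exact ⟨b, hb, rfl, rfl⟩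
        · rintro ⟨x, h, rfl, rfl⟩; exact ⟨rfl, h⟩
      rw [h2]
      exact LinearIndepOn.image_of_comp (fun j : Fin m => (f, j)) D.overlap h1
    -- Since the images under `δ` are independent, the span of the new overlaps meets the kernel
    -- only in zero, and the old overlaps are in the kernel.
    · have h1 := Submodule.range_ker_disjoint hcomp
      have h2 : Set.range (fun j : M => D.overlap (f, j)) =
          D.overlap '' (({f} ×ˢ M : Finset (Fin m × Fin m)) : Set (Fin m × Fin m)) := by
        ext z
        simp
      rw [h2] at h1
      refine h1.symm.mono_left ?_
      rw [h.2]
      exact fun z hz => hker z hz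
  · rw [himg, Submodule.span_union, h.2]
    apply le_antisymm
    · refine sup_le (lat_le_succ f) (Submodule.span_le.2 ?_)
      rintro _ ⟨j, hj, rfl⟩
      exact overlap_mem_lat (hM j hj)
    · intro z hz
      have hz1 : δ z ∈ Submodule.span ℤ (D.row R '' M) := hs ▸ Submodule.mem_top
      have hz2 : D.row R '' M = δ '' ((fun j => D.overlap (f, j)) '' M) := by
        rw [Set.image_image]
        exact Set.image_congr fun j _ => (hrow j).symm
      rw [hz2, ← Submodule.map_span] at hz1
      obtain ⟨x, hx, hxz⟩ := hz1
      have hx' : x ∈ D.lat (f + 1) := by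
        refine Submodule.span_le.2 ?_ hx
        rintro _ ⟨j, hj, rfl⟩
        exact overlap_mem_lat (hM j hj)
      have hz' : z - x ∈ D.lat (f + 1) := sub_mem hz hx'
      have hzero : δ (z - x) = 0 := by rw [map_sub, hxz, sub_self]
      -- Here `x` is a combination of new overlaps with the same image as `z`. It remains to show
      -- that an element of `lat (f + 1)` in the kernel of `δ` is in `lat f`.
      suffices z - x ∈ D.lat f by
        rw [← sub_add_cancel z x]
        exact Submodule.add_mem_sup this hx
      generalize z - x = w at hz' hzero
      have hval : ∀ v, D.cov f v → ∀ e (he : e ∈ R), D.sig f e = D.sig f v →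
          w v = if (D.sig f e).card = 1 then 0 else w (y e) := by
        intro v hv e he hev
        have h1 := congrFun hzero ⟨e, he⟩
        rw [hδ] at h1
        rw [hz'.2 v e (sig_succ_eq hev.symm (by simp [hv, hR.cov e he]))]
        simpa [sub_eq_zero] using h1
      have hsmall : ∀ v, (D.sig f v).card ≤ 1 → w v = 0 := by
        intro v hv
        by_cases hc : D.cov f v
        · rcases Nat.lt_or_ge (D.sig f v).card 1 with h0 | h0
          · refine hz'.1 v ?_
            rw [sig_succ, if_pos hc]
            exact (Finset.card_insert_le _ _).trans (by omega)
          · obtain ⟨e, he, hev⟩ := hR.exists_rep v hc (.inl (by omega))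
            rw [hval v hc e he hev, hev, if_pos (by omega)]
        · exact hz'.1 v (by rwa [sig_succ, if_neg hc])
      -- In an old class that is split, the covered part takes the value at `y e` because `δ`
      -- vanishes, and the uncovered part contains `y e`.
      have hmix : ∀ v u, D.cov f v → ¬ D.cov f u → D.sig f v = D.sig f u → w v = w u := by
        intro v u hv hu hvu
        rcases Nat.lt_or_ge 1 (D.sig f v).card with h1 | h1
        · obtain ⟨e, he, hev⟩ := hR.exists_rep v hv (.inr ⟨h1, u, hu, hvu.symm⟩)
          have h2 : (D.sig f e).card ≠ 1 := by rw [hev]; omega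
          have h3 := hy e ⟨he, h2⟩
          rw [hval v hv e he hev, if_neg h2]
          exact hz'.2 _ _ (sig_succ_eq (h3.2.trans (hev.trans hvu)) (by simp [h3.1, hu]))
        · rw [hsmall v h1, hsmall u (hvu ▸ h1)]
      refine ⟨hsmall, fun v u hvu => ?_⟩
      by_cases hv : D.cov f v <;> by_cases hu : D.cov f u
      · exact hz'.2 _ _ (sig_succ_eq hvu (by simp [hv, hu]))
      · exact hmix v u hv hu hvu
      · exact (hmix u v hu hv hvu.symm).symm
      · exact hz'.2 _ _ (sig_succ_eq hvu (by simp [hv, hu]))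

end RootedTree

end CycleLattice

/-! ### Positions along the tree path of an edge, and the choice of pairs -/

namespace CycleLattice

namespace RootedTree

variable {n m : ℕ} (D : RootedTree n m)

/-- If the tree edge `e` is on the tree path of `f`: the vertex `v` is on the same side of `e` as the
target of `f`. -/
def far (f : Fin m) (e v : Fin n) : Prop := D.anc v e ↔ D.anc (D.tgt f) e

open Classical in
/-- The number of members of `R` that separate `v` from the source of `f`, if `R` is on the tree path
of `f`. -/
noncomputable def pos (f : Fin m) (R : Finset (Fin n)) (v : Fin n) : ℕ := {e ∈ R | D.far f e v}.card

variable {D} {f : Fin m} {R : Finset (Fin n)}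

theorem pos_le (v : Fin n) : D.pos f R v ≤ R.card := by
  classical
  exact Finset.card_filter_le _ _

/-- The sets are subtrees or complements of subtrees. All of them contain the target of `f` and none
contains the source; this turns each case of laminarity into an inclusion. -/
theorem far_chain {e e' : Fin n} (he : D.cov f e) (he' : D.cov f e') :
    (∀ v, D.far f e v → D.far f e' v) ∨ ∀ v, D.far f e' v → D.far f e v := by
  simp only [cov, far] at *
  have h := D.laminar e e'
  have hs := he.2
  have hs' := he'.2
  by_cases hb : D.anc (D.tgt f) e <;> by_cases hb' : D.anc (D.tgt f) e' <;>
    simp only [hb, hb', iff_true, iff_false, not_not] at hs hs' ⊢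
  · rcases h with h | h | h
    · exact .inl h
    · exact .inr h
    · exact absurd ⟨hb, hb'⟩ (h _)
  · rcases h with h | h | h
    · exact absurd (h _ hb) hb'
    · exact absurd (h _ hs') hs
    · exact .inl fun v hv hv' => h v ⟨hv, hv'⟩
  · rcases h with h | h | h
    · exact absurd (h _ hs) hs'
    · exact absurd (h _ hb') hb
    · exact .inr fun v hv hv' => h v ⟨hv', hv⟩
  · rcases h with h | h | h
    · exact .inr fun v hv hv' => hv (h v hv')
    · exact .inl fun v hv hv' => hv (h v hv')
    · exact absurd ⟨hs, hs'⟩ (h _)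

theorem ne_root_of_cov {e : Fin n} (he : D.cov f e) : e ≠ D.root := by
  rintro rfl
  exact he.2 (by simp [D.not_anc_root])

theorem far_par {e : Fin n} (he : e ≠ D.root) : ¬ (D.far f e e ↔ D.far f e (D.par e)) := by
  have h1 : D.anc e e := (D.anc_iff e he e).2 (.inl rfl)
  have h2 := D.anc_par e he
  simp only [far]
  tauto

/-- Together with `far_par`: the two ends of a tree edge are separated by this edge and by no other.
These are the pairs that `exists_rank_of_chain` asks for. -/
theorem far_par_of_ne {e e' : Fin n} (he : e ≠ D.root) (hne : e' ≠ e) :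
    D.far f e' e ↔ D.far f e' (D.par e) := by
  have := D.anc_iff e he e'
  simp only [far]
  tauto

theorem exists_rank (hR : ∀ e ∈ R, D.cov f e) :
    ∃ rank : Fin n → ℕ,
      (∀ e ∈ R, 1 ≤ rank e ∧ rank e ≤ R.card ∧ ∀ v, D.far f e v ↔ rank e ≤ D.pos f R v) ∧
      (∀ t, 1 ≤ t → t ≤ R.card → ∃ e ∈ R, rank e = t) ∧
      (R.Nonempty → ∀ t ≤ R.card, ∃ v, D.pos f R v = t) := by
  refine exists_rank_of_chain R (D.far f) (D.pos f R) (fun _ => rfl)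
    (fun e he e' he' => far_chain (hR e he) (hR e' he')) fun e he => ?_
  have hr := ne_root_of_cov (hR e he)
  have h1 := far_par (f := f) hr
  by_cases h2 : D.far f e e
  · exact ⟨D.par e, e, h2, by tauto, fun e' _ hne => (far_par_of_ne hr hne).symm⟩
  · exact ⟨e, D.par e, by tauto, h2, fun e' _ hne => far_par_of_ne hr hne⟩

theorem far_iff_of_pos_eq (hR : ∀ e ∈ R, D.cov f e) {u v : Fin n} (h : D.pos f R u = D.pos f R v)
    {e : Fin n} (he : e ∈ R) : D.far f e u ↔ D.far f e v := by
  obtain ⟨rank, h1, -, -⟩ := exists_rank hR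
  rw [(h1 e he).2.2, (h1 e he).2.2, h]

/-- The edges that cover a tree edge off the path of `f` have ends in a set of vertices with the same
position. -/
theorem pos_eq_of_off_path (hR : ∀ e ∈ R, D.cov f e) (hf : ¬ D.tree f) {y : Fin n}
    (hy : ¬ D.cov f y) {u v : Fin n} (hu : ¬ D.far f y u) (hv : ¬ D.far f y v) :
    D.pos f R u = D.pos f R v := by
  classical
  rw [pos, pos]
  congr 1
  refine Finset.filter_congr fun e he => ?_
  have hc := hR e he
  simp only [cov, far, hf, not_false_eq_true, true_and, not_not] at *
  -- The edge `e` separates the ends of `f`, whereas `y` does not and has `u` and `v` on the side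
  -- away from them. Laminarity tested at these four vertices then puts `u` and `v` on the same side
  -- of `e`.
  rcases D.laminar e y with h | h | h
  · have := h u
    have := h v
    have := h (D.src f)
    have := h (D.tgt f)
    grind
  · have := h u
    have := h v
    have := h (D.src f)
    have := h (D.tgt f)
    grind
  · have := h u
    have := h v
    have := h (D.src f)
    have := h (D.tgt f)
    grind

variable (D) in
/-- The outcome of the first `k` rounds of the search for pairs that contain `f`: the vertices in the
same position, and the ends of the edges in `M`, have been merged into the classes of `lab`. -/
structure IsMerged (f : Fin m) (R : Finset (Fin n)) (k : ℕ) (M : Finset (Fin m)) (lab : Fin n → ℕ) :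
    Prop where
  lt : ∀ j ∈ M, j.val < k ∧ ¬ D.tree j
  lab_of_pos : ∀ u v, D.pos f R u = D.pos f R v → lab u = lab v
  lab_link : ∀ j : Fin m, j.val < k → ¬ D.tree j → lab (D.src j) = lab (D.tgt j)
  card : (Finset.univ.image lab).card + M.card ≤ R.card + 1
  finest : ∀ s : Setoid (Fin n), (∀ u v, D.pos f R u = D.pos f R v → s u v) →
    (∀ j ∈ M, s (D.src j) (D.tgt j)) → ∀ u v, lab u = lab v → s u v
  overlap : ∀ j ∈ M, ∃ v, D.cov f v ∧ D.cov j v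

theorem IsMerged.zero : D.IsMerged f R 0 ∅ (D.pos f R) where
  lt := by simp
  lab_of_pos := fun _ _ h => h
  lab_link := by simp
  card := by
    have : Finset.univ.image (D.pos f R) ⊆ Finset.range (R.card + 1) := by
      intro x hx
      obtain ⟨v, -, rfl⟩ := Finset.mem_image.1 hx
      exact Finset.mem_range.2 (Nat.lt_succ_of_le (pos_le v))
    simpa using Finset.card_le_card this
  finest := fun s h1 _ u v h => h1 u v h
  overlap := by simp

theorem IsMerged.succ_of_skip {M : Finset (Fin m)} {lab : Fin n → ℕ} {j : Fin m}
    (h : D.IsMerged f R j M lab) (hj : ¬ D.tree j → lab (D.src j) = lab (D.tgt j)) :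
    D.IsMerged f R (j + 1) M lab where
  lt := fun i hi => ⟨(h.lt i hi).1.trans (Nat.lt_succ_self _), (h.lt i hi).2⟩
  lab_of_pos := h.lab_of_pos
  lab_link := fun i hi hi' => by
    rcases Nat.lt_succ_iff_lt_or_eq.1 hi with h1 | h1
    · exact h.lab_link i h1 hi'
    · obtain rfl := Fin.ext h1
      exact hj hi'
  card := h.card
  finest := h.finest
  overlap := h.overlap

/-- A class disappears whenever an edge is chosen, which keeps the sum in `card` bounded. The chosen
edge overlaps the path of `f`: otherwise its ends would have equal positions and hence equal labels
from the start. -/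
theorem IsMerged.succ_of_merge {M : Finset (Fin m)} {lab : Fin n → ℕ} {j : Fin m}
    (h : D.IsMerged f R j M lab) (hR : ∀ e ∈ R, D.cov f e) (ht : ¬ D.tree j)
    (hj : lab (D.src j) ≠ lab (D.tgt j)) :
    D.IsMerged f R (j + 1) (insert j M)
      (fun v => if lab v = lab (D.src j) then lab (D.tgt j) else lab v) where
  lt := fun i hi => by
    rcases Finset.mem_insert.1 hi with rfl | hi
    · exact ⟨Nat.lt_succ_self _, ht⟩
    · exact ⟨(h.lt i hi).1.trans (Nat.lt_succ_self _), (h.lt i hi).2⟩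
  lab_of_pos := fun u v huv => by simp [h.lab_of_pos u v huv]
  lab_link := fun i hi hi' => by
    rcases Nat.lt_succ_iff_lt_or_eq.1 hi with h1 | h1
    · simp [h.lab_link i h1 hi']
    · obtain rfl := Fin.ext h1
      simp
  card := by
    have hjM : j ∉ M := fun hh => (h.lt j hh).1.false
    have hsub : (Finset.univ.image fun v =>
        if lab v = lab (D.src j) then lab (D.tgt j) else lab v) ⊆
        (Finset.univ.image lab).erase (lab (D.src j)) := by
      intro x hx
      obtain ⟨v, -, rfl⟩ := Finset.mem_image.1 hx
      split_ifs with hv <;> simp [hv, hj.symm]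
    have h1 := Finset.card_le_card hsub
    have h2 : lab (D.src j) ∈ Finset.univ.image lab := Finset.mem_image_of_mem _ (Finset.mem_univ _)
    have h3 := Finset.card_erase_add_one h2
    rw [Finset.card_insert_of_notMem hjM]
    have := h.card
    omega
  finest := fun s h1 h2 u v huv => by
    have hM := h.finest s h1 fun i hi => h2 i (Finset.mem_insert_of_mem hi)
    have hl := h2 j (Finset.mem_insert_self _ _)
    -- Relabelling is modelled by moving `w` to the target of `j`, and an equivalence that respects
    -- all chosen links cannot tell these two vertices apart.
    have key : ∀ w, s w (if lab w = lab (D.src j) then D.tgt j else w) := by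
      intro w
      split_ifs with hw
      · exact s.trans (hM _ _ hw) hl
      · exact s.refl _
    refine s.trans (key u) (s.trans (hM _ _ ?_) (s.symm (key v)))
    split_ifs at huv ⊢ <;> exact huv
  overlap := fun i hi => by
    classical
    rcases Finset.mem_insert.1 hi with rfl | hi
    · by_contra! hno
      refine hj (h.lab_of_pos _ _ ?_)
      rw [pos, pos]
      congr 1
      refine Finset.filter_congr fun e he => ?_
      have := hno e (hR e he)
      simp only [cov, ht, not_false_eq_true, true_and, not_not] at this
      simp [far, this]
    · exact h.overlap i hi

theorem not_far_iff_iff_cov {j : Fin m} (hj : ¬ D.tree j) (e : Fin n) :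
    ¬ (D.far f e (D.src j) ↔ D.far f e (D.tgt j)) ↔ D.cov j e := by
  simp only [far, cov, hj, not_false_eq_true, true_and]
  tauto

/-- The representative of rank `t` is the cut at `t`, and the links across it are the edges that
cover it. It is crossed since its `sig` is nonempty, and two cuts are separated since the `sig`s
differ. If `sig` has one element, the link across is unique. Otherwise some `y` off the path of `f`
has the same `sig`; all links across the cut then have an end beyond `y`, and these ends share one
position. -/
theorem IsMerged.lineLinks {M : Finset (Fin m)} {lab : Fin n → ℕ}
    (h : D.IsMerged f R f M lab) (hf : ¬ D.tree f) (hR : D.IsRepSet f R) (hne : R.Nonempty) :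
    LineLinks (D.pos f R) lab {j : Fin m | j < f ∧ ¬ D.tree j} D.src D.tgt R.card := by
  obtain ⟨rank, h1, h2, h3⟩ := exists_rank hR.cov
  have hcov : ∀ t, 1 ≤ t → t ≤ R.card → ∃ e ∈ R, rank e = t ∧ ∀ j, ¬ D.tree j →
      (¬ (t ≤ D.pos f R (D.src j) ↔ t ≤ D.pos f R (D.tgt j)) ↔ D.cov j e) := by
    intro t ht ht'
    obtain ⟨e, he, rfl⟩ := h2 t ht ht'
    refine ⟨e, he, rfl, fun j hj => ?_⟩
    rw [← not_far_iff_iff_cov (f := f) hj, (h1 e he).2.2, (h1 e he).2.2]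
  refine ⟨pos_le, h3 hne, h.lab_of_pos, fun j hj => h.lab_link j hj.1 hj.2,
    fun S hS hJ u v huv => ?_, ?_, ?_, ?_⟩
  · exact h.finest ⟨fun u v => S u ↔ S v, fun _ => Iff.rfl, Iff.symm, Iff.trans⟩ hS
      (fun j hj => hJ j (h.lt j hj)) u v huv
  · intro t ht ht'
    obtain ⟨e, he, -, hc⟩ := hcov t ht ht'
    obtain ⟨j, hj⟩ := hR.nonempty e he
    rw [mem_sig] at hj
    exact ⟨j, ⟨hj.1, hj.2.1⟩, (hc j hj.2.1).2 hj.2⟩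
  · intro t ht ht' i hi j hj hi' hj'
    obtain ⟨e, he, -, hc⟩ := hcov t ht ht'
    rw [hc i hi.2] at hi'
    rw [hc j hj.2] at hj'
    rcases hR.single_or e he with h4 | ⟨y, hy, hye⟩
    · obtain ⟨x, hx⟩ := Finset.card_eq_one.1 h4
      have hi4 : i ∈ D.sig f e := mem_sig _ |>.2 ⟨hi.1, hi'⟩
      have hj4 : j ∈ D.sig f e := mem_sig _ |>.2 ⟨hj.1, hj'⟩
      rw [hx, Finset.mem_singleton] at hi4 hj4
      rw [hi4, hj4]
    · have hcy : ∀ i : Fin m, i < f → D.cov i e → D.cov i y := fun i hi hie =>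
        ((mem_sig _).1 (hye ▸ (mem_sig _).2 ⟨hi, hie⟩ : i ∈ D.sig f y)).2
      -- An edge that covers `y` has one end on the side of `y` away from `f`, and the label of that
      -- end is the label of the edge.
      have hend : ∀ i : Fin m, i < f → ¬ D.tree i → D.cov i e →
          ∃ x, ¬ D.far f y x ∧ lab x = lab (D.src i) := by
        intro i hi hit hie
        have h5 := hcy i hi hie
        rw [← not_far_iff_iff_cov (f := f) hit] at h5
        by_cases h6 : D.far f y (D.src i)
        · exact ⟨D.tgt i, by tauto, (h.lab_link i hi hit).symm⟩
        · exact ⟨D.src i, h6, rfl⟩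
      obtain ⟨x, hx, hxi⟩ := hend i hi.1 hi.2 hi'
      obtain ⟨x', hx', hxj⟩ := hend j hj.1 hj.2 hj'
      rw [← hxi, ← hxj]
      exact h.lab_of_pos _ _ (pos_eq_of_off_path hR.cov hf hy hx hx')
  · intro t t' ht htt' ht'
    obtain ⟨e, he, het, hc⟩ := hcov t ht (by omega)
    obtain ⟨e', he', het', hc'⟩ := hcov t' (by omega) ht'
    have h4 : D.sig f e ≠ D.sig f e' := fun hh => by
      have := hR.inj e he e' he' hh
      subst this
      omega
    have : ∃ j : Fin m, ¬ (j ∈ D.sig f e ↔ j ∈ D.sig f e') := by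
      by_contra! hh
      exact h4 (Finset.ext hh)
    obtain ⟨j, hj⟩ := this
    simp only [mem_sig] at hj
    have hjt : ¬ D.tree j := fun hh => hj (by simp [cov, hh])
    have hjf : j < f := by
      by_contra hh
      exact hj (by rw [Fin.lt_def] at hh; simp [hh])
    refine ⟨j, ⟨hjf, hjt⟩, ?_⟩
    rw [← not_iff_not, hc j hjt] at *
    have := hc' j hjt
    have h6 : j.val < f.val := hjf
    tauto

variable (D) in
open Classical in
noncomputable def farVec (f : Fin m) (R : Finset (Fin n)) (v : Fin n) : R → ℤ :=
  fun e => if D.far f e v then 1 else 0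

/-- Differences of `farVec` vanish for vertices in the same position and are rows up to sign for the
ends of chosen edges. As all vertices are in one class, every difference is in the span. The two
ends of a tree edge in `R` differ by a unit vector up to sign. -/
theorem IsMerged.span_eq_top {M : Finset (Fin m)} {lab : Fin n → ℕ}
    (h : D.IsMerged f R f M lab) (hf : ¬ D.tree f) (hR : D.IsRepSet f R) :
    Submodule.span ℤ (D.row R '' M) = ⊤ := by
  classical
  rcases R.eq_empty_or_nonempty with rfl | hne
  · exact Subsingleton.elim _ _
  have hlab := (h.lineLinks hf hR hne).lab_eq
  obtain ⟨rank, h1, -, -⟩ := exists_rank hR.cov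
  set U := Submodule.span ℤ (D.row R '' M) with hU
  have hall : ∀ u v, D.farVec f R u - D.farVec f R v ∈ U := by
    intro u v
    refine h.finest ⟨fun u v => D.farVec f R u - D.farVec f R v ∈ U, fun u => by simp,
      fun {u v} huv => by simpa using neg_mem huv, fun {u v w} huv hvw => by
        simpa using add_mem huv hvw⟩ ?_ ?_ u v (hlab u v)
    · intro u v huv
      have : D.farVec f R u = D.farVec f R v := by
        funext e
        simp [farVec, far_iff_of_pos_eq hR.cov huv e.2]
      show D.farVec f R u - D.farVec f R v ∈ U
      simp [this]
    · intro j hj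
      show D.farVec f R (D.src j) - D.farVec f R (D.tgt j) ∈ U
      have hrow : D.row R j ∈ U := Submodule.subset_span ⟨j, hj, rfl⟩
      have ht := (h.lt j hj).2
      -- The sets are nested, so the end with the larger position lies in all sets that contain the
      -- other end. The sign is thus the same in all coordinates.
      rcases le_total (D.pos f R (D.src j)) (D.pos f R (D.tgt j)) with hle | hle
      · have : D.farVec f R (D.src j) - D.farVec f R (D.tgt j) = - D.row R j := by
          funext e
          have h2 := (h1 e e.2).2.2
          have h3 := not_far_iff_iff_cov (f := f) ht e.1
          have h4 : D.far f e (D.src j) → D.far f e (D.tgt j) := by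
            rw [h2, h2]; exact fun h => h.trans hle
          simp only [Pi.sub_apply, Pi.neg_apply, farVec, row, ← h3]
          split_ifs <;> first | rfl | (exfalso; tauto)
        rw [this]
        exact neg_mem hrow
      · have : D.farVec f R (D.src j) - D.farVec f R (D.tgt j) = D.row R j := by
          funext e
          have h2 := (h1 e e.2).2.2
          have h3 := not_far_iff_iff_cov (f := f) ht e.1
          have h4 : D.far f e (D.tgt j) → D.far f e (D.src j) := by
            rw [h2, h2]; exact fun h => h.trans hle
          simp only [Pi.sub_apply, farVec, row, ← h3]
          split_ifs <;> first | rfl | (exfalso; tauto)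
        rw [this]
        exact hrow
  have hsingle : ∀ e : R, (Pi.single e 1 : R → ℤ) ∈ U := by
    intro e
    have hr := ne_root_of_cov (hR.cov e e.2)
    have h2 := far_par (f := f) hr
    have h3 := hall e (D.par e)
    have h4 : D.farVec f R e - D.farVec f R (D.par e) = Pi.single e 1 ∨
        D.farVec f R e - D.farVec f R (D.par e) = - Pi.single e 1 := by
      by_cases h5 : D.far f e e
      · left
        funext e'
        by_cases hee : e' = e
        · subst hee
          have h6 : ¬ D.far f e' (D.par e') := by tauto
          simp [farVec, h5, h6]
        · simp [farVec, far_par_of_ne (f := f) hr (fun hh => hee (Subtype.ext hh)), hee]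
      · right
        funext e'
        by_cases hee : e' = e
        · subst hee
          have h6 : D.far f e' (D.par e') := by tauto
          simp [farVec, h5, h6]
        · simp [farVec, far_par_of_ne (f := f) hr (fun hh => hee (Subtype.ext hh)), hee]
    rcases h4 with h4 | h4
    · rwa [h4] at h3
    · rw [h4] at h3
      simpa using neg_mem h3
  rw [eq_top_iff]
  intro x _
  rw [pi_eq_sum_univ' x]
  refine Submodule.sum_mem _ fun e _ => ?_
  have := U.smul_mem (x e) (hsingle e)
  convert this using 1

/-- At least one class remains, so `card` gives `M.card ≤ R.card`, and a generating set of `ℤ^R` of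
this size is independent. The opposite inequality, which follows from generation, serves the time
bound. -/
theorem IsMerged.basis {M : Finset (Fin m)} {lab : Fin n → ℕ} {Q : Finset (Fin m × Fin m)}
    (h : D.IsMerged f R f M lab) (hf : ¬ D.tree f) (hR : D.IsRepSet f R) (hQ : D.IsPairBasis f Q) :
    D.IsPairBasis (f + 1) (Q ∪ {f} ×ˢ M) ∧ R.card ≤ M.card := by
  have hspan := h.span_eq_top hf hR
  have hrange : Set.range (fun j : (M : Set (Fin m)) => D.row R j) = D.row R '' M := by
    ext; simp
  refine ⟨hQ.succ hR (fun j hj => (h.lt j hj).1) ?_ hspan, ?_⟩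
  · refine linearIndependent_of_top_le_span_of_card_le_finrank (hrange ▸ hspan.ge) ?_
    have h1 := h.card
    have h2 : 1 ≤ (Finset.univ.image lab).card :=
      Finset.card_pos.2 ⟨_, Finset.mem_image_of_mem lab (Finset.mem_univ D.root)⟩
    simp only [Finset.coe_sort_coe, Fintype.card_coe, Module.finrank_fintype_fun_eq_card]
    omega
  · have h1 : (Submodule.span ℤ (Set.range fun j : (M : Set (Fin m)) => D.row R j)) = ⊤ :=
      hrange ▸ hspan
    have h2 := finrank_range_le_card (R := ℤ) (fun j : (M : Set (Fin m)) => D.row R j)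
    rw [Set.finrank, h1, finrank_top] at h2
    simpa using h2

end RootedTree

end CycleLattice

/-! ### Separation by tree edges, and rooted trees realized in a graph -/

namespace CycleLattice

namespace RootedTree

variable {n m : ℕ} {D : RootedTree n m}

theorem depth_le_of_anc {u v : Fin n} (h : D.anc v u) : v = u ∨ D.depth u < D.depth v := by
  induction v using D.induction_par with
  | hr => exact absurd h (D.anc_root _)
  | hs v hv ih =>
    have h1 := D.depth_par hv
    rcases (D.anc_iff v hv u).1 h with rfl | h
    · exact .inl rfl
    · right
      rcases ih h with h2 | h2
      · rw [← h2]; omega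
      · omega

theorem anc_self {v : Fin n} (hv : v ≠ D.root) : D.anc v v := (D.anc_iff v hv v).2 (.inl rfl)

variable (D)

/-- The tree edge `w` separates `u` from `v`. -/
def Sep (u v w : Fin n) : Prop := ¬ (D.anc u w ↔ D.anc v w)

/-- The tree edges are exactly the edges `pe w`, joining `w` to its parent. -/
structure Realizes {α β : Type*} (G : Graph α β) (T : Set β) (vtx : Fin n ≃ G.vertexSet)
    (edg : Fin m ≃ G.edgeSet) (pe : Fin n → Fin m) : Prop where
  link : ∀ f, G.IsLink (edg f).1 (vtx (D.src f)).1 (vtx (D.tgt f)).1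
  tree_iff : ∀ f, D.tree f ↔ (edg f).1 ∈ T
  pe_link : ∀ w, w ≠ D.root → G.IsLink (edg (pe w)).1 (vtx w).1 (vtx (D.par w)).1
  pe_tree : ∀ w, w ≠ D.root → D.tree (pe w)

end RootedTree

/-! ### Walks -/

/-- The list `l` of pairs of a vertex and the edge by which it is left is a walk from `u` to `w`. -/
def IsWalk {V E : Type*} (link : E → V → V → Prop) : V → List (V × E) → V → Prop
  | u, [], w => u = w
  | u, p :: l, w => p.1 = u ∧ ∃ y, link p.2 u y ∧ IsWalk link y l w

namespace IsWalk

variable {V E : Type*} {link : E → V → V → Prop}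

theorem append {u v w : V} {l l' : List (V × E)} (h : IsWalk link u l v) (h' : IsWalk link v l' w) :
    IsWalk link u (l ++ l') w := by
  induction l generalizing u with
  | nil => obtain rfl : u = v := h; exact h'
  | cons p l ih =>
    obtain ⟨h1, y, h2, h3⟩ := h
    exact ⟨h1, y, h2, ih h3⟩

theorem single {u v : V} {e : E} (h : link e u v) : IsWalk link u [(u, e)] v := ⟨rfl, v, h, rfl⟩

theorem link_get {u w : V} {l : List (V × E)} (h : IsWalk link u l w) (i : ℕ) (hi : i < l.length) :
    link l[i].2 l[i].1 (if h : i + 1 < l.length then l[i + 1].1 else w) := by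
  induction l generalizing u i with
  | nil => simp at hi
  | cons p l ih =>
    obtain ⟨rfl, y, h2, h3⟩ := h
    cases i with
    | zero =>
      cases l with
      | nil => obtain rfl : y = w := h3; simpa using h2
      | cons q l => obtain ⟨rfl, -⟩ := h3; simpa using h2
    | succ i => simpa using ih h3 i (by simpa using hi)

/-- Addition in `Fin (k + 1)` returns from the last position to the first, which is where the closed
walk ends. -/
theorem exists_cycle {u : V} {l : List (V × E)} (h : IsWalk link u l u) (hl : l ≠ []) :
    ∃ k, ∃ hk : k + 1 = l.length, ∀ i : Fin (k + 1),
      link (l[i.val]'(by omega)).2 (l[i.val]'(by omega)).1 (l[(i + 1).val]'((i + 1).isLt.trans_eq hk)).1 := by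
  obtain ⟨k, hk⟩ : ∃ k, k + 1 = l.length := ⟨l.length - 1, by
    have := List.length_pos_of_ne_nil hl; omega⟩
  refine ⟨k, hk, fun i => ?_⟩
  have h1 := h.link_get i.val (by omega)
  convert h1 using 1
  by_cases hik : i.val = k
  · have h2 : (i + 1).val = 0 := by
      have : i = Fin.last k := Fin.ext hik
      rw [this, Fin.last_add_one]; rfl
    rw [dif_neg (by omega)]
    simp only [h2]
    cases l with
    | nil => exact absurd rfl hl
    | cons p l => exact h.1
  · have h2 : (i + 1).val = i.val + 1 := Fin.val_add_one_of_lt (by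
      rw [Fin.lt_def, Fin.val_last]; omega)
    rw [dif_pos (by omega)]
    simp only [h2]

end IsWalk

/-! ### Cycles closed by one or two edges outside the tree -/

section Graphs

variable {α β : Type*} {n m : ℕ} {G : Graph α β} {T : Set β} {vtx : Fin n ≃ G.vertexSet}
  {edg : Fin m ≃ G.edgeSet}

/-- The edges of `G` whose numbers belong to `S`. -/
def edgesIn (edg : Fin m ≃ G.edgeSet) (S : Set (Fin m)) : Set β := {e | ∃ i ∈ S, (edg i).1 = e}

theorem mem_edgesIn {S : Set (Fin m)} {i : Fin m} : (edg i).1 ∈ edgesIn edg S ↔ i ∈ S := by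
  constructor
  · rintro ⟨j, hj, h⟩
    rwa [← edg.injective (Subtype.ext h)]
  · exact fun h => ⟨i, h, rfl⟩

theorem isCycle_of_isWalk {u : Fin n} {l : List (Fin n × Fin m)}
    (h : IsWalk (fun e v w => G.IsLink (edg e).1 (vtx v).1 (vtx w).1) u l u) (hl : l ≠ [])
    (hv : (l.map Prod.fst).Nodup) (he : (l.map Prod.snd).Nodup) :
    IsCycle G (edgesIn edg {e | e ∈ l.map Prod.snd}) := by
  obtain ⟨k, hk, hlink⟩ := h.exists_cycle hl
  refine ⟨k, fun i => (vtx (l[i.val]'(by omega)).1).1, fun i => (edg (l[i.val]'(by omega)).2).1,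
    fun i j hij => ?_, fun i j hij => ?_, hlink, ?_⟩
  · have h1 := vtx.injective (Subtype.ext hij)
    have := (List.Nodup.getElem_inj_iff hv (i := i.val) (j := j.val) (hi := by simp; omega)
      (hj := by simp; omega)).1 (by simpa using h1)
    exact Fin.ext this
  · have h1 := edg.injective (Subtype.ext hij)
    have := (List.Nodup.getElem_inj_iff he (i := i.val) (j := j.val) (hi := by simp; omega)
      (hj := by simp; omega)).1 (by simpa using h1)
    exact Fin.ext this
  · ext e
    simp only [edgesIn, Set.mem_ofPred_eq, Set.mem_range]
    constructor
    · rintro ⟨i, hi, rfl⟩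
      obtain ⟨p, hp, rfl⟩ := List.mem_map.1 hi
      obtain ⟨j, hj, rfl⟩ := List.getElem_of_mem hp
      exact ⟨⟨j, by omega⟩, rfl⟩
    · rintro ⟨i, rfl⟩
      exact ⟨_, List.mem_map_of_mem (List.getElem_mem _), rfl⟩

namespace RootedTree.Realizes

variable {D : RootedTree n m} {pe : Fin n → Fin m} (h : D.Realizes G T vtx edg pe)
include h

theorem link_iff {f : Fin m} {u v : Fin n} : G.IsLink (edg f).1 (vtx u).1 (vtx v).1 ↔
    D.src f = u ∧ D.tgt f = v ∨ D.src f = v ∧ D.tgt f = u := by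
  constructor
  · intro hl
    rcases (h.link f).eq_and_eq_or_eq_and_eq hl with ⟨h1, h2⟩ | ⟨h1, h2⟩
    · exact .inl ⟨vtx.injective (Subtype.ext h1), vtx.injective (Subtype.ext h2)⟩
    · exact .inr ⟨vtx.injective (Subtype.ext h1), vtx.injective (Subtype.ext h2)⟩
  · rintro (⟨rfl, rfl⟩ | ⟨rfl, rfl⟩)
    · exact h.link f
    · exact (h.link f).symm

/-- If the two links were traversed in opposite directions, each vertex would be the parent of the
other, which the depths forbid. -/
theorem pe_inj {v w : Fin n} (hv : v ≠ D.root) (hw : w ≠ D.root) (hvw : pe v = pe w) : v = w := by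
  have h1 := h.link_iff.1 (h.pe_link v hv)
  have h2 := h.link_iff.1 (h.pe_link w hw)
  have h3 := D.depth_par hv
  have h4 := D.depth_par hw
  rw [hvw] at h1
  rcases h1 with ⟨h1, h1'⟩ | ⟨h1, h1'⟩ <;> rcases h2 with ⟨h2, h2'⟩ | ⟨h2, h2'⟩
  · exact h1.symm.trans h2
  · rw [h1] at h2; rw [h1'] at h2'; rw [h2'] at h3; rw [← h2] at h4; omega
  · rw [h1] at h2; rw [h1'] at h2'; rw [h2] at h3; rw [← h2'] at h4; omega
  · exact h1'.symm.trans h2'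

/-- Induction on the sum of the depths: the deeper end is replaced by its parent, which affects
separation at one tree edge only. The clause on ancestors shows that the end just removed does not
occur again. The last clause keeps the path on one side of each tree edge that does not separate its
ends. -/
theorem exists_path (u v : Fin n) : ∃ l : List (Fin n × Fin m),
    IsWalk (fun e v w => G.IsLink (edg e).1 (vtx v).1 (vtx w).1) u l v ∧
    (l.map Prod.fst ++ [v]).Nodup ∧ (l.map Prod.snd).Nodup ∧
    (∀ e, e ∈ l.map Prod.snd ↔ ∃ w, pe w = e ∧ D.Sep u v w) ∧
    ∀ x ∈ l.map Prod.fst ++ [v], (x = D.root ∨ D.anc u x ∨ D.anc v x) ∧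
      ∀ w, ¬ D.Sep u v w → (D.anc x w ↔ D.anc v w) := by
  obtain ⟨d, hd⟩ : ∃ d, D.depth u + D.depth v = d := ⟨_, rfl⟩
  induction d using Nat.strong_induction_on generalizing u v with
  | _ d ih =>
    have hself : ∀ x, x = D.root ∨ D.anc x x := fun x => by
      by_cases hx : x = D.root
      · exact .inl hx
      · exact .inr (anc_self hx)
    by_cases huv : u = v
    · subst huv
      refine ⟨[], rfl, by simp, by simp, by simp [Sep], ?_⟩
      intro x hx
      simp only [List.map_nil, List.nil_append, List.mem_singleton] at hx
      subst hx
      exact ⟨(hself x).imp_right .inl, fun _ _ => Iff.rfl⟩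
    have hroot : D.depth D.root = 0 := by simp [depth, D.anc_root]
    have hpos : ∀ w, w ≠ D.root → 0 < D.depth w := fun w hw => by
      have := D.depth_par hw; omega
    rcases le_total (D.depth v) (D.depth u) with hle | hle
    · have hu : u ≠ D.root := by
        rintro rfl
        by_cases hv : v = D.root
        · exact huv hv.symm
        · have := hpos v hv; omega
      have hdu := D.depth_par hu
      have hvu : ¬ D.anc v u := fun hh => by
        rcases depth_le_of_anc hh with h1 | h1
        · exact huv h1.symm
        · omega
      have hpu := D.anc_par u hu
      have hau := D.anc_iff u hu
      obtain ⟨l, h1, h2, h3, h4, h5⟩ := ih _ (by omega) (D.par u) v rfl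
      have hsep : ∀ w, D.Sep u v w ↔ w = u ∨ D.Sep (D.par u) v w := by
        intro w
        simp only [Sep, hau w]
        by_cases hw : w = u
        · subst hw; tauto
        · tauto
      refine ⟨(u, pe u) :: l, ⟨rfl, D.par u, h.pe_link u hu, h1⟩, ?_, ?_, ?_, ?_⟩
      · simp only [List.map_cons, List.cons_append, List.nodup_cons]
        refine ⟨fun hmem => ?_, h2⟩
        rcases (h5 u hmem).1 with h6 | h6 | h6
        · exact hu h6
        · exact hpu h6
        · exact hvu h6
      · simp only [List.map_cons, List.nodup_cons]
        refine ⟨fun hmem => ?_, h3⟩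
        obtain ⟨w, hw, hs⟩ := (h4 _).1 hmem
        have hwr : w ≠ D.root := by rintro rfl; exact hs (by simp [D.not_anc_root])
        obtain rfl := h.pe_inj hwr hu hw
        exact hs (by simp [hpu, hvu])
      · intro e
        simp only [List.map_cons, List.mem_cons, h4, hsep]
        constructor
        · rintro (rfl | ⟨w, rfl, hw⟩)
          · exact ⟨u, rfl, .inl rfl⟩
          · exact ⟨w, rfl, .inr hw⟩
        · rintro ⟨w, rfl, rfl | hw⟩
          · exact .inl rfl
          · exact .inr ⟨w, rfl, hw⟩
      · intro x hx
        simp only [List.map_cons, List.cons_append, List.mem_cons] at hx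
        rcases hx with rfl | hx
        · exact ⟨(hself _).imp_right .inl, fun w hw => not_not.1 hw⟩
        · obtain ⟨h6, h7⟩ := h5 x hx
          refine ⟨?_, fun w hw => h7 w (by rw [hsep] at hw; tauto)⟩
          rw [hau]; tauto
    · have hv : v ≠ D.root := by
        rintro rfl
        by_cases hu : u = D.root
        · exact huv hu
        · have := hpos u hu; omega
      have hdv := D.depth_par hv
      have huv' : ¬ D.anc u v := fun hh => by
        rcases depth_le_of_anc hh with h1 | h1
        · exact huv h1
        · omega
      have hpv := D.anc_par v hv
      have hav := D.anc_iff v hv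
      obtain ⟨l, h1, h2, h3, h4, h5⟩ := ih _ (by omega) u (D.par v) rfl
      have hsep : ∀ w, D.Sep u v w ↔ w = v ∨ D.Sep u (D.par v) w := by
        intro w
        simp only [Sep, hav w]
        by_cases hw : w = v
        · subst hw; tauto
        · tauto
      refine ⟨l ++ [(D.par v, pe v)], h1.append (.single (h.pe_link v hv).symm), ?_, ?_, ?_, ?_⟩
      · simp only [List.map_append, List.map_cons, List.map_nil]
        rw [List.nodup_append]
        refine ⟨h2, by simp, ?_⟩
        rintro x hx y hy rfl
        rw [List.mem_singleton] at hy
        subst hy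
        rcases (h5 _ hx).1 with h6 | h6 | h6
        · exact hv h6
        · exact huv' h6
        · exact hpv h6
      · simp only [List.map_append, List.map_cons, List.map_nil]
        rw [List.nodup_append]
        refine ⟨h3, by simp, ?_⟩
        rintro x hx y hy rfl
        rw [List.mem_singleton] at hy
        subst hy
        obtain ⟨w, hw, hs⟩ := (h4 _).1 hx
        have hwr : w ≠ D.root := by rintro rfl; exact hs (by simp [D.not_anc_root])
        obtain rfl := h.pe_inj hwr hv hw
        exact hs (by simp [hpv, huv'])
      · intro e
        simp only [List.map_append, List.map_cons, List.map_nil, List.mem_append, h4, hsep,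
          List.mem_singleton]
        constructor
        · rintro (⟨w, rfl, hw⟩ | rfl)
          · exact ⟨w, rfl, .inr hw⟩
          · exact ⟨v, rfl, .inl rfl⟩
        · rintro ⟨w, rfl, rfl | hw⟩
          · exact .inr rfl
          · exact .inl ⟨w, rfl, hw⟩
      · intro x hx
        simp only [List.map_append, List.map_cons, List.map_nil] at hx
        rcases List.mem_append.1 hx with hx | hx
        · obtain ⟨h6, h7⟩ := h5 x hx
          refine ⟨by rw [hav]; tauto, fun w hw => ?_⟩
          rw [hsep] at hw
          rw [h7 w (by tauto), hav]
          tauto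
        · rw [List.mem_singleton] at hx
          subst hx
          exact ⟨(hself _).imp_right .inr, fun _ _ => Iff.rfl⟩

omit h in
theorem ne_root_of_sep {u v w : Fin n} (hs : D.Sep u v w) : w ≠ D.root := by
  rintro rfl
  exact hs (by simp [D.not_anc_root])

/-- An edge that is not in the tree closes a cycle. -/
theorem isCycle_of_forall_ne {f : Fin m} (hf : ∀ w, w ≠ D.root → pe w ≠ f) :
    IsCycle G (edgesIn edg {e | e = f ∨ ∃ w, pe w = e ∧ D.Sep (D.src f) (D.tgt f) w}) := by
  obtain ⟨l, h1, h2, h3, h4, -⟩ := h.exists_path (D.src f) (D.tgt f)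
  have := isCycle_of_isWalk (h1.append (.single (h.link f).symm)) (by simp)
    (by simpa using h2) (by
      simp only [List.map_append, List.map_cons, List.map_nil]
      rw [List.nodup_append]
      refine ⟨h3, by simp, ?_⟩
      rintro x hx y hy rfl
      rw [List.mem_singleton] at hy
      subst hy
      obtain ⟨w, hw, hs⟩ := (h4 _).1 hx
      exact hf w (ne_root_of_sep hs) hw)
  convert this using 3
  ext e
  simp only [List.map_append, List.map_cons, List.map_nil, List.mem_append, h4, List.mem_singleton]
  exact or_comm

/-- A tree edge that is not an edge to a parent would close a cycle with such edges, inside `T`.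
This is why `isCycle_of_forall_ne` speaks of edges different from all `pe w` and not of edges
outside the tree. -/
theorem exists_pe (hT : IsSpanningTree G T) {f : Fin m} (hf : D.tree f) :
    ∃ w, w ≠ D.root ∧ pe w = f := by
  by_contra! hno
  refine hT.2.2 _ (h.isCycle_of_forall_ne hno) ?_
  rintro _ ⟨e, rfl | ⟨w, rfl, hw⟩, rfl⟩
  · exact (h.tree_iff _).1 hf
  · exact (h.tree_iff _).1 (h.pe_tree w (ne_root_of_sep hw))

variable (D pe) in
omit h in
/-- The edge numbers of the cycle that is closed by `f`. -/
def fund (f : Fin m) : Set (Fin m) := {e | e = f ∨ ∃ w, pe w = e ∧ D.cov f w}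

variable (D pe) in
omit h in
/-- The edge numbers of the symmetric difference of the cycles that are closed by the members of a
pair. -/
def pairSet (p : Fin m × Fin m) : Set (Fin m) :=
  {e | e = p.1 ∨ e = p.2 ∨ ∃ w, pe w = e ∧ ¬ (D.cov p.1 w ↔ D.cov p.2 w)}

theorem isCycle_fund {f : Fin m} (hf : ¬ D.tree f) : IsCycle G (edgesIn edg (fund D pe f)) := by
  have := h.isCycle_of_forall_ne (f := f) fun w hw hwf => hf (hwf ▸ h.pe_tree w hw)
  simpa [fund, cov, hf, Sep] using this

omit h in
theorem not_iff_iff_or {a b c d : Prop} (h : ¬ (d ↔ b) → ¬ (a ↔ c) → False) :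
    ¬ (¬ (c ↔ d) ↔ ¬ (a ↔ b)) ↔ ¬ (d ↔ b) ∨ ¬ (a ↔ c) := by
  by_cases a <;> by_cases b <;> by_cases c <;> by_cases d <;> simp_all

omit h in
-- The propositional core of `isCycle_pair`: the letters with index record the sides of a tree edge
-- `w₀` on both paths, the others those of a second tree edge. Laminarity prevents the latter from
-- separating a pair on each side of `w₀`.
theorem false_of_separations {a b c d a₀ b₀ c₀ d₀ : Prop} (h₀ : ¬ (c₀ ↔ d₀)) (ha : a₀ ↔ c₀)
    (hb : b₀ ↔ d₀) (h : ¬ (d ↔ b)) (h' : ¬ (a ↔ c))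
    (hl : (d → d₀) ∧ (b → b₀) ∧ (a → a₀) ∧ (c → c₀) ∨ (d₀ → d) ∧ (b₀ → b) ∧ (a₀ → a) ∧ (c₀ → c) ∨
      ¬ (d ∧ d₀) ∧ ¬ (b ∧ b₀) ∧ ¬ (a ∧ a₀) ∧ ¬ (c ∧ c₀)) : False := by
  by_cases c₀ <;> by_cases d₀ <;> by_cases c <;> by_cases d <;> simp_all

/-- The cycle runs along `f`, through the tree to an end `b` of `j`, along `j` to its other end `a`,
and through the tree back. A tree edge `w₀` on both paths has the two tree segments on different
sides, so they are disjoint. -/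
theorem isCycle_pair {f j : Fin m} (hf : ¬ D.tree f) (hj : ¬ D.tree j) (hfj : j ≠ f)
    (ho : ∃ v, D.cov f v ∧ D.cov j v) : IsCycle G (edgesIn edg (pairSet D pe (f, j))) := by
  obtain ⟨w₀, hfw, hjw⟩ := ho
  simp only [cov, hf, hj, not_false_eq_true, true_and] at hfw hjw
  -- The edge `j` crosses `w₀` too; it is directed so that `a` is on the side of the source of `f`
  -- and `b` on the side of its target.
  obtain ⟨a, b, hab, ha, hb, hcov⟩ : ∃ a b, G.IsLink (edg j).1 (vtx b).1 (vtx a).1 ∧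
      (D.anc a w₀ ↔ D.anc (D.src f) w₀) ∧ (D.anc b w₀ ↔ D.anc (D.tgt f) w₀) ∧
      ∀ w, D.cov j w ↔ ¬ (D.anc a w ↔ D.anc b w) := by
    by_cases hs : D.anc (D.src j) w₀ ↔ D.anc (D.src f) w₀
    · refine ⟨D.src j, D.tgt j, (h.link j).symm, hs, by tauto, fun w => by simp [cov, hj]⟩
    · refine ⟨D.tgt j, D.src j, h.link j, by tauto, by tauto, fun w => by
        simp only [cov, hj, not_false_eq_true, true_and]; tauto⟩
  obtain ⟨l, h1, h2, h3, h4, h5⟩ := h.exists_path (D.tgt f) b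
  obtain ⟨l', h1', h2', h3', h4', h5'⟩ := h.exists_path a (D.src f)
  have hwalk := ((IsWalk.single
      (link := fun e v w => G.IsLink (edg e).1 (vtx v).1 (vtx w).1) (h.link f)).append h1).append
    ((IsWalk.single
      (link := fun e v w => G.IsLink (edg e).1 (vtx v).1 (vtx w).1) hab).append h1')
  have hside : ∀ x ∈ l.map Prod.fst ++ [b], (D.anc x w₀ ↔ D.anc (D.tgt f) w₀) := fun x hx => by
    rw [(h5 x hx).2 w₀ (by simp only [Sep]; tauto), hb]
  have hside' : ∀ x ∈ l'.map Prod.fst ++ [D.src f], (D.anc x w₀ ↔ D.anc (D.src f) w₀) :=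
    fun x hx => by rw [(h5' x hx).2 w₀ (by simp only [Sep]; tauto)]
  have hboth : ∀ w, D.Sep (D.tgt f) b w → D.Sep a (D.src f) w → False := by
    intro w hw hw'
    simp only [Sep] at hw hw'
    rcases D.laminar w w₀ with h6 | h6 | h6
    · exact false_of_separations hfw ha hb hw hw'
        (.inl ⟨h6 (D.tgt f), h6 b, h6 a, h6 (D.src f)⟩)
    · exact false_of_separations hfw ha hb hw hw'
        (.inr (.inl ⟨h6 (D.tgt f), h6 b, h6 a, h6 (D.src f)⟩))
    · exact false_of_separations hfw ha hb hw hw'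
        (.inr (.inr ⟨h6 (D.tgt f), h6 b, h6 a, h6 (D.src f)⟩))
  have hnt : ∀ u v e, (∃ w, pe w = e ∧ D.Sep u v w) → D.tree e := by
    rintro u v e ⟨w, rfl, hw⟩
    exact h.pe_tree w (ne_root_of_sep hw)
  have := isCycle_of_isWalk hwalk (by simp) (by
      have hperm : ((([(D.src f, f)] ++ l) ++ ([(b, j)] ++ l')).map Prod.fst).Perm
          ((l.map Prod.fst ++ [b]) ++ (l'.map Prod.fst ++ [D.src f])) := by
        simp only [List.map_append, List.map_cons, List.map_nil, List.append_assoc]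
        refine (List.perm_append_comm (l₁ := [D.src f])).trans ?_
        simp [List.append_assoc]
      rw [hperm.nodup_iff, List.nodup_append]
      refine ⟨h2, h2', ?_⟩
      rintro x hx y hy rfl
      have := hside x hx
      have := hside' x hy
      tauto) (by
      have hperm : ((([(D.src f, f)] ++ l) ++ ([(b, j)] ++ l')).map Prod.snd).Perm
          ([f, j] ++ (l.map Prod.snd ++ l'.map Prod.snd)) := by
        simp only [List.map_append, List.map_cons, List.cons_append, List.nil_append]
        refine List.Perm.cons _ ?_
        exact List.perm_middle
      rw [hperm.nodup_iff, List.nodup_append]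
      refine ⟨by simpa using hfj.symm, ?_, ?_⟩
      · rw [List.nodup_append]
        refine ⟨h3, h3', ?_⟩
        rintro x hx y hy rfl
        obtain ⟨w, rfl, hw⟩ := (h4 _).1 hx
        obtain ⟨w', hww, hw'⟩ := (h4' _).1 hy
        obtain rfl := h.pe_inj (ne_root_of_sep hw') (ne_root_of_sep hw) hww
        exact hboth _ hw hw'
      · rintro x hx y hy rfl
        rw [List.mem_append, h4, h4'] at hy
        have ht : D.tree x := hy.elim (hnt _ _ _) (hnt _ _ _)
        simp only [List.mem_cons, List.not_mem_nil, or_false] at hx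
        rcases hx with rfl | rfl
        · exact hf ht
        · exact hj ht)
  convert this using 3
  ext e
  -- By parity, `w` is on exactly one of the two tree paths if and only if it is on exactly one of
  -- the two segments; being on both segments is excluded.
  have hiff : ∀ w, ¬ (D.cov f w ↔ D.cov j w) ↔ D.Sep (D.tgt f) b w ∨ D.Sep a (D.src f) w := by
    intro w
    have h6 := hboth w
    rw [hcov]
    simp only [cov, hf, not_false_eq_true, true_and, Sep] at h6 ⊢
    exact not_iff_iff_or h6
  simp only [pairSet, hiff, and_or_left, exists_or, Set.mem_ofPred_eq, List.map_append,
    List.map_cons, List.map_nil, List.mem_append, h4, h4', List.mem_singleton]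
  generalize (∃ w, pe w = e ∧ D.Sep (D.tgt f) b w) = p
  generalize (∃ w, pe w = e ∧ D.Sep a (D.src f) w) = q
  tauto

end RootedTree.Realizes

end Graphs

end CycleLattice

/-! ### Characteristic vectors and the cycle lattice -/

namespace CycleLattice

section Graphs

variable {α β : Type*} {n m : ℕ} {G : Graph α β} {T : Set β} {vtx : Fin n ≃ G.vertexSet}
  {edg : Fin m ≃ G.edgeSet}

open Classical in
theorem indVec_edgesIn (S : Set (Fin m)) (i : Fin m) :
    indVec G (edgesIn edg S) (edg i) = if i ∈ S then 1 else 0 := by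
  simp [indVec, Set.indicator_apply, mem_edgesIn]

namespace RootedTree

variable {D : RootedTree n m}

theorem sep_par {u w : Fin n} (hu : u ≠ D.root) : D.Sep u (D.par u) w ↔ w = u := by
  have h1 := D.anc_iff u hu w
  have h2 := D.anc_par u hu
  simp only [Sep]
  by_cases hw : w = u
  · subst hw; tauto
  · tauto

theorem sep_comm {u v w : Fin n} : D.Sep u v w ↔ D.Sep v u w := by
  simp only [Sep]; tauto

theorem cov_iff_sep {f : Fin m} {w : Fin n} :
    D.cov f w ↔ ¬ D.tree f ∧ D.Sep (D.src f) (D.tgt f) w := Iff.rfl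

namespace Realizes

variable {pe : Fin n → Fin m} (h : D.Realizes G T vtx edg pe)
include h

theorem sep_iff {f : Fin m} {u v w : Fin n} (hl : G.IsLink (edg f).1 (vtx u).1 (vtx v).1) :
    D.Sep (D.src f) (D.tgt f) w ↔ D.Sep u v w := by
  rcases h.link_iff.1 hl with ⟨rfl, rfl⟩ | ⟨rfl, rfl⟩
  · rfl
  · exact sep_comm

theorem sep_pe {u w : Fin n} (hu : u ≠ D.root) :
    D.Sep (D.src (pe u)) (D.tgt (pe u)) w ↔ w = u := by
  rw [h.sep_iff (h.pe_link u hu), sep_par hu]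

omit h in
-- Modulo two, a change at `i` is the sum of the values at `i` and `i + 1`, and each value is
-- counted twice around the cycle.
theorem even_card_cyclic {k : ℕ} (p : Fin (k + 1) → Prop) [DecidablePred p] :
    Even (Finset.card {i | ¬ (p i ↔ p (i + 1))}) := by
  rw [← ZMod.natCast_eq_zero_iff_even, Finset.card_filter, Nat.cast_sum]
  have h1 : ∀ i, ((if ¬ (p i ↔ p (i + 1)) then 1 else 0 : ℕ) : ZMod 2) =
      (if p i then 1 else 0) + (if p (i + 1) then 1 else 0) := by
    intro i
    by_cases hi : p i <;> by_cases hi' : p (i + 1) <;> simp [hi, hi']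
    decide
  have h2 : ∑ i, (if p (i + 1) then 1 else 0 : ZMod 2) = ∑ i, (if p i then 1 else 0 : ZMod 2) :=
    Equiv.sum_comp (Equiv.addRight (1 : Fin (k + 1))) fun i => (if p i then 1 else 0 : ZMod 2)
  rw [Finset.sum_congr rfl fun i _ => h1 i, Finset.sum_add_distrib, h2]
  exact CharTwo.add_self_eq_zero _

open Classical in
-- Going round the cycle, membership in the subtree below `w` changes exactly at the edges whose
-- ends `w` separates.
theorem even_card_sep {C : Set β} (hC : IsCycle G C) (w : Fin n) :
    Even (Finset.card {f : Fin m | (edg f).1 ∈ C ∧ D.Sep (D.src f) (D.tgt f) w}) := by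
  obtain ⟨k, x, e, hx, he, hl, rfl⟩ := hC
  choose y hy using fun i => vtx.surjective ⟨x i, (hl i).left_mem⟩
  choose f hf using fun i => edg.surjective ⟨e i, (hl i).edge_mem⟩
  have hl' : ∀ i, G.IsLink (edg (f i)).1 (vtx (y i)).1 (vtx (y (i + 1))).1 := by
    intro i
    rw [hy, hy, hf]
    exact hl i
  have hinj : Function.Injective f := fun i j hij => he (by
    have := (hf i).symm.trans ((congrArg edg hij).trans (hf j))
    exact congrArg Subtype.val this)
  have := even_card_cyclic (fun i => D.anc (y i) w)
  convert this using 1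
  rw [← Finset.card_image_of_injective _ hinj]
  congr 1
  ext g
  simp only [Finset.mem_filter, Finset.mem_univ, true_and, Finset.mem_image, Set.mem_range]
  constructor
  · rintro ⟨⟨i, hi⟩, hs⟩
    have hig : f i = g := edg.injective (by rw [hf]; exact Subtype.ext hi)
    subst hig
    exact ⟨i, by rwa [h.sep_iff (hl' i)] at hs, rfl⟩
  · rintro ⟨i, hi, rfl⟩
    exact ⟨⟨i, by rw [hf]⟩, by rwa [h.sep_iff (hl' i)]⟩

variable (edg D pe) in
omit h in
open Classical in
/-- A function on the tree edges as a function on all edges. -/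
noncomputable def treeVec : (Fin n → ℤ) →ₗ[ℤ] (G.edgeSet → ℤ) where
  -- The root has no edge to a parent, so `pe D.root` is arbitrary and must not contribute.
  toFun z := fun e => ∑ w, if w ≠ D.root ∧ edg (pe w) = e then z w else 0
  map_add' a b := by
    funext e
    rw [Pi.add_apply, ← Finset.sum_add_distrib]
    refine Finset.sum_congr rfl fun w _ => ?_
    split_ifs <;> simp
  map_smul' c a := by
    funext e
    rw [Pi.smul_apply, smul_eq_mul, Finset.mul_sum]
    refine Finset.sum_congr rfl fun w _ => ?_
    split_ifs <;> simp

open Classical in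
theorem treeVec_pe (z : Fin n → ℤ) {w : Fin n} (hw : w ≠ D.root) :
    treeVec edg D pe z (edg (pe w)) = z w := by
  show (∑ v, if v ≠ D.root ∧ edg (pe v) = edg (pe w) then z v else 0) = z w
  rw [Finset.sum_eq_single w]
  · simp [hw]
  · rintro v - hvw
    rw [if_neg]
    rintro ⟨hv, hh⟩
    exact hvw (h.pe_inj hv hw (edg.injective hh))
  · simp

theorem treeVec_of_not_tree (z : Fin n → ℤ) {f : Fin m} (hf : ¬ D.tree f) :
    treeVec edg D pe z (edg f) = 0 := by
  classical
  show (∑ v, if v ≠ D.root ∧ edg (pe v) = edg f then z v else 0) = 0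
  refine Finset.sum_eq_zero fun v _ => if_neg ?_
  rintro ⟨hv, hh⟩
  exact hf (edg.injective hh ▸ h.pe_tree v hv)

variable (edg D pe) in
omit h in
/-- The characteristic vector of the cycle that is closed by `f`. -/
noncomputable def fundVec (f : Fin m) : G.edgeSet → ℤ := indVec G (edgesIn edg (fund D pe f))

variable (edg D pe) in
omit h in
noncomputable def pairVec (p : Fin m × Fin m) : G.edgeSet → ℤ :=
  indVec G (edgesIn edg (pairSet D pe p))

omit h in
open Classical in
theorem exists_pe_eq_iff (h : D.Realizes G T vtx edg pe) {w : Fin n} (hw : w ≠ D.root)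
    {p : Fin n → Prop} (hp : ∀ v, p v → v ≠ D.root) : (∃ v, pe v = pe w ∧ p v) ↔ p w := by
  constructor
  · rintro ⟨v, hv, hpv⟩
    exact h.pe_inj (hp v hpv) hw hv ▸ hpv
  · exact fun hh => ⟨w, rfl, hh⟩

omit h in
theorem exists_pe_ne (h : D.Realizes G T vtx edg pe) {f : Fin m} (hf : ¬ D.tree f)
    {p : Fin n → Prop} (hp : ∀ v, p v → v ≠ D.root) : ¬ ∃ v, pe v = f ∧ p v := by
  rintro ⟨v, rfl, hpv⟩
  exact hf (h.pe_tree v (hp v hpv))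

omit h in
theorem ne_root_of_not_iff {f j : Fin m} {v : Fin n} (hv : ¬ (D.cov f v ↔ D.cov j v)) :
    v ≠ D.root := by
  by_cases h1 : D.cov f v
  · exact ne_root_of_cov h1
  · exact ne_root_of_cov (f := j) (by tauto)

open Classical in
theorem fundVec_pe {f : Fin m} (hf : ¬ D.tree f) {w : Fin n} (hw : w ≠ D.root) :
    fundVec edg D pe f (edg (pe w)) = if D.cov f w then 1 else 0 := by
  rw [fundVec, indVec_edgesIn]
  refine if_congr ?_ rfl rfl
  have h1 : pe w ≠ f := fun hh => hf (hh ▸ h.pe_tree w hw)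
  have h2 := h.exists_pe_eq_iff hw (p := D.cov f) fun v hv => ne_root_of_cov hv
  simp only [fund, Set.mem_ofPred_eq, h1, h2, false_or]

open Classical in
theorem fundVec_of_not_tree {f g : Fin m} (hg : ¬ D.tree g) :
    fundVec edg D pe f (edg g) = if g = f then 1 else 0 := by
  rw [fundVec, indVec_edgesIn]
  refine if_congr ?_ rfl rfl
  have h2 := h.exists_pe_ne hg (p := D.cov f) fun v hv => ne_root_of_cov hv
  simp only [fund, Set.mem_ofPred_eq, h2, or_false]

theorem ext_vec (hT : IsSpanningTree G T) {x y : G.edgeSet → ℤ}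
    (h1 : ∀ w, w ≠ D.root → x (edg (pe w)) = y (edg (pe w)))
    (h2 : ∀ f, ¬ D.tree f → x (edg f) = y (edg f)) : x = y := by
  funext e
  obtain ⟨f, rfl⟩ := edg.surjective e
  by_cases hf : D.tree f
  · obtain ⟨w, hw, rfl⟩ := h.exists_pe hT hf
    exact h1 w hw
  · exact h2 f hf

/-- The indicator of a symmetric difference is `a + b - 2ab`; the product lives on tree edges
because `f` and `j` are different. -/
theorem pairVec_eq (hT : IsSpanningTree G T) {f j : Fin m} (hf : ¬ D.tree f) (hj : ¬ D.tree j)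
    (hfj : j ≠ f) : pairVec edg D pe (f, j) =
      fundVec edg D pe f + fundVec edg D pe j - 2 • treeVec edg D pe (D.overlap (f, j)) := by
  classical
  refine h.ext_vec hT (fun w hw => ?_) fun g hg => ?_
  · simp only [Pi.add_apply, Pi.sub_apply, Pi.smul_apply, h.treeVec_pe _ hw, h.fundVec_pe hf hw,
      h.fundVec_pe hj hw]
    rw [pairVec, indVec_edgesIn]
    have h1 : pe w ≠ f := fun hh => hf (hh ▸ h.pe_tree w hw)
    have h1' : pe w ≠ j := fun hh => hj (hh ▸ h.pe_tree w hw)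
    have h2 := h.exists_pe_eq_iff hw (p := fun v => ¬ (D.cov f v ↔ D.cov j v))
      fun v hv => ne_root_of_not_iff hv
    simp only [pairSet, Set.mem_ofPred_eq, h1, h1', h2, false_or, overlap]
    by_cases h3 : D.cov f w <;> by_cases h4 : D.cov j w <;> simp [h3, h4]
  · simp only [Pi.add_apply, Pi.sub_apply, Pi.smul_apply, h.treeVec_of_not_tree _ hg,
      h.fundVec_of_not_tree hg]
    rw [pairVec, indVec_edgesIn]
    have h2 := h.exists_pe_ne hg (p := fun v => ¬ (D.cov f v ↔ D.cov j v))
      fun v hv => ne_root_of_not_iff hv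
    simp only [pairSet, Set.mem_ofPred_eq, h2, or_false]
    by_cases h3 : g = f
    · subst h3; simp [hfj.symm]
    · simp [h3]

open Classical in
/-- Modulo the cycles closed by single edges, a cycle is twice a function on the tree edges. -/
theorem indVec_cycle (hT : IsSpanningTree G T) {C : Set β} (hC : IsCycle G C) :
    indVec G C = ∑ f with ¬ D.tree f ∧ (edg f).1 ∈ C, fundVec edg D pe f -
      2 • treeVec edg D pe fun w => ((({f ∈ D.sig m w | (edg f).1 ∈ C}).card / 2 : ℕ) : ℤ) := by
  refine h.ext_vec hT (fun w hw => ?_) fun g hg => ?_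
  · simp only [Pi.sub_apply, Pi.smul_apply, Finset.sum_apply, h.treeVec_pe _ hw]
    rw [Finset.sum_congr rfl fun f hf => h.fundVec_pe (Finset.mem_filter.1 hf).2.1 hw,
      Finset.sum_boole]
    have h1 : ({f ∈ D.sig m w | (edg f).1 ∈ C}) = Finset.filter (D.cov · w)
        (Finset.univ.filter fun f => ¬ D.tree f ∧ (edg f).1 ∈ C) := by
      ext f
      rw [Finset.mem_filter, mem_sig, Finset.mem_filter, Finset.mem_filter]
      simp only [Finset.mem_univ, true_and, cov]
      have := f.isLt
      tauto
    rw [h1]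
    have h2 := h.even_card_sep hC w
    -- Inside the cycle, the cut of `w` consists of the edges that cover `w` and possibly `pe w`
    -- itself. As the total is even, the number of covering edges is odd exactly if `pe w` is in the
    -- cycle.
    have h3 : (Finset.univ.filter fun f : Fin m => (edg f).1 ∈ C ∧ D.Sep (D.src f) (D.tgt f) w) =
        Finset.filter (D.cov · w) (Finset.univ.filter fun f => ¬ D.tree f ∧ (edg f).1 ∈ C) ∪
          if (edg (pe w)).1 ∈ C then {pe w} else ∅ := by
      ext f
      simp only [Finset.mem_filter, Finset.mem_univ, true_and, Finset.mem_union, cov_iff_sep]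
      by_cases hf : D.tree f
      · obtain ⟨u, hu, rfl⟩ := h.exists_pe hT hf
        rw [h.sep_pe hu]
        by_cases hwu : w = u
        · subst hwu
          split_ifs with h4 <;> simp [h4, hf]
        · have h5 : pe u ≠ pe w := fun hh => hwu (h.pe_inj hu hw hh).symm
          split_ifs with h4 <;> simp [hwu, hf, h5]
      · have h5 : f ≠ pe w := fun hh => hf (hh ▸ h.pe_tree w hw)
        split_ifs with h4 <;> simp [hf, h5]
    have h4 : pe w ∉ Finset.filter (D.cov · w)
        (Finset.univ.filter fun f => ¬ D.tree f ∧ (edg f).1 ∈ C) := by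
      simp [h.pe_tree w hw]
    rw [h3] at h2
    generalize Finset.filter (D.cov · w) (Finset.univ.filter fun f => ¬ D.tree f ∧ (edg f).1 ∈ C) = F
      at h2 h4
    by_cases h5 : (edg (pe w)).1 ∈ C
    · rw [if_pos h5, Finset.union_comm, ← Finset.insert_eq, Finset.card_insert_of_notMem h4] at h2
      have : indVec G C (edg (pe w)) = 1 := by simp [indVec, h5]
      rw [this]
      obtain ⟨r, hr⟩ := h2
      rw [show F.card = 2 * (r - 1) + 1 by omega]
      generalize r - 1 = k
      rw [show (2 * k + 1) / 2 = k by omega]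
      push_cast
      simp
    · rw [if_neg h5, Finset.union_empty] at h2
      have : indVec G C (edg (pe w)) = 0 := by simp [indVec, h5]
      rw [this]
      obtain ⟨r, hr⟩ := h2
      rw [hr, show (r + r) / 2 = r by omega]
      push_cast
      simp
      ring
  · simp only [Pi.sub_apply, Pi.smul_apply, Finset.sum_apply, h.treeVec_of_not_tree _ hg,
      h.fundVec_of_not_tree hg]
    simp [indVec, Set.indicator_apply, hg]

omit h in
open Classical in
-- A count of at most one is rounded down to zero after halving, which is the vanishing condition in
-- `lat`.
theorem half_count_mem_lat (C : Set β) :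
    (fun w => ((({f ∈ D.sig m w | (edg f).1 ∈ C}).card / 2 : ℕ) : ℤ)) ∈ D.lat m := by
  refine ⟨fun v hv => ?_, fun v w hvw => by simp only [hvw]⟩
  have := (Finset.card_filter_le (D.sig m v) fun f => (edg f).1 ∈ C).trans hv
  simp only [Nat.cast_eq_zero]
  omega

variable (D) in
omit h in
open Classical in
/-- The cycles closed by single edges, and the pairs in `Q`. -/
noncomputable def gens (Q : Finset (Fin m × Fin m)) : Finset (Fin m ⊕ Fin m × Fin m) :=
  Finset.disjSum {f | ¬ D.tree f} Q

variable (D) in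
omit h in
/-- The pairs consist of different edges outside the tree whose tree paths overlap. -/
def IsOverlapping (Q : Finset (Fin m × Fin m)) : Prop :=
  ∀ p ∈ Q, p.2 ≠ p.1 ∧ ∃ v, D.cov p.1 v ∧ D.cov p.2 v

variable (D pe) in
omit h in
/-- The edge numbers of the cycles in question. -/
def genCycle : Fin m ⊕ Fin m × Fin m → Set (Fin m) := Sum.elim (fund D pe) (pairSet D pe)

theorem isCycle_gens {Q : Finset (Fin m × Fin m)} (hQ : IsOverlapping D Q)
    {g : Fin m ⊕ Fin m × Fin m} (hg : g ∈ gens D Q) : IsCycle G (edgesIn edg (genCycle D pe g)) := by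
  rcases g with f | ⟨f, j⟩
  · simp only [gens, Finset.inl_mem_disjSum, Finset.mem_filter, Finset.mem_univ, true_and] at hg
    exact h.isCycle_fund hg
  · simp only [gens, Finset.inr_mem_disjSum] at hg
    obtain ⟨h1, v, h2, h3⟩ := hQ _ hg
    exact h.isCycle_pair h2.1 h3.1 h1 ⟨v, h2, h3⟩

/-- The coordinates outside the tree express the coefficients of the fundamental cycles by those of
the pairs. Inserted into the tree coordinates, the fundamental vectors cancel and twice a relation
between overlaps is left. -/
theorem linearIndepOn_gens (hT : IsSpanningTree G T) {Q : Finset (Fin m × Fin m)}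
    (hQ : IsOverlapping D Q) (hi : LinearIndepOn ℤ D.overlap (Q : Set (Fin m × Fin m))) :
    LinearIndepOn ℤ (fun g => indVec G (edgesIn edg (genCycle D pe g)))
      (gens D Q : Set (Fin m ⊕ Fin m × Fin m)) := by
  classical
  rw [linearIndepOn_finset_iff] at hi ⊢
  intro c hc
  have hQ1 : ∀ p ∈ Q, ¬ D.tree p.1 := fun p hp => by
    obtain ⟨-, v, h2, -⟩ := hQ p hp; exact h2.1
  have hQ2 : ∀ p ∈ Q, ¬ D.tree p.2 := fun p hp => by
    obtain ⟨-, v, -, h2⟩ := hQ p hp; exact h2.1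
  rw [gens, Finset.sum_disjSum] at hc
  replace hc : ∑ f with ¬ D.tree f, c (.inl f) • fundVec edg D pe f +
      ∑ p ∈ Q, c (.inr p) • (fundVec edg D pe p.1 + fundVec edg D pe p.2 -
        2 • treeVec edg D pe (D.overlap p)) = 0 := by
    rw [← hc]
    congr 1
    refine Finset.sum_congr rfl fun p hp => ?_
    rw [← h.pairVec_eq hT (hQ1 p hp) (hQ2 p hp) (hQ p hp).1]
    rfl
  have htree : ∀ w, w ≠ D.root → ∑ f with ¬ D.tree f, c (.inl f) * (if D.cov f w then 1 else 0) +
      ∑ p ∈ Q, c (.inr p) * ((if D.cov p.1 w then 1 else 0) + (if D.cov p.2 w then 1 else 0) -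
        2 * D.overlap p w) = 0 := by
    intro w hw
    have := congrFun hc (edg (pe w))
    simp only [Pi.add_apply, Finset.sum_apply, Pi.smul_apply, Pi.sub_apply, Pi.zero_apply,
      h.treeVec_pe _ hw, smul_eq_mul] at this
    refine Eq.trans ?_ this
    congr 1
    · exact Finset.sum_congr rfl fun f hf => by rw [h.fundVec_pe (Finset.mem_filter.1 hf).2 hw]
    · exact Finset.sum_congr rfl fun p hp => by
        rw [h.fundVec_pe (hQ1 p hp) hw, h.fundVec_pe (hQ2 p hp) hw]; simp
  have hnon : ∀ g, ¬ D.tree g → c (.inl g) +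
      ∑ p ∈ Q, c (.inr p) * ((if g = p.1 then 1 else 0) + (if g = p.2 then 1 else 0)) = 0 := by
    intro g hg
    have := congrFun hc (edg g)
    simp only [Pi.add_apply, Finset.sum_apply, Pi.smul_apply, Pi.sub_apply, Pi.zero_apply,
      h.treeVec_of_not_tree _ hg, smul_eq_mul, h.fundVec_of_not_tree hg, smul_zero, sub_zero] at this
    refine Eq.trans ?_ this
    congr 1
    simp [hg]
  have hpair : ∀ p ∈ Q, c (.inr p) = 0 := by
    refine hi (fun p => c (.inr p)) ?_
    funext w
    rw [Finset.sum_apply, Pi.zero_apply]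
    simp only [Pi.smul_apply, smul_eq_mul]
    by_cases hw : w = D.root
    · refine Finset.sum_eq_zero fun p _ => ?_
      have : ¬ D.cov p.1 w := fun hh => ne_root_of_cov hh hw
      simp [overlap, this]
    -- The relations outside the tree, each weighted by whether its edge covers `w` and then summed;
    -- this is the fundamental part of the coordinate at `w`.
    have h1 : ∑ f with ¬ D.tree f, (c (.inl f) + ∑ p ∈ Q, c (.inr p) *
        ((if f = p.1 then 1 else 0) + (if f = p.2 then 1 else 0))) *
          (if D.cov f w then 1 else 0) = 0 :=
      Finset.sum_eq_zero fun f hf => by rw [hnon f (Finset.mem_filter.1 hf).2, zero_mul]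
    have h2 : ∑ f with ¬ D.tree f, (∑ p ∈ Q, c (.inr p) *
        ((if f = p.1 then 1 else 0) + (if f = p.2 then 1 else 0))) *
          (if D.cov f w then 1 else 0) =
        ∑ p ∈ Q, c (.inr p) * ((if D.cov p.1 w then 1 else 0) + (if D.cov p.2 w then 1 else 0)) := by
      simp only [Finset.sum_mul]
      rw [Finset.sum_comm]
      refine Finset.sum_congr rfl fun p hp => ?_
      simp only [mul_assoc, ← Finset.mul_sum, add_mul, Finset.sum_add_distrib, ite_mul, one_mul,
        zero_mul]
      rw [Finset.sum_ite_eq', Finset.sum_ite_eq']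
      simp [hQ1 p hp, hQ2 p hp]
    simp only [add_mul, Finset.sum_add_distrib] at h1
    have h3 := htree w hw
    simp only [mul_sub, Finset.sum_sub_distrib] at h3
    have h4 : ∑ p ∈ Q, c (.inr p) * (2 * D.overlap p w) =
        2 * ∑ p ∈ Q, c (.inr p) * D.overlap p w := by
      rw [Finset.mul_sum]
      exact Finset.sum_congr rfl fun p _ => by ring
    linarith
  intro g hg
  rcases g with f | p
  · simp only [gens, Finset.inl_mem_disjSum, Finset.mem_filter, Finset.mem_univ, true_and] at hg
    have := hnon f hg
    rwa [Finset.sum_eq_zero fun p hp => by rw [hpair p hp, zero_mul], add_zero] at this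
  · simp only [gens, Finset.inr_mem_disjSum] at hg
    exact hpair p hg

/-- Solved for twice the overlap, `pairVec_eq` puts `2 • lat m` into the span, and by `indVec_cycle`
every cycle is fundamental cycles plus an element of `2 • lat m`. -/
theorem span_gens (hT : IsSpanningTree G T) {Q : Finset (Fin m × Fin m)}
    (hQ : IsOverlapping D Q) (hs : Submodule.span ℤ (D.overlap '' Q) = D.lat m) :
    Submodule.span ℤ ((fun g => indVec G (edgesIn edg (genCycle D pe g))) '' (gens D Q)) =
      cycleLattice G := by
  classical
  apply le_antisymm
  · refine Submodule.span_mono ?_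
    rintro _ ⟨g, hg, rfl⟩
    exact ⟨_, h.isCycle_gens hQ hg, rfl⟩
  · refine Submodule.span_le.2 ?_
    rintro _ ⟨C, hC, rfl⟩
    set U := Submodule.span ℤ ((fun g => indVec G (edgesIn edg (genCycle D pe g))) '' (gens D Q))
    have h1 : ∀ f, ¬ D.tree f → fundVec edg D pe f ∈ U := fun f hf =>
      Submodule.subset_span ⟨.inl f, by simp [gens, hf], rfl⟩
    have h2 : ∀ z ∈ D.lat m, 2 • treeVec edg D pe z ∈ U := by
      intro z hz
      rw [← hs] at hz
      induction hz using Submodule.span_induction with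
      | mem z hz =>
        obtain ⟨⟨f, j⟩, hp, rfl⟩ := hz
        obtain ⟨h3, v, h4, h5⟩ := hQ _ hp
        have h6 : pairVec edg D pe (f, j) ∈ U :=
          Submodule.subset_span ⟨.inr (f, j), by simpa [gens] using hp, rfl⟩
        have h7 := h.pairVec_eq hT h4.1 h5.1 h3
        have h8 : 2 • treeVec edg D pe (D.overlap (f, j)) =
            fundVec edg D pe f + fundVec edg D pe j - pairVec edg D pe (f, j) := by
          rw [h7]; abel
        rw [h8]
        exact sub_mem (add_mem (h1 f h4.1) (h1 j h5.1)) h6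
      | zero => simp
      | add x y _ _ hx hy => rw [map_add, smul_add]; exact add_mem hx hy
      | smul a x _ hx => rw [map_smul, smul_comm]; exact U.smul_mem a hx
    rw [SetLike.mem_coe, h.indVec_cycle hT hC]
    exact sub_mem (sum_mem fun f hf => h1 f (Finset.mem_filter.1 hf).2.1)
      (h2 _ (half_count_mem_lat C))

/-! ### Lengths -/

/-- A step along a tree edge changes sides at this tree edge only, so a walk needs a step for every
tree edge that separates its ends. -/
theorem card_sep_le_length (hT : IsSpanningTree G T) {x y : (G.restrict T).vertexSet}
    (p : (G.restrict T).toSimpleGraph.Walk x y) {u v : Fin n} (hx : x.1 = vtx u) (hy : y.1 = vtx v)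
    [DecidablePred (D.Sep u v)] : (Finset.univ.filter fun w => D.Sep u v w).card ≤ p.length := by
  classical
  induction p generalizing u with
  | nil =>
    obtain rfl : u = v := vtx.injective (Subtype.ext (hx.symm.trans hy))
    simp [Sep]
  | @cons x z y hxz p ih =>
    obtain ⟨w, hw⟩ := vtx.surjective ⟨z.1, z.2⟩
    have hz : z.1 = vtx w := by rw [hw]
    have hadj : ∃ e, e ∈ T ∧ G.IsLink e x.1 z.1 := hxz.2
    obtain ⟨e, heT, he⟩ := hadj
    obtain ⟨f, hf⟩ := edg.surjective ⟨e, he.edge_mem⟩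
    have hfe : (edg f).1 = e := by rw [hf]
    obtain ⟨w₀, hw₀, rfl⟩ := h.exists_pe hT ((h.tree_iff f).2 (hfe ▸ heT))
    rw [hx, hz, ← hfe] at he
    have hsub : (Finset.univ.filter fun a => D.Sep u v a) ⊆
        insert w₀ (Finset.univ.filter fun a => D.Sep w v a) := by
      intro a ha
      simp only [Finset.mem_filter, Finset.mem_univ, true_and, Finset.mem_insert] at ha ⊢
      rw [← h.sep_pe hw₀, h.sep_iff he]
      simp only [Sep] at ha ⊢
      tauto
    have h1 := Finset.card_le_card hsub
    have h2 := Finset.card_insert_le w₀ (Finset.univ.filter fun a => D.Sep w v a)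
    have h3 := ih hz hy
    rw [SimpleGraph.Walk.length_cons]
    convert! h1.trans (h2.trans (Nat.add_le_add_right h3 1))

variable (D) in
omit h in
open Classical in
/-- The tree path between the ends of `f`. -/
noncomputable def path (f : Fin m) : Finset (Fin n) := {v | D.cov f v}

theorem card_path_le (hT : IsSpanningTree G T) (f : Fin m) :
    (path D f).card ≤ treeDiam G T := by
  classical
  have : Finite (G.restrict T).vertexSet := Finite.of_equiv _ vtx
  have hc : (G.restrict T).toSimpleGraph.Connected := hT.2.1
  have hne : Nonempty (G.restrict T).vertexSet := hc.nonempty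
  obtain ⟨p, hp⟩ := (hc (vtx (D.src f)) (vtx (D.tgt f))).exists_walk_length_eq_dist
  have h1 := h.card_sep_le_length hT p rfl rfl
  rw [hp] at h1
  refine le_trans (Finset.card_le_card ?_) (h1.trans (SimpleGraph.dist_le_diam
    (SimpleGraph.connected_iff_ediam_ne_top.1 hc)))
  intro v hv
  simp only [path, Finset.mem_filter, Finset.mem_univ, true_and] at hv ⊢
  exact hv.2

omit h in
theorem one_le_treeDiam (hn : 2 ≤ n) (vtx : Fin n ≃ G.vertexSet) (hT : IsSpanningTree G T) :
    1 ≤ treeDiam G T := by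
  have : Finite (G.restrict T).vertexSet := Finite.of_equiv _ vtx
  have hc : (G.restrict T).toSimpleGraph.Connected := hT.2.1
  have hne : Nonempty (G.restrict T).vertexSet := hc.nonempty
  have : Nontrivial (Fin n) := Fin.nontrivial_iff_two_le.2 hn
  have : Nontrivial (G.restrict T).vertexSet := vtx.symm.nontrivial
  have := SimpleGraph.diam_ne_zero_of_ediam_ne_top (SimpleGraph.connected_iff_ediam_ne_top.1 hc)
  exact Nat.one_le_iff_ne_zero.2 this

omit h in
theorem ncard_edgesIn_le {S : Set (Fin m)} {F : Finset (Fin m)} (hS : S ⊆ F) :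
    (edgesIn edg S).ncard ≤ F.card := by
  have h1 : edgesIn edg S ⊆ (fun i => (edg i).1) '' (F : Set (Fin m)) := by
    rintro _ ⟨i, hi, rfl⟩
    exact ⟨i, hS hi, rfl⟩
  refine (Set.ncard_le_ncard h1 (F.finite_toSet.image _)).trans ?_
  exact (Set.ncard_image_le F.finite_toSet).trans (Set.ncard_coe_finset F).le

/-- A fundamental cycle has at most `treeDiam G T + 1` edges, which is enough as the diameter is
positive. In a pair, a common tree edge is dropped from both paths and makes room for the two edges
outside the tree. -/
theorem ncard_gens_le (hn : 2 ≤ n) (hT : IsSpanningTree G T) {Q : Finset (Fin m × Fin m)}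
    (hQ : IsOverlapping D Q) {g : Fin m ⊕ Fin m × Fin m} (hg : g ∈ gens D Q) :
    (edgesIn edg (genCycle D pe g)).ncard ≤ 2 * treeDiam G T := by
  classical
  have h1 := one_le_treeDiam hn vtx hT
  rcases g with f | ⟨f, j⟩
  · simp only [gens, Finset.inl_mem_disjSum, Finset.mem_filter, Finset.mem_univ, true_and] at hg
    have h2 := h.card_path_le hT f
    have h3 : genCycle D pe (.inl f) ⊆ (insert f ((path D f).image pe) : Finset (Fin m)) := by
      rintro e (rfl | ⟨w, rfl, hw⟩)
      · simp
      · simp only [Finset.coe_insert, Finset.coe_image, Set.mem_insert_iff, Set.mem_image,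
          Finset.mem_coe]
        exact .inr ⟨w, by simp [path, hw], rfl⟩
    have h4 := ncard_edgesIn_le (edg := edg) h3
    have h5 := Finset.card_insert_le f ((path D f).image pe)
    have h6 := Finset.card_image_le (s := path D f) (f := pe)
    omega
  · simp only [gens, Finset.inr_mem_disjSum] at hg
    obtain ⟨-, v, hfv, hjv⟩ := hQ _ hg
    have h2 := h.card_path_le hT f
    have h2' := h.card_path_le hT j
    have h3 : genCycle D pe (.inr (f, j)) ⊆
        (insert f (insert j ((path D f \ path D j ∪ path D j \ path D f).image pe)) :
          Finset (Fin m)) := by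
      rintro e (rfl | rfl | ⟨w, rfl, hw⟩)
      · simp
      · simp
      · simp only [Finset.coe_insert, Finset.coe_image, Set.mem_insert_iff, Set.mem_image,
          Finset.mem_coe]
        refine .inr (.inr ⟨w, ?_, rfl⟩)
        simp only [path, Finset.mem_union, Finset.mem_sdiff, Finset.mem_filter, Finset.mem_univ,
          true_and]
        tauto
    have h4 := ncard_edgesIn_le (edg := edg) h3
    have h5 := Finset.card_insert_le f (insert j
      ((path D f \ path D j ∪ path D j \ path D f).image pe))
    have h6 := Finset.card_insert_le j ((path D f \ path D j ∪ path D j \ path D f).image pe)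
    have h7 := Finset.card_image_le (s := path D f \ path D j ∪ path D j \ path D f) (f := pe)
    have h8 := Finset.card_union_le (path D f \ path D j) (path D j \ path D f)
    have h9 := Finset.card_sdiff_add_card_inter (path D f) (path D j)
    have h10 := Finset.card_sdiff_add_card_inter (path D j) (path D f)
    rw [Finset.inter_comm] at h10
    have h11 : 1 ≤ (path D f ∩ path D j).card :=
      Finset.card_pos.2 ⟨v, by simp [path, hfv, hjv]⟩
    omega

end Realizes

end RootedTree

end Graphs

end CycleLattice

namespace CycleLattice

/-! ### The program -/

attribute [simp] Expr.eval Expr.cost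

infixr:60 " ;; " => Prog.seq

/-- The entry of the array `a` at the position in register `x`. -/
def Expr.at (a x : ℕ) : Expr := .read a (.reg x)

/-- Nonzero if and only if the values differ. -/
def Expr.neq (p q : Expr) : Expr := .add (.sub p q) (.sub q p)

@[simp] theorem Expr.eval_at (a x : ℕ) (s : State) : (Expr.at a x).eval s = s.arr a (s.reg x) := rfl

@[simp] theorem Expr.cost_at (a x : ℕ) : (Expr.at a x).cost = 2 := rfl

theorem Expr.eval_neq {p q : Expr} {s : State} : (Expr.neq p q).eval s ≠ 0 ↔ p.eval s ≠ q.eval s := by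
  simp only [Expr.neq, Expr.eval]
  omega

@[simp] theorem Expr.cost_neq (p q : Expr) : (Expr.neq p q).cost = 2 * (p.cost + q.cost) + 3 := by
  simp only [Expr.neq, Expr.cost]
  omega

/-- Fills array `8` with the multiples of the number of vertices. -/
def rowsProg : Prog :=
  .for 4 (.reg 0) (.write 8 (.reg 4) (.reg 14) ;; .assign 14 (.add (.reg 14) (.reg 0)))

/-- Fills arrays `6` and `7` with the ends of the edges. -/
def endsProg : Prog :=
  .for 4 (.reg 0) (.for 5 (.sub (.read 0 (.add (.reg 4) (.const 1))) (.at 0 4))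
    (.write 6 (.read 2 (.add (.at 0 4) (.reg 5))) (.reg 4) ;;
      .write 7 (.read 2 (.add (.at 0 4) (.reg 5))) (.read 1 (.add (.at 0 4) (.reg 5)))))

/-- Appends the vertex in register `8` to the tree, as a child of the vertex in register `7`. -/
def visitProg : Prog :=
  .for 6 (.reg 0) (.write 9 (.add (.at 8 8) (.reg 6)) (.read 9 (.add (.at 8 7) (.reg 6)))) ;;
    .write 9 (.add (.at 8 8) (.reg 8)) (.const 1) ;; .write 10 (.reg 8) (.const 1) ;;
    .write 12 (.reg 8) (.reg 5)

/-- Visits the end of the edge in register `5`, if it is a tree edge with one visited end. -/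
def growStep : Prog :=
  .cond (.read 10 (.at 7 5)) (.assign 7 (.at 7 5) ;; .assign 8 (.at 6 5))
      (.assign 7 (.at 6 5) ;; .assign 8 (.at 7 5)) ;;
    .cond (.sub (.add (.at 3 5) (.at 10 7)) (.add (.const 1) (.at 10 8))) visitProg .skip

/-- Builds the rooted tree: array `9` holds the ancestor matrix, array `12` the edges to the
parents. -/
def growProg : Prog :=
  .write 10 (.const 0) (.const 1) ;; .for 4 (.reg 0) (.for 5 (.reg 1) growStep)

/-! ### Numbering the ends -/

theorem runs_rows {W n : ℕ} {s : State} (hn : s.reg 0 = n) (h14 : s.reg 14 = 0) (hW : n * n ≤ W)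
    (hW' : n ≤ W) : Runs W rowsProg s fun t s' => t ≤ 20 * n + 20 ∧ ∀ v < n, s'.arr 8 v = v * n := by
  refine Runs.for (N := n)
    (fun k t s => t ≤ 20 * k ∧ s.reg 14 = k * n ∧ ∀ v < k, s.arr 8 v = v * n) hW' ?_ ?_ ?_ ?_
  · intro s' hs
    rw [Expr.eval, hs.reg 0 rfl, hn]
  · simp [h14]
  · rintro k t s' hk ⟨h1, h2, h3⟩ h4 hs
    have h0 : s'.reg 0 = n := (hs.reg 0 rfl).trans hn
    have h5 : k * n + n ≤ W := by nlinarith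
    refine .seq (.write (by simp; omega) (by simp; omega) (.assign (by simp; omega) ?_))
    simp only [State.setReg_reg, State.setArr_reg, State.setArr_arr, Expr.eval, Expr.cost,
      State.setReg_arr]
    refine ⟨by simp [h4], by omega, by simp [h2, h0]; ring, fun v hv => ?_⟩
    by_cases hvk : v = k
    · simp [hvk, h4, h2]
    · simp only [true_and, h4, hvk, if_false]
      exact h3 v (by omega)
  · rintro t s' ⟨h1, h2, h3⟩ hs
    exact ⟨by simp; omega, h3⟩

theorem offsets_eq {γ : Type*} (L : List (List γ)) :
    offsets L = (List.range (L.length + 1)).map fun i => (L.take i).flatten.length := by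
  suffices ∀ (L : List (List γ)) (a : ℕ), (L.map List.length).scanl (· + ·) a =
      (List.range (L.length + 1)).map fun i => a + (L.take i).flatten.length by
    rw [offsets, this]
    simp only [Nat.zero_add]
  intro L
  induction L with
  | nil => intro a; simp
  | cons l L ih =>
    intro a
    rw [List.map_cons, List.scanl_cons, ih, List.length_cons, List.range_succ_eq_map (n := L.length + 1)]
    simp [Function.comp_def, add_assoc]

theorem flatten_getElem? {γ : Type*} (L : List (List γ)) (v p : ℕ) (hv : v < L.length)
    (hp : p < L[v].length) : L.flatten[(L.take v).flatten.length + p]? = some L[v][p] := by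
  have h : L.flatten = (L.take v).flatten ++ (L[v] ++ (L.drop (v + 1)).flatten) := by
    conv_lhs => rw [← List.take_append_drop v L, List.drop_eq_getElem_cons hv, List.flatten_append,
      List.flatten_cons]
  rw [h, List.getElem?_append_right (by omega), Nat.add_sub_cancel_left,
    List.getElem?_append_left hp, List.getElem?_eq_getElem hp]

/-! ### Reading the adjacency lists -/

section Input

variable {α β : Type*} {n m : ℕ} {G : Graph α β} {vtx : Fin n ≃ G.vertexSet}
  {edg : Fin m ≃ G.edgeSet} {adj : Fin n → List (Fin m × Fin n)}

/-- The other end of an edge at `v` is determined by the edge, so every edge, even a loop, is listed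
at most once. -/
theorem length_adj_le (hadj : IsAdjList G vtx edg adj) (v : Fin n) : (adj v).length ≤ m := by
  have h1 : ((adj v).map Prod.fst).Nodup := by
    refine List.Nodup.map_on ?_ (hadj v).1
    rintro ⟨e, w⟩ h ⟨e', w'⟩ h' hee
    obtain rfl : e = e' := hee
    have := (((hadj v).2 _ _).1 h).right_unique (((hadj v).2 _ _).1 h')
    rw [vtx.injective (Subtype.ext this)]
  simpa using h1.length_le_card

/-- The arrays `0`, `1` and `2` hold the adjacency lists. -/
structure HoldsAdj (adj : Fin n → List (Fin m × Fin n)) (s : State) : Prop where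
  len : ∀ v : Fin n, s.arr 0 (v + 1) - s.arr 0 v = (adj v).length
  nbr : ∀ (v : Fin n) (p : ℕ) (hp : p < (adj v).length), s.arr 1 (s.arr 0 v + p) = (adj v)[p].2
  edge : ∀ (v : Fin n) (p : ℕ) (hp : p < (adj v).length), s.arr 2 (s.arr 0 v + p) = (adj v)[p].1

theorem holdsAdj_inputState (adj : Fin n → List (Fin m × Fin n)) (tree : Set (Fin m)) :
    HoldsAdj adj (inputState adj tree) := by
  have h0 : ∀ v ≤ n, (inputState adj tree).arr 0 v = ((List.ofFn adj).take v).flatten.length := by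
    intro v hv
    show (offsets (List.ofFn adj)).getD v 0 = _
    rw [offsets_eq, List.getD_eq_getElem?_getD, List.getElem?_map, List.getElem?_range (by simp; omega)]
    rfl
  refine ⟨fun v => ?_, fun v p hp => ?_, fun v p hp => ?_⟩
  · rw [h0 _ v.isLt, h0 _ v.isLt.le, List.take_add_one]
    simp
  all_goals
    rw [h0 _ v.isLt.le]
    show List.getD _ _ 0 = _
    rw [List.getD_eq_getElem?_getD, List.getElem?_map,
      flatten_getElem? _ v.val p (by simp) (by simpa using hp)]
    simp

/-- The arrays `6` and `7` hold ends of the edge `e`. -/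
def HasEnds (G : Graph α β) (vtx : Fin n ≃ G.vertexSet) (edg : Fin m ≃ G.edgeSet) (s : State)
    (e : Fin m) : Prop :=
  ∃ u v : Fin n, s.arr 6 e = u ∧ s.arr 7 e = v ∧ G.IsLink (edg e).1 (vtx u).1 (vtx v).1

/-- An edge is written again when it is met from its other end. Either orientation is valid, hence
the invariant only asks for some orientation. -/
theorem runs_ends {W : ℕ} {s : State} (hn : s.reg 0 = n) (hs : HoldsAdj adj s)
    (hadj : IsAdjList G vtx edg adj) (hWn : n ≤ W) (hWm : m ≤ W) :
    Runs W endsProg s fun t s' => t ≤ 50 * (n * m) + 50 * n + 50 ∧ ∀ e, HasEnds G vtx edg s' e := by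
  refine Runs.for (N := n) (fun k t s => t ≤ k * (50 * m + 50) ∧
    ∀ v : Fin n, v.val < k → ∀ q ∈ adj v, HasEnds G vtx edg s q.1) hWn ?_ ?_ ?_ ?_
  · intro s' hF
    rw [Expr.eval, hF.reg 0 rfl, hn]
  · simp
  · rintro k t s₁ hk ⟨h1, h2⟩ h4 hF
    have hlen := length_adj_le hadj ⟨k, hk⟩
    have a0 := hF.arr 0 rfl
    have a1 := hF.arr 1 rfl
    have a2 := hF.arr 2 rfl
    refine Runs.for (N := (adj ⟨k, hk⟩).length) (fun p t s' => t ≤ p * 40 ∧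
      (∀ v : Fin n, v.val < k → ∀ q ∈ adj v, HasEnds G vtx edg s' q.1) ∧
      ∀ (i : ℕ) (hi : i < (adj ⟨k, hk⟩).length), i < p → HasEnds G vtx edg s' (adj ⟨k, hk⟩)[i].1)
      (hlen.trans hWm) ?_ ?_ ?_ ?_
    · intro s₂ hF₂
      have := hs.len ⟨k, hk⟩
      simp only [Expr.eval, Expr.eval_at, hF₂.reg 4 rfl, hF₂.arr 0 rfl, a0, h4]
      exact this
    · exact ⟨by simp, h2, by simp⟩
    · rintro p t₂ s₂ hp ⟨h5, h6, h7⟩ h8 hF₂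
      have r4 : s₂.reg 4 = k := (hF₂.reg 4 rfl).trans h4
      have b0 : s₂.arr 0 = s.arr 0 := (hF₂.arr 0 rfl).trans a0
      have b1 : s₂.arr 1 = s.arr 1 := (hF₂.arr 1 rfl).trans a1
      have b2 : s₂.arr 2 = s.arr 2 := (hF₂.arr 2 rfl).trans a2
      have he := hs.edge ⟨k, hk⟩ p hp
      have hw := hs.nbr ⟨k, hk⟩ p hp
      have hl := ((hadj ⟨k, hk⟩).2 (adj ⟨k, hk⟩)[p].1 (adj ⟨k, hk⟩)[p].2).1 (List.getElem_mem hp)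
      have hWp : ((adj ⟨k, hk⟩)[p].1).val ≤ W := ((adj ⟨k, hk⟩)[p].1).isLt.le.trans hWm
      have hWp' : ((adj ⟨k, hk⟩)[p].2).val ≤ W := ((adj ⟨k, hk⟩)[p].2).isLt.le.trans hWn
      have hk' : (⟨k, hk⟩ : Fin n).val = k := rfl
      rw [hk'] at he hw
      refine .seq (.write (by simpa [r4, h8, b0, b2, he] using hWp) (by simp [r4]; omega)
        (.write (by simpa [r4, h8, b0, b2, he] using hWp)
          (by simpa [r4, h8, b0, b1, hw] using hWp') ?_))
      refine ⟨by simpa using h8, by simp; omega, ?_⟩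
      have key : ∀ e' : Fin m, (e' ≠ (adj ⟨k, hk⟩)[p].1 → HasEnds G vtx edg s₂ e') →
          HasEnds G vtx edg ((((s₂.setArr 6 (s₂.arr 2 (s₂.arr 0 (s₂.reg 4) + s₂.reg 5))
            (s₂.reg 4)).setArr 7 (s₂.arr 2 (s₂.arr 0 (s₂.reg 4) + s₂.reg 5))
            (s₂.arr 1 (s₂.arr 0 (s₂.reg 4) + s₂.reg 5)))).setReg 5 (p + 1)) e' := by
        intro e' h9
        simp only [r4, h8, b0, b1, b2, he, hw]
        by_cases hee : e' = (adj ⟨k, hk⟩)[p].1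
        · subst hee
          exact ⟨⟨k, hk⟩, _, by simp, by simp, hl⟩
        · obtain ⟨u, v, hu, hv, huv⟩ := h9 hee
          have : e'.val ≠ ((adj ⟨k, hk⟩)[p].1).val := fun hh => hee (Fin.ext hh)
          exact ⟨u, v, by simp [this, hu], by simp [this, hv], huv⟩
      refine ⟨fun v hv q hq => key _ fun _ => h6 v hv q hq, fun i hi hip => key _ fun hne => ?_⟩
      refine h7 i hi ?_
      by_contra hh
      obtain rfl : i = p := by omega
      exact hne rfl
    · rintro t₂ s₂ ⟨h5, h6, h7⟩ hF₂
      refine ⟨(hF₂.reg 4 rfl).trans h4, ?_, fun v hv q hq => ?_⟩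
      · simp
        nlinarith
      · show HasEnds G vtx edg s₂ q.1
        by_cases hvk : v.val = k
        · obtain rfl : v = ⟨k, hk⟩ := Fin.ext hvk
          obtain ⟨i, hi, rfl⟩ := List.getElem_of_mem hq
          exact h7 i hi hi
        · exact h6 v (by omega) q hq
  · rintro t s' ⟨h1, h2⟩ hF
    refine ⟨by simp; nlinarith, fun e => ?_⟩
    obtain ⟨x, y, hxy⟩ := G.exists_isLink_of_mem_edgeSet (edg e).2
    obtain ⟨u, hu⟩ := vtx.surjective ⟨x, hxy.left_mem⟩
    obtain ⟨v, hv⟩ := vtx.surjective ⟨y, hxy.right_mem⟩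
    refine h2 u u.isLt (e, v) (((hadj u).2 e v).2 ?_)
    rwa [hu, hv]

end Input

end CycleLattice

namespace CycleLattice

/-! ### Building the tree -/

theorem mul_add_inj {n u w u' w' : ℕ} (hw : w < n) (hw' : w' < n) :
    u * n + w = u' * n + w' ↔ u = u' ∧ w = w' := by
  constructor
  · intro h
    have hn : 0 < n := by omega
    have h1 := congrArg (· / n) h
    have h2 := congrArg (· % n) h
    simp only [Nat.mul_comm _ n, Nat.mul_add_div hn, Nat.div_eq_of_lt hw, Nat.div_eq_of_lt hw',
      Nat.mul_add_mod, Nat.mod_eq_of_lt hw, Nat.mod_eq_of_lt hw'] at h1 h2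
    exact ⟨by simpa using h1, h2⟩
  · rintro ⟨rfl, rfl⟩; rfl

theorem mul_add_lt {n u w : ℕ} (hu : u < n) (hw : w < n) : u * n + w < n * n := by
  nlinarith

section Grow

variable {n m W : ℕ} {s : State}

/-- The path from a child to the root extends that of its parent by one edge, so the new row of the
matrix is a copy with one more entry set. -/
theorem runs_visit {u w e : ℕ} (hn : s.reg 0 = n) (h5 : s.reg 5 = e) (h7 : s.reg 7 = u)
    (h8 : s.reg 8 = w) (hrow : ∀ v < n, s.arr 8 v = v * n) (hu : u < n) (hw : w < n) (huw : u ≠ w)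
    (hval : ∀ x < n, s.arr 9 (u * n + x) ≤ 1) (he : e ≤ W) (hW : n * n ≤ W) (hW1 : 1 ≤ W) :
    Runs W visitProg s fun t s' => t ≤ 30 * n + 30 ∧
      (∀ v < n, ∀ x < n, s'.arr 9 (v * n + x) =
        if v = w then (if x = w then 1 else s.arr 9 (u * n + x)) else s.arr 9 (v * n + x)) ∧
      s'.arr 10 = Function.update (s.arr 10) w 1 ∧ s'.arr 12 = Function.update (s.arr 12) w e := by
  have hWn : n ≤ W := by nlinarith
  refine .seq ((Runs.for (N := n) (fun k t s' => t ≤ 20 * k ∧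
    ∀ v < n, ∀ x < n, s'.arr 9 (v * n + x) =
        if v = w ∧ x < k then s.arr 9 (u * n + x) else s.arr 9 (v * n + x)) (Q := fun t s' =>
      t ≤ 20 * n + 10 ∧ ∀ v < n, ∀ x < n, s'.arr 9 (v * n + x) =
        if v = w then s.arr 9 (u * n + x) else s.arr 9 (v * n + x)) hWn ?_ ?_ ?_ ?_).frame.mono ?_)
  · intro s' hF
    rw [Expr.eval, hF.reg 0 rfl, hn]
  · simp
  · rintro k t s' hk ⟨h1, h2⟩ h6 hF
    have r7 := (hF.reg 7 rfl).trans h7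
    have r8 := (hF.reg 8 rfl).trans h8
    have a8 := hF.arr 8 rfl
    have e1 : s'.arr 8 w = w * n := by rw [a8, hrow w hw]
    have e2 : s'.arr 8 u = u * n := by rw [a8, hrow u hu]
    have h3 := h2 u hu k hk
    rw [if_neg (by tauto)] at h3
    have h4 := mul_add_lt hw hk
    have hle : s'.arr 9 (u * n + k) ≤ W := h3 ▸ (hval k hk).trans hW1
    refine .write (by simp [r8, e1, h6]; omega) (by simpa [r7, e2, h6] using hle) ?_
    simp only [Expr.eval, Expr.eval_at, Expr.cost, Expr.cost_at, State.setArr_reg,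
      State.setReg_arr, State.setArr_arr, r7, r8, h6, e1, e2, h3]
    refine ⟨trivial, by omega, fun v hv x hx => ?_⟩
    rw [h2 v hv x hx]
    simp only [true_and, mul_add_inj hx hk]
    by_cases hvw : v = w
    · subst hvw
      by_cases hxk : x = k
      · simp [hxk]
      · have : x < k + 1 ↔ x < k := by omega
        simp [hxk, this]
    · simp [hvw]
  · rintro t s' ⟨h1, h2⟩ hF
    refine ⟨by simp; omega, fun v hv x hx => ?_⟩
    rw [h2 v hv x hx]
    simp [hx]
  · rintro t s₁ ⟨⟨h1, h2⟩, hF⟩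
    have r8 := (hF.reg 8 rfl).trans h8
    have r5 := (hF.reg 5 rfl).trans h5
    have e1 : s₁.arr 8 w = w * n := by rw [hF.arr 8 rfl, hrow w hw]
    have h4 := mul_add_lt hw hw
    refine .seq (.write (by simp [r8, e1]; omega) (by simpa using hW1) (.seq
      (.write (by simp [r8]; omega) (by simpa using hW1)
      (.write (by simp [r8]; omega) (by simpa [r5] using he) ?_))))
    refine ⟨by simp; omega, fun v hv x hx => ?_, ?_, ?_⟩
    · simp only [State.setArr_arr, r8, e1, Expr.eval, Expr.eval_at, State.setArr_reg]
      rw [h2 v hv x hx]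
      simp only [true_and, mul_add_inj hx hw]
      by_cases hvw : v = w <;> by_cases hxw : x = w <;> simp [hvw, hxw]
    · funext i
      simp [r8, Function.update_apply, hF.arr 10 rfl]
    · funext i
      simp [r8, r5, Function.update_apply, hF.arr 12 rfl]

variable [NeZero n]

/-- The vertices in `V` form a rooted tree, in which `par` is the parent function, and the arrays
describe it. -/
structure Grown (src tgt : Fin m → Fin n) (tree : Fin m → Prop) (V : Finset (Fin n))
    (par : Fin n → Fin n) (s : State) : Prop where
  root_mem : 0 ∈ V
  vis : ∀ v : Fin n, s.arr 10 v = if v ∈ V then 1 else 0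
  root_row : ∀ w : Fin n, s.arr 9 ((0 : Fin n) * n + w) = 0
  par_mem : ∀ v ∈ V, v ≠ 0 → par v ∈ V
  edge : ∀ v ∈ V, v ≠ 0 → ∃ e : Fin m, s.arr 12 v = e ∧ tree e ∧
    (src e = v ∧ tgt e = par v ∨ src e = par v ∧ tgt e = v)
  row : ∀ v ∈ V, v ≠ 0 → ∀ w : Fin n,
    s.arr 9 (v * n + w) = if w = v then 1 else s.arr 9 (par v * n + w)
  row_par : ∀ v ∈ V, v ≠ 0 → s.arr 9 (par v * n + v) = 0
  closed : ∀ u ∈ V, ∀ w : Fin n, s.arr 9 (u * n + w) ≠ 0 → w ∈ V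
  le_one : ∀ u ∈ V, ∀ w : Fin n, s.arr 9 (u * n + w) ≤ 1

variable {src tgt : Fin m → Fin n} {tree : Fin m → Prop}

theorem Grown.congr {V : Finset (Fin n)} {par : Fin n → Fin n} {s' : State}
    (h : Grown src tgt tree V par s) (e9 : s'.arr 9 = s.arr 9) (e10 : s'.arr 10 = s.arr 10)
    (e12 : s'.arr 12 = s.arr 12) : Grown src tgt tree V par s' := by
  obtain ⟨h1, h2, h3, h4, h5, h6, h7, h8, h9⟩ := h
  constructor <;> first | assumption | (simp only [e9, e10, e12]; assumption)

theorem Grown.visit {V : Finset (Fin n)} {par : Fin n → Fin n} {s' : State}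
    (h : Grown src tgt tree V par s) {u w : Fin n} {e : Fin m} (hu : u ∈ V) (hw : w ∉ V)
    (he : tree e) (hl : src e = w ∧ tgt e = u ∨ src e = u ∧ tgt e = w)
    (h9 : ∀ v < n, ∀ x < n, s'.arr 9 (v * n + x) =
        if v = w then (if x = w then 1 else s.arr 9 (u * n + x)) else s.arr 9 (v * n + x))
    (h10 : s'.arr 10 = Function.update (s.arr 10) w 1)
    (h12 : s'.arr 12 = Function.update (s.arr 12) w e) :
    Grown src tgt tree (insert w V) (Function.update par w u) s' := by
  have hA : ∀ v x : Fin n, s'.arr 9 (v * n + x) =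
      if v = w then (if x = w then 1 else s.arr 9 (u * n + x)) else s.arr 9 (v * n + x) := by
    intro v x
    rw [h9 v v.isLt x x.isLt]
    simp only [Fin.val_inj]
  have hne : ∀ v ∈ V, v ≠ w := fun v hv hh => hw (hh ▸ hv)
  have hold : ∀ v ∈ V, ∀ x : Fin n, s'.arr 9 (v * n + x) = s.arr 9 (v * n + x) := fun v hv x => by
    rw [hA, if_neg (hne v hv)]
  -- The rows of visited vertices contain visited vertices only, so the unvisited `w` is not an
  -- ancestor of `u`.
  have h0 : s.arr 9 (u * n + w) = 0 := by
    by_contra hh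
    exact hw (h.closed u hu w hh)
  have hcases : ∀ {C : Fin n → Prop}, (∀ v ∈ V, v ≠ w → C v) → C w → ∀ v ∈ insert w V, C v := by
    intro C h1 h2 v hv
    rcases Finset.mem_insert.1 hv with rfl | hv
    · exact h2
    · exact h1 v hv (hne v hv)
  refine ⟨Finset.mem_insert_of_mem h.root_mem, fun v => ?_, fun x => ?_, ?_, ?_, ?_, ?_, ?_, ?_⟩
  · rw [h10, Function.update_apply, h.vis]
    by_cases hvw : v = w
    · simp [hvw]
    · simp [hvw, Fin.val_inj]
  · rw [hold _ h.root_mem, h.root_row]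
  · refine hcases (fun v hv hvw hv0 => ?_) fun _ => ?_
    · rw [Function.update_of_ne hvw]
      exact Finset.mem_insert_of_mem (h.par_mem v hv hv0)
    · simpa using .inr hu
  · refine hcases (fun v hv hvw hv0 => ?_) fun _ => ?_
    · rw [Function.update_of_ne hvw, h12, Function.update_of_ne (by simpa [Fin.val_inj] using hvw)]
      exact h.edge v hv hv0
    · exact ⟨e, by simp [h12], he, by simpa using hl⟩
  · refine hcases (fun v hv hvw hv0 x => ?_) fun _ x => ?_
    · rw [Function.update_of_ne hvw, hold v hv, hold _ (h.par_mem v hv hv0), h.row v hv hv0]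
    · rw [Function.update_self, hold u hu, hA, if_pos rfl]
  · refine hcases (fun v hv hvw hv0 => ?_) fun _ => ?_
    · rw [Function.update_of_ne hvw, hold _ (h.par_mem v hv hv0), h.row_par v hv hv0]
    · rw [Function.update_self, hold u hu, h0]
  · refine hcases (fun v hv hvw x hx => ?_) fun x hx => ?_
    · rw [hold v hv] at hx
      exact Finset.mem_insert_of_mem (h.closed v hv x hx)
    · rw [hA, if_pos rfl] at hx
      by_cases hxw : x = w
      · simp [hxw]
      · rw [if_neg hxw] at hx
        exact Finset.mem_insert_of_mem (h.closed u hu x hx)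
  · refine hcases (fun v hv hvw x => ?_) fun x => ?_
    · rw [hold v hv]
      exact h.le_one v hv x
    · rw [hA, if_pos rfl]
      split_ifs
      · rfl
      · exact h.le_one u hu x

/-- The arrays `3`, `6`, `7` and `8` hold the tree, the ends of the edges and the multiples of `n`. -/
structure HoldsGraph (src tgt : Fin m → Fin n) (tree : Fin m → Prop) (s : State) : Prop where
  r0 : s.reg 0 = n
  r1 : s.reg 1 = m
  a3 : ∀ e : Fin m, s.arr 3 e ≤ 1 ∧ (s.arr 3 e = 1 ↔ tree e)
  a6 : ∀ e : Fin m, s.arr 6 e = src e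
  a7 : ∀ e : Fin m, s.arr 7 e = tgt e
  a8 : ∀ v < n, s.arr 8 v = v * n

omit [NeZero n] in
theorem HoldsGraph.congr {s' : State} (h : HoldsGraph src tgt tree s) (h0 : s'.reg 0 = s.reg 0)
    (h1 : s'.reg 1 = s.reg 1) (h3 : s'.arr 3 = s.arr 3) (h6 : s'.arr 6 = s.arr 6)
    (h7 : s'.arr 7 = s.arr 7) (h8 : s'.arr 8 = s.arr 8) : HoldsGraph src tgt tree s' := by
  obtain ⟨g1, g2, g3, g4, g5, g6⟩ := h
  constructor <;> first | assumption | (simp only [h0, h1, h3, h6, h7, h8]; assumption)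

/-- The term `60 * n * V.card` is a potential that pays for copying a row when a vertex is visited.
Without a visit the step takes constant time and shows that a tree edge does not leave `V`. -/
theorem runs_growStep {V : Finset (Fin n)} {par : Fin n → Fin n} {e : Fin m}
    (h : Grown src tgt tree V par s) (hs : HoldsGraph src tgt tree s) (h5 : s.reg 5 = e)
    (hW : n * n ≤ W) (hWm : m ≤ W) :
    Runs W growStep s fun t s' => ∃ V' par', Grown src tgt tree V' par' s' ∧
      t + 60 * n * V.card ≤ 60 + 60 * n * V'.card ∧
      (V.card < V'.card ∨ V' = V ∧ (tree e → (src e ∈ V ↔ tgt e ∈ V))) := by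
  have hn : 0 < n := Nat.pos_of_neZero n
  have hWn : n ≤ W := by nlinarith
  have hWsrc : (src e).val ≤ W := (src e).isLt.le.trans hWn
  have hWtgt : (tgt e).val ≤ W := (tgt e).isLt.le.trans hWn
  have key : ∀ (u w : Fin n) (t₀ : ℕ), t₀ ≤ 20 →
      (u = src e ∧ w = tgt e ∧ tgt e ∉ V ∨ u = tgt e ∧ w = src e ∧ tgt e ∈ V) →
      ∀ s₁ : State, s₁.reg 0 = n → s₁.reg 5 = e → s₁.reg 7 = u → s₁.reg 8 = w → s₁.arr = s.arr →
      Runs W (.cond (.sub (.add (.at 3 5) (.at 10 7)) (.add (.const 1) (.at 10 8))) visitProg .skip)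
        s₁ fun t s' => ∃ V' par', Grown src tgt tree V' par' s' ∧
      t₀ + t + 60 * n * V.card ≤ 60 + 60 * n * V'.card ∧
      (V.card < V'.card ∨ V' = V ∧ (tree e → (src e ∈ V ↔ tgt e ∈ V))) := by
    intro u w t₀ ht₀ huw s₁ r0 r5 r7 r8 harr
    -- All three entries are `0` or `1`; the truncated difference is nonzero only for a tree edge
    -- from a visited `u` to an unvisited `w`.
    have hev : (Expr.sub (.add (.at 3 5) (.at 10 7)) (.add (.const 1) (.at 10 8))).eval s₁ ≠ 0 ↔
        tree e ∧ u ∈ V ∧ w ∉ V := by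
      simp only [Expr.eval, Expr.eval_at, r5, r7, r8, harr, h.vis]
      rw [← (hs.a3 e).2]
      have := (hs.a3 e).1
      by_cases hu : u ∈ V <;> by_cases hw : w ∈ V <;> simp [hu, hw] <;> omega
    refine .cond (fun hc => ?_) fun hc => ?_
    · rw [hev] at hc
      obtain ⟨h1, h2, h3⟩ := hc
      refine (runs_visit r0 r5 r7 r8 (by simpa [harr] using hs.a8) u.isLt w.isLt
        (fun hh => h3 (Fin.ext hh ▸ h2))
        (fun x hx => by rw [harr]; exact h.le_one u h2 ⟨x, hx⟩) (e.isLt.le.trans hWm) hW (by omega)).mono ?_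
      rintro t s' ⟨h4, h9, h10, h12⟩
      rw [harr] at h9 h10 h12
      refine ⟨_, _, h.visit h2 h3 h1 (by tauto) h9 h10 h12, ?_, .inl ?_⟩
      · rw [Finset.card_insert_of_notMem h3]
        simp
        nlinarith
      · rw [Finset.card_insert_of_notMem h3]
        omega
    · have hc' : ¬ (tree e ∧ u ∈ V ∧ w ∉ V) := fun hh => (hev.2 hh) hc
      refine .skip ⟨V, par, h.congr (by rw [harr]) (by rw [harr]) (by rw [harr]), ?_,
        .inr ⟨rfl, fun ht => ?_⟩⟩
      · simp; omega
      · rcases huw with ⟨rfl, rfl, h3⟩ | ⟨rfl, rfl, h3⟩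
        · simp only [h3, not_false_eq_true, and_true, ht, true_and] at hc'
          simp [hc', h3]
        · simp only [h3, ht, true_and, not_not] at hc'
          simp [hc', h3]
  refine .seq (.cond (fun hc => ?_) fun hc => ?_)
  · simp only [Expr.eval, Expr.eval_at, h5, hs.a7, h.vis] at hc
    have hc' : tgt e ∈ V := by by_contra hh; simp [hh] at hc
    refine .seq (.assign (by simpa [h5, hs.a7] using hWtgt)
      (.assign (by simpa [h5, hs.a6] using hWsrc) ?_))
    refine (key (tgt e) (src e) _ ?_ (.inr ⟨rfl, rfl, hc'⟩) _ ?_ ?_ ?_ ?_ ?_).mono fun _ _ h => h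
    all_goals simp [h5, hs.a6, hs.a7, hs.r0]
  · simp only [Expr.eval, Expr.eval_at, h5, hs.a7, h.vis] at hc
    have hc' : tgt e ∉ V := by intro hh; simp [hh] at hc
    refine .seq (.assign (by simpa [h5, hs.a6] using hWsrc)
      (.assign (by simpa [h5, hs.a7] using hWtgt) ?_))
    refine (key (src e) (tgt e) _ ?_ (.inl ⟨rfl, rfl, hc'⟩) _ ?_ ?_ ?_ ?_ ?_).mono fun _ _ h => h
    all_goals simp [h5, hs.a6, hs.a7, hs.r0]

/-- A round over all edges without a visit shows that `V` is closed under tree edges and hence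
contains every vertex. So `n` rounds suffice, whatever the order of the edges. -/
theorem runs_grow (hs : HoldsGraph src tgt tree s) (h9 : s.arr 9 = fun _ => 0)
    (h10 : s.arr 10 = fun _ => 0) (hW : n * n ≤ W) (hWm : m ≤ W)
    (hconn : ∀ S : Fin n → Prop, S 0 → (∀ e, tree e → (S (src e) ↔ S (tgt e))) → ∀ v, S v) :
    Runs W growProg s fun t s' => t ≤ 100 * (n * m) + 60 * (n * n) + 100 * n + 100 ∧
      ∃ par, Grown src tgt tree Finset.univ par s' := by
  have hn : 0 < n := Nat.pos_of_neZero n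
  have hWn : n ≤ W := by nlinarith
  refine .seq (.write (by simp) (by simp; omega) ?_)
  -- The summand `60 * n` on the left offsets the potential of the root, which is visited at the
  -- start.
  refine Runs.for (N := n) (fun k t s' => ∃ V par, Grown src tgt tree V par s' ∧
    t + 60 * n ≤ k * (80 * m + 30) + 60 * n * V.card ∧ (V = Finset.univ ∨ k + 1 ≤ V.card)) hWn
    ?_ ?_ ?_ ?_
  · intro s' hF
    rw [Expr.eval, hF.reg 0 rfl]
    exact hs.r0
  · refine ⟨{0}, fun _ => 0, ⟨by simp, fun v => ?_, ?_, ?_, ?_, ?_, ?_, ?_, ?_⟩, ?_, .inr ?_⟩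
    · by_cases hv : v = 0
      · simp [hv]
      · have : v.val ≠ 0 := fun hh => hv (Fin.ext hh)
        simp [hv, h10, this]
    all_goals simp [h9]
  · rintro k t s₁ hk ⟨V, par, hV, ht, hcard⟩ h4 hF
    have hs₁ : HoldsGraph src tgt tree s₁ := hs.congr (hF.reg 0 rfl) (hF.reg 1 rfl) (hF.arr 3 rfl)
      (hF.arr 6 rfl) (hF.arr 7 rfl) (hF.arr 8 rfl)
    refine Runs.for (N := m) (fun i t s' => ∃ V' par', Grown src tgt tree V' par' s' ∧
      t + 60 * n * V.card ≤ i * 80 + 60 * n * V'.card ∧ (V' = Finset.univ ∨ k + 2 ≤ V'.card ∨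
        k + 1 ≤ V'.card ∧ ∀ e : Fin m, e.val < i → tree e → (src e ∈ V' ↔ tgt e ∈ V'))) hWm
      ?_ ?_ ?_ ?_
    · intro s' hF'
      rw [Expr.eval, hF'.reg 1 rfl]
      exact hs₁.r1
    · refine ⟨V, par, hV.congr rfl rfl rfl, by simp, ?_⟩
      rcases hcard with h1 | h1
      · exact .inl h1
      · exact .inr (.inr ⟨h1, by simp⟩)
    · rintro i t₂ s₂ hi ⟨V₂, par₂, hV₂, ht₂, hcard₂⟩ h5 hF₂
      have hs₂ : HoldsGraph src tgt tree s₂ := hs₁.congr (hF₂.reg 0 rfl) (hF₂.reg 1 rfl)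
        (hF₂.arr 3 rfl) (hF₂.arr 6 rfl) (hF₂.arr 7 rfl) (hF₂.arr 8 rfl)
      refine (runs_growStep (e := ⟨i, hi⟩) hV₂ hs₂ h5 hW hWm).frame.mono ?_
      rintro t₃ s₃ ⟨⟨V₃, par₃, hV₃, ht₃, hcard₃⟩, hF₃⟩
      refine ⟨(hF₃.reg 5 rfl).trans h5, V₃, par₃, hV₃.congr rfl rfl rfl, by simp; omega, ?_⟩
      have hVn : V₃.card ≤ n := by simpa using Finset.card_le_univ V₃
      rcases hcard₃ with h1 | ⟨rfl, h1⟩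
      · rcases hcard₂ with rfl | h2 | ⟨h2, -⟩
        · simp at h1; omega
        · exact .inr (.inl (by omega))
        · exact .inr (.inl (by omega))
      · rcases hcard₂ with rfl | h2 | ⟨h2, h3⟩
        · exact .inl rfl
        · exact .inr (.inl h2)
        · refine .inr (.inr ⟨h2, fun e he hte => ?_⟩)
          by_cases hei : e.val = i
          · obtain rfl : e = ⟨i, hi⟩ := Fin.ext hei
            exact h1 hte
          · exact h3 e (by omega) hte
    · rintro t₂ s₂ ⟨V₂, par₂, hV₂, ht₂, hcard₂⟩ hF₂
      refine ⟨(hF₂.reg 4 rfl).trans h4, V₂, par₂, hV₂.congr rfl rfl rfl, ?_, ?_⟩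
      · simp
        nlinarith
      · rcases hcard₂ with h1 | h1 | ⟨h1, h2⟩
        · exact .inl h1
        · exact .inr h1
        · left
          rw [Finset.eq_univ_iff_forall]
          exact hconn (· ∈ V₂) hV₂.root_mem fun e he => h2 e e.isLt he
  · rintro t s' ⟨V, par, hV, ht, hcard⟩ hF
    have hVn : V.card ≤ n := by simpa using Finset.card_le_univ V
    obtain rfl : V = Finset.univ := by
      rcases hcard with h1 | h1
      · exact h1
      · omega
    refine ⟨?_, par, hV⟩
    simp at ht ⊢
    nlinarith

end Grow

end CycleLattice

namespace CycleLattice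

/-! ### Writing cycles -/

/-- Appends a number to the output array. -/
def pushProg (e : Expr) : Prog := .write 5 (.reg 3) e ;; .assign 3 (.add (.reg 3) (.const 1))

/-- Ends the current member of the output list. -/
def closeProg : Prog := .assign 2 (.add (.reg 2) (.const 1)) ;; .write 4 (.reg 2) (.reg 3)

/-- Appends the tree edges that satisfy a test to the output array. -/
def emitProg (test : Expr) : Prog :=
  .for 15 (.reg 0) (.cond test (pushProg (.at 12 15)) .skip)

/-- The output consists of the lists in `L`, followed by the unfinished list `l`. -/
structure Writes (s : State) (L : List (List ℕ)) (l : List ℕ) : Prop where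
  r2 : s.reg 2 = L.length
  r3 : s.reg 3 = (L.flatten ++ l).length
  a4 : ∀ i ≤ L.length, s.arr 4 i = (L.take i).flatten.length
  a5 : ∀ i < (L.flatten ++ l).length, (L.flatten ++ l)[i]? = some (s.arr 5 i)

variable {W n m : ℕ} {s : State} {L : List (List ℕ)} {l : List ℕ}

theorem Writes.congr {s' : State} (h : Writes s L l) (h2 : s'.reg 2 = s.reg 2)
    (h3 : s'.reg 3 = s.reg 3) (h4 : s'.arr 4 = s.arr 4) (h5 : s'.arr 5 = s.arr 5) :
    Writes s' L l := by
  obtain ⟨g1, g2, g3, g4⟩ := h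
  constructor <;> simpa only [h2, h3, h4, h5]

theorem runs_push (h : Writes s L l) {e : Expr} (he : e.eval s ≤ W)
    (hl : (L.flatten ++ l).length + 1 ≤ W) :
    Runs W (pushProg e) s fun t s' => t = e.cost + 6 ∧ Writes s' L (l ++ [e.eval s]) := by
  refine .seq (.write (by simp [h.r3] at hl ⊢; omega) he (.assign (by simp [h.r3] at hl ⊢; omega) ?_))
  refine ⟨by simp; omega, by simpa using h.r2, ?_, by simpa using h.a4, fun i hi => ?_⟩
  · simp only [State.setReg_reg, if_true, Expr.eval, State.setArr_reg, h.r3]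
    simp [add_assoc]
  · rw [← List.append_assoc] at hi ⊢
    rw [List.length_append, List.length_singleton] at hi
    simp only [State.setReg_arr, State.setArr_arr, Expr.eval, h.r3, true_and]
    by_cases hil : i = (L.flatten ++ l).length
    · subst hil
      simp only [List.getElem?_append_right le_rfl]
      simp
    · rw [List.getElem?_append_left (by omega), if_neg hil]
      exact h.a5 i (by omega)

theorem runs_close (h : Writes s L l) (hl : (L.flatten ++ l).length ≤ W) (hL : L.length + 1 ≤ W) :
    Runs W closeProg s fun t s' => t = 7 ∧ Writes s' (L ++ [l]) [] := by
  refine .seq (.assign (by simpa [h.r2] using hL) (.write (by simpa [h.r2] using hL)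
    (by simpa [h.r3] using hl) ?_))
  refine ⟨by simp, by simp [h.r2], by simp [h.r3], fun i hi => ?_, fun i hi => ?_⟩
  · simp only [State.setArr_arr, State.setReg_arr, Expr.eval, State.setReg_reg, if_true, h.r2, h.r3,
      true_and]
    rw [List.length_append, List.length_singleton] at hi
    by_cases hil : i = L.length + 1
    · subst hil
      simp [List.take_of_length_le]
    · rw [if_neg hil, List.take_append_of_le_length (by omega)]
      exact h.a4 i (by omega)
  · have := h.a5 i (by simpa using hi)
    simpa using this

theorem runs_emit (h : Writes s L []) (hn : s.reg 0 = n) {test : Expr} (p : ℕ → Prop)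
    [DecidablePred p] (hp : ∀ s', Frame (emitProg test) s s' → s'.reg 15 < n →
      (test.eval s' ≠ 0 ↔ p (s'.reg 15))) (hval : ∀ v < n, p v → s.arr 12 v ≤ W)
    (hW : L.flatten.length + n + 1 ≤ W) :
    Runs W (emitProg test) s fun t s' => t ≤ n * (test.cost + 20) + 6 ∧
      Writes s' L (((List.range n).filter p).map (s.arr 12)) := by
  refine Runs.for (N := n) (fun k t s' => t ≤ k * (test.cost + 20) ∧
    Writes s' L (((List.range k).filter p).map (s.arr 12))) (by omega) ?_ ?_ ?_ ?_
  · intro s' hF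
    rw [Expr.eval, hF.reg 0 rfl, hn]
  · exact ⟨by simp, h.congr rfl rfl rfl rfl⟩
  · rintro k t s' hk ⟨h1, h2⟩ h3 hF
    have hpk := hp s' hF (by omega)
    rw [h3] at hpk
    have hlen : (((List.range k).filter p).map (s.arr 12)).length ≤ k := by
      rw [List.length_map]
      exact (List.length_filter_le _ _).trans (by simp)
    rw [List.range_succ, List.filter_append, List.map_append]
    refine .cond (fun hc => ?_) fun hc => ?_
    · have hpk' := hpk.1 hc
      refine (runs_push h2 (e := .at 12 15) (by
        simp only [Expr.eval_at, h3, hF.arr 12 rfl]; exact hval k hk hpk') (by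
        rw [List.length_append]; omega)).frame.mono ?_
      rintro t' s₁ ⟨⟨ht, h4⟩, hF'⟩
      refine ⟨(hF'.reg 15 rfl).trans h3, by simp [ht]; nlinarith, ?_⟩
      have h5 : Writes (s₁.setReg 15 (k + 1)) L _ := h4.congr rfl rfl rfl rfl
      simpa [h3, hF.arr 12 rfl, hpk'] using h5
    · have hpk' : ¬ p k := fun hh => hpk.2 hh hc
      refine .skip ⟨h3, by simp; nlinarith, ?_⟩
      have h5 : Writes (s'.setReg 15 (k + 1)) L _ := h2.congr rfl rfl rfl rfl
      simpa [hpk'] using h5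
  · rintro t s' ⟨h1, h2⟩ hF
    exact ⟨by simpa using h1, h2⟩

/-! ### The main loop -/

open CycleLattice.RootedTree CycleLattice.RootedTree.Realizes

/-- Nonzero if and only if the tree edge in register `x` is on the path between the vertices whose rows
of the ancestor matrix start at the positions in registers `y` and `z`. -/
def pathTest (y z x : ℕ) : Expr :=
  .neq (.read 9 (.add (.reg y) (.reg x))) (.read 9 (.add (.reg z) (.reg x)))

def emitFund : Prog := emitProg (pathTest 7 8 15) ;; pushProg (.reg 4) ;; closeProg

def emitPair : Prog :=
  emitProg (.neq (pathTest 7 8 15) (pathTest 9 10 15)) ;; pushProg (.reg 4) ;; pushProg (.reg 5) ;;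
    closeProg

variable {D : RootedTree n m} {pe : Fin n → Fin m} {f j : Fin m}

/-- The arrays describe the graph and the rooted tree. -/
structure Stored (D : RootedTree n m) (pe : Fin n → Fin m) (s : State) : Prop where
  graph : HoldsGraph D.src D.tgt D.tree s
  a9 : ∀ u v : Fin n, s.arr 9 (u * n + v) ≤ 1 ∧ (s.arr 9 (u * n + v) = 1 ↔ D.anc u v)
  a12 : ∀ v, v ≠ D.root → s.arr 12 v = pe v

theorem Stored.of_frame {P : Prog} {s' : State} (h : Stored D pe s) (hF : Frame P s s')
    (hP : ([0, 1].all fun x => !P.writesReg x) = true)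
    (hP' : ([3, 6, 7, 8, 9, 12].all fun x => !P.writesArr x) = true) : Stored D pe s' := by
  simp only [List.all_cons, List.all_nil, Bool.and_true, Bool.and_eq_true, Bool.not_eq_true'] at hP hP'
  obtain ⟨h3, h6, h7, h8, h9, h12⟩ := hP'
  refine ⟨h.graph.congr (hF.reg 0 hP.1) (hF.reg 1 hP.2) (hF.arr 3 h3) (hF.arr 6 h6) (hF.arr 7 h7)
    (hF.arr 8 h8), ?_, ?_⟩
  · rw [hF.arr 9 h9]; exact h.a9
  · rw [hF.arr 12 h12]; exact h.a12

open Classical in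
-- Matrix entries are at most one, so the value is exactly `0` or `1`. Two such tests can therefore
-- be compared by `Expr.neq`, as `emitPair` does.
theorem Stored.eval_pathTest (h : Stored D pe s) {y z x : ℕ} (hf : ¬ D.tree f)
    (hy : s.reg y = D.src f * n) (hz : s.reg z = D.tgt f * n) {v : Fin n} (hx : s.reg x = v) :
    (pathTest y z x).eval s = if D.cov f v then 1 else 0 := by
  have h1 := h.a9 (D.src f) v
  have h2 := h.a9 (D.tgt f) v
  have h3 : D.cov f v ↔ ¬ (s.arr 9 (D.src f * n + v) = 1 ↔ s.arr 9 (D.tgt f * n + v) = 1) := by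
    rw [h1.2, h2.2]
    simp [cov, hf]
  simp only [pathTest, Expr.neq, Expr.eval, hy, hz, hx, h3]
  split_ifs <;> omega

open Classical in
/-- The list of the edges of a cycle. -/
noncomputable def cycleList (D : RootedTree n m) (pe : Fin n → Fin m) :
    Fin m ⊕ Fin m × Fin m → List (Fin m)
  | .inl f => ((List.finRange n).filter fun v => D.cov f v).map pe ++ [f]
  | .inr p => ((List.finRange n).filter fun v => ¬ (D.cov p.1 v ↔ D.cov p.2 v)).map pe ++ [p.1, p.2]

theorem mem_cycleList (g : Fin m ⊕ Fin m × Fin m) (e : Fin m) :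
    e ∈ cycleList D pe g ↔ e ∈ genCycle D pe g := by
  rcases g with f | p
  · simp only [cycleList, List.mem_append, List.mem_map, List.mem_filter, List.mem_finRange, true_and,
      decide_eq_true_eq, List.mem_singleton, genCycle, Sum.elim_inl, fund, Set.mem_ofPred_eq]
    rw [or_comm]
    simp only [and_comm]
  · simp only [cycleList, List.mem_append, List.mem_map, List.mem_filter, List.mem_finRange, true_and,
      decide_eq_true_eq, List.mem_cons, List.not_mem_nil, or_false, genCycle, Sum.elim_inr, pairSet,
      Set.mem_ofPred_eq]
    rw [or_comm, or_assoc]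
    simp only [and_comm]

theorem length_cycleList_le (g : Fin m ⊕ Fin m × Fin m) : (cycleList D pe g).length ≤ n + 2 := by
  classical
  rcases g with f | p
  · have := List.length_filter_le (fun v => decide (D.cov f v)) (List.finRange n)
    simp only [cycleList, List.length_append, List.length_map, List.length_singleton]
    rw [List.length_finRange] at this
    omega
  · have := List.length_filter_le (fun v => decide (¬ (D.cov p.1 v ↔ D.cov p.2 v))) (List.finRange n)
    simp only [cycleList, List.length_append, List.length_map, List.length_cons, List.length_nil]
    rw [List.length_finRange] at this
    omega

/-- The output that consists of the cycles in `gl`. -/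
noncomputable def outList (D : RootedTree n m) (pe : Fin n → Fin m)
    (gl : List (Fin m ⊕ Fin m × Fin m)) : List (List ℕ) :=
  gl.map fun g => (cycleList D pe g).map Fin.val

theorem length_flatten_outList_le (gl : List (Fin m ⊕ Fin m × Fin m)) :
    (outList D pe gl).flatten.length ≤ gl.length * (n + 2) := by
  induction gl with
  | nil => simp [outList]
  | cons g gl ih =>
    have := length_cycleList_le (D := D) (pe := pe) g
    simp only [outList, List.map_cons, List.flatten_cons, List.length_append, List.length_map,
      List.length_cons] at ih ⊢
    nlinarith

open Classical in
theorem map_filter_range {p : Fin n → Prop} (h : Stored D pe s) (hp : ∀ v, p v → v ≠ D.root) :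
    ((List.range n).filter fun v => ∃ hv : v < n, p ⟨v, hv⟩).map (s.arr 12) =
      (((List.finRange n).filter fun v => p v).map pe).map Fin.val := by
  rw [← List.map_coe_finRange_eq_range, List.filter_map, List.map_map, List.map_map]
  have : ((fun v => decide (∃ hv : v < n, p ⟨v, hv⟩)) ∘ Fin.val) = fun v : Fin n => decide (p v) := by
    funext v
    simp
  rw [this]
  refine List.map_congr_left fun v hv => ?_
  rw [List.mem_filter] at hv
  exact h.a12 v (hp v (by simpa using hv.2))

theorem runs_emitFund {gl : List (Fin m ⊕ Fin m × Fin m)} (h : Stored D pe s)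
    (hw : Writes s (outList D pe gl) []) (hf : ¬ D.tree f) (h4 : s.reg 4 = f)
    (h7 : s.reg 7 = D.src f * n) (h8 : s.reg 8 = D.tgt f * n) (hWm : m ≤ W)
    (hW : (gl.length + 1) * (n + 2) ≤ W) :
    Runs W emitFund s fun t s' => t ≤ 40 * n + 40 ∧ Writes s' (outList D pe (gl ++ [.inl f])) [] := by
  classical
  have hlen := length_flatten_outList_le (D := D) (pe := pe) gl
  have hlen' : (outList D pe gl).flatten.length + (n + 2) ≤ W := by nlinarith
  refine .seq ((runs_emit hw h.graph.r0 (fun v => ∃ hv : v < n, D.cov f ⟨v, hv⟩) ?_ ?_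
    (by omega)).frame.mono ?_)
  · intro s' hF hlt
    rw [(h.of_frame hF rfl rfl).eval_pathTest (v := ⟨s'.reg 15, hlt⟩) hf
      ((hF.reg 7 rfl).trans h7) ((hF.reg 8 rfl).trans h8) rfl]
    simp [hlt]
  · rintro v hv ⟨hv', hcov⟩
    have := h.a12 ⟨v, hv⟩ (ne_root_of_cov hcov)
    rw [show s.arr 12 v = pe ⟨v, hv⟩ from this]
    omega
  · rintro t₁ s₁ ⟨⟨ht₁, hw₁⟩, hF₁⟩
    rw [map_filter_range h fun v hv => ne_root_of_cov hv] at hw₁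
    have hl1 := length_cycleList_le (D := D) (pe := pe) (.inl f)
    simp only [cycleList, List.length_append, List.length_singleton] at hl1
    have r4 : s₁.reg 4 = f := (hF₁.reg 4 rfl).trans h4
    refine .seq ((runs_push hw₁ (e := .reg 4) (by simp [r4]; omega) (by
      simp only [List.length_append, List.length_map] at hl1 ⊢; omega)).mono ?_)
    rintro t₂ s₂ ⟨ht₂, hw₂⟩
    refine (runs_close hw₂ (by
      simp only [List.length_append, List.length_map, List.length_singleton] at hl1 ⊢; omega) (by
      simp only [outList, List.length_map]; nlinarith)).mono ?_
    rintro t₃ s₃ ⟨ht₃, hw₃⟩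
    refine ⟨?_, ?_⟩
    · simp [pathTest] at ht₁ ht₂
      omega
    · convert hw₃ using 1
      simp [outList, cycleList, r4]

theorem runs_emitPair {gl : List (Fin m ⊕ Fin m × Fin m)} (h : Stored D pe s)
    (hw : Writes s (outList D pe gl) []) (hf : ¬ D.tree f) (hj : ¬ D.tree j) (h4 : s.reg 4 = f)
    (h5 : s.reg 5 = j) (h7 : s.reg 7 = D.src f * n) (h8 : s.reg 8 = D.tgt f * n)
    (h9 : s.reg 9 = D.src j * n) (h10 : s.reg 10 = D.tgt j * n) (hWm : m ≤ W)
    (hW : (gl.length + 1) * (n + 2) ≤ W) :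
    Runs W emitPair s fun t s' => t ≤ 110 * n + 40 ∧
      Writes s' (outList D pe (gl ++ [.inr (f, j)])) [] := by
  classical
  have hlen := length_flatten_outList_le (D := D) (pe := pe) gl
  have hlen' : (outList D pe gl).flatten.length + (n + 2) ≤ W := by nlinarith
  refine .seq ((runs_emit hw h.graph.r0
    (fun v => ∃ hv : v < n, ¬ (D.cov f ⟨v, hv⟩ ↔ D.cov j ⟨v, hv⟩)) ?_ ?_
    (by omega)).frame.mono ?_)
  · intro s' hF hlt
    rw [Expr.eval_neq, (h.of_frame hF rfl rfl).eval_pathTest (v := ⟨s'.reg 15, hlt⟩) hf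
      ((hF.reg 7 rfl).trans h7) ((hF.reg 8 rfl).trans h8) rfl,
      (h.of_frame hF rfl rfl).eval_pathTest (v := ⟨s'.reg 15, hlt⟩) hj
      ((hF.reg 9 rfl).trans h9) ((hF.reg 10 rfl).trans h10) rfl]
    by_cases h1 : D.cov f ⟨s'.reg 15, hlt⟩ <;> by_cases h2 : D.cov j ⟨s'.reg 15, hlt⟩ <;>
      simp [hlt, h1, h2]
  · rintro v hv ⟨hv', hcov⟩
    have := h.a12 ⟨v, hv⟩ (ne_root_of_not_iff hcov)
    rw [show s.arr 12 v = pe ⟨v, hv⟩ from this]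
    omega
  · rintro t₁ s₁ ⟨⟨ht₁, hw₁⟩, hF₁⟩
    have hmap := map_filter_range h (p := fun v => ¬ (D.cov f v ↔ D.cov j v))
      fun v hv => ne_root_of_not_iff hv
    replace hw₁ : Writes s₁ (outList D pe gl) ((((List.finRange n).filter fun v =>
        ¬ (D.cov f v ↔ D.cov j v)).map pe).map Fin.val) := by
      convert hw₁ using 1
      convert hmap.symm
    have hl1 := length_cycleList_le (D := D) (pe := pe) (.inr (f, j))
    simp only [cycleList, List.length_append, List.length_cons, List.length_nil] at hl1
    have r4 : s₁.reg 4 = f := (hF₁.reg 4 rfl).trans h4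
    have r5 : s₁.reg 5 = j := (hF₁.reg 5 rfl).trans h5
    refine .seq ((runs_push hw₁ (e := .reg 4) (by simp [r4]; omega) (by
      simp only [List.length_append, List.length_map] at hl1 ⊢; omega)).frame.mono ?_)
    rintro t₂ s₂ ⟨⟨ht₂, hw₂⟩, hF₂⟩
    have r5' : s₂.reg 5 = j := (hF₂.reg 5 rfl).trans r5
    refine .seq ((runs_push hw₂ (e := .reg 5) (by simp [r5']; omega) (by
      simp only [List.length_append, List.length_map, List.length_singleton] at hl1 ⊢
      omega)).mono ?_)
    rintro t₃ s₃ ⟨ht₃, hw₃⟩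
    refine (runs_close hw₃ (by
      simp only [List.length_append, List.length_map, List.length_singleton] at hl1 ⊢; omega) (by
      simp only [outList, List.length_map]; nlinarith)).mono ?_
    rintro t₄ s₄ ⟨ht₄, hw₄⟩
    refine ⟨?_, ?_⟩
    · simp [pathTest] at ht₁ ht₂ ht₃
      omega
    · convert hw₄ using 1
      simp [outList, cycleList, r4, r5']

end CycleLattice

namespace CycleLattice

open CycleLattice.RootedTree CycleLattice.RootedTree.Realizes

/-! ### Classes of tree edges -/

def clearProg : Prog :=
  .for 5 (.add (.reg 0) (.const 1)) (.write 14 (.reg 5) (.const 0) ;; .write 15 (.reg 5) (.const 0))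

/-- Stores a member of each class on the tree path of an edge, and one off this path. -/
def markProg : Prog :=
  .for 5 (.reg 0) (.cond (pathTest 7 8 5) (.write 14 (.at 11 5) (.add (.reg 5) (.const 1)))
    (.write 15 (.at 11 5) (.add (.reg 5) (.const 1))))

/-- Splits the classes along the tree path of an edge. -/
def updateProg : Prog :=
  .for 5 (.reg 0) (.cond (pathTest 7 8 5)
    (.write 11 (.reg 5) (.read 14 (.at 11 5)) ;; .write 13 (.reg 5) (.add (.at 13 5) (.const 1)))
    (.write 11 (.reg 5) (.read 15 (.at 11 5))))

variable {W n m : ℕ} {s : State} {D : RootedTree n m} {pe : Fin n → Fin m} {f j : Fin m}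

theorem runs_clear (hn : s.reg 0 = n) (hW : n + 1 ≤ W) :
    Runs W clearProg s fun t s' => t ≤ 20 * n + 30 ∧ ∀ c ≤ n, s'.arr 14 c = 0 ∧ s'.arr 15 c = 0 := by
  refine Runs.for (N := n + 1) (fun k t s' => t ≤ 20 * k ∧
    ∀ c < k, s'.arr 14 c = 0 ∧ s'.arr 15 c = 0) hW ?_ (by simp) ?_ ?_
  · intro s' hF
    simp [hF.reg 0 rfl, hn]
  · rintro k t s' hk ⟨h1, h2⟩ h3 hF
    refine .seq (.write (by simp; omega) (by simp) (.write (by simp; omega) (by simp) ?_))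
    refine ⟨h3, by simp; omega, fun c hc => ?_⟩
    by_cases hck : c = k
    · simp [hck, h3]
    · simpa [hck, h3] using h2 c (by omega)
  · rintro t s' ⟨h1, h2⟩ hF
    exact ⟨by simp; omega, fun c hc => h2 c (by omega)⟩

/-- For each class, the array `a` stores the successor of a member that satisfies `p`, or zero if there
is none with number less than `k`. -/
def Marks (p : Fin n → Prop) (cls : ℕ → ℕ) (k : ℕ) (a : ℕ → ℕ) : Prop :=
  ∀ c ≤ n, (a c = 0 ∧ ∀ v : Fin n, v < k → p v → cls v ≠ c) ∨
    ∃ e : Fin n, a c = e + 1 ∧ p e ∧ cls e = c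

namespace Marks

variable {p : Fin n → Prop} {cls a a' : ℕ → ℕ} {k : ℕ}

theorem zero (ha : ∀ c ≤ n, a c = 0) : Marks p cls 0 a :=
  fun c hc => .inl ⟨ha c hc, fun _ hv => absurd hv (Nat.not_lt_zero _)⟩

theorem succ (h : Marks p cls k a) (hk : k < n) (hp : p ⟨k, hk⟩)
    (ha : ∀ c, a' c = if c = cls k then k + 1 else a c) : Marks p cls (k + 1) a' := by
  intro c hc
  by_cases hck : c = cls k
  · exact .inr ⟨⟨k, hk⟩, by simp [ha, hck], hp, hck.symm⟩
  · rw [ha, if_neg hck]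
    refine (h c hc).imp_left fun ⟨h1, h2⟩ => ⟨h1, fun v hv hpv => ?_⟩
    rcases Nat.lt_succ_iff_lt_or_eq.1 hv with h3 | h3
    · exact h2 v h3 hpv
    · rw [h3]; exact Ne.symm hck

theorem succ_of_not (h : Marks p cls k a) (hk : k < n) (hp : ¬ p ⟨k, hk⟩) :
    Marks p cls (k + 1) a := by
  intro c hc
  refine (h c hc).imp_left fun ⟨h1, h2⟩ => ⟨h1, fun v hv hpv => ?_⟩
  rcases Nat.lt_succ_iff_lt_or_eq.1 hv with h3 | h3
  · exact h2 v h3 hpv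
  · exact absurd (show p ⟨k, hk⟩ by convert hpv; exact h3.symm) hp

theorem exists_of (h : Marks p cls n a) {v : Fin n} (hv : cls v ≤ n) (hp : p v) :
    ∃ e : Fin n, a (cls v) = e + 1 ∧ p e ∧ cls e = cls v :=
  (h _ hv).resolve_left fun h' => h'.2 v v.isLt hp rfl

theorem ne_zero_iff (h : Marks p cls n a) {c : ℕ} (hc : c ≤ n) :
    a c ≠ 0 ↔ ∃ v, p v ∧ cls v = c := by
  rcases h c hc with ⟨h1, h2⟩ | ⟨e, h1, h2, h3⟩
  · simp only [h1, ne_eq, not_true_eq_false, false_iff, not_exists, not_and]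
    exact fun v hv => h2 v v.isLt hv
  · simp only [h1, ne_eq, Nat.add_eq_zero_iff, one_ne_zero, and_false, not_false_eq_true, true_iff]
    exact ⟨e, h2, h3⟩

theorem le (h : Marks p cls k a) {c : ℕ} (hc : c ≤ n) : a c ≤ n := by
  rcases h c hc with ⟨h1, h2⟩ | ⟨e, h1, h2, h3⟩
  · omega
  · have := e.isLt
    omega

end Marks

theorem Stored.eval_pathTest_ne (h : Stored D pe s) {y z x : ℕ} (hf : ¬ D.tree f)
    (hy : s.reg y = D.src f * n) (hz : s.reg z = D.tgt f * n) {v : Fin n} (hx : s.reg x = v) :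
    (pathTest y z x).eval s ≠ 0 ↔ D.cov f v := by
  rw [h.eval_pathTest hf hy hz hx]
  by_cases hc : D.cov f v <;> simp [hc]

theorem runs_mark (h : Stored D pe s) (hf : ¬ D.tree f) (h7 : s.reg 7 = D.src f * n)
    (h8 : s.reg 8 = D.tgt f * n) (hcls : ∀ v : Fin n, s.arr 11 v ≤ n)
    (h0 : ∀ c ≤ n, s.arr 14 c = 0 ∧ s.arr 15 c = 0) (hW : n + 1 ≤ W) :
    Runs W markProg s fun t s' => t ≤ 50 * n + 10 ∧ Marks (D.cov f) (s.arr 11) n (s'.arr 14) ∧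
      Marks (fun v => ¬ D.cov f v) (s.arr 11) n (s'.arr 15) := by
  refine Runs.for (N := n) (fun k t s' => t ≤ 50 * k ∧ Marks (D.cov f) (s.arr 11) k (s'.arr 14) ∧
      Marks (fun v => ¬ D.cov f v) (s.arr 11) k (s'.arr 15)) (by omega) ?_ ?_ ?_ ?_
  · intro s' hF
    rw [Expr.eval, hF.reg 0 rfl, h.graph.r0]
  · exact ⟨by simp, .zero fun c hc => (h0 c hc).1, .zero fun c hc => (h0 c hc).2⟩
  · rintro k t s' hk ⟨h1, h2, h3⟩ h5 hF
    have hev := (h.of_frame hF rfl rfl).eval_pathTest_ne (x := 5) (v := ⟨k, hk⟩) hf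
      ((hF.reg 7 rfl).trans h7) ((hF.reg 8 rfl).trans h8) h5
    have a11 := hF.arr 11 rfl
    have hck := hcls ⟨k, hk⟩
    simp only at hck
    refine .cond (fun hc => ?_) fun hc => ?_
    · have hcov := hev.1 hc
      refine .write (by simp [a11, h5]; omega) (by simp; omega) ⟨h5, by simp [pathTest]; omega, ?_, ?_⟩
      · exact h2.succ hk hcov fun c => by simp [a11, h5]
      · exact h3.succ_of_not hk (not_not.2 hcov)
    · have hcov : ¬ D.cov f ⟨k, hk⟩ := fun hh => hev.2 hh hc
      refine .write (by simp [a11, h5]; omega) (by simp; omega) ⟨h5, by simp [pathTest]; omega, ?_, ?_⟩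
      · exact h2.succ_of_not hk hcov
      · exact h3.succ hk hcov fun c => by simp [a11, h5]
  · rintro t s' ⟨h1, h2⟩ hF
    exact ⟨by simp; omega, h2⟩

/-- Array `11` stores the partition of the tree edges by the set of covering edges with number less than
`i`, and array `13` the sizes of these sets. -/
structure Classes (D : RootedTree n m) (i : ℕ) (s : State) : Prop where
  le : ∀ v : Fin n, s.arr 11 v ≤ n
  eq_iff : ∀ v w : Fin n, s.arr 11 v = s.arr 11 w ↔ D.sig i v = D.sig i w
  card : ∀ v : Fin n, s.arr 13 v = (D.sig i v).card

theorem Classes.congr {i : ℕ} {s' : State} (h : Classes D i s) (h11 : s'.arr 11 = s.arr 11)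
    (h13 : s'.arr 13 = s.arr 13) : Classes D i s' := by
  obtain ⟨g1, g2, g3⟩ := h
  constructor <;> simpa only [h11, h13]

theorem card_sig_le (i : ℕ) (v : Fin n) : (D.sig i v).card ≤ m :=
  (Finset.card_le_univ _).trans_eq (Fintype.card_fin m)

/-- The new name of a class is the successor of the member marked for it. This member belongs to the
class, so different classes get different names, and names never exceed `n`. -/
theorem runs_update (h : Stored D pe s) (hf : ¬ D.tree f) (h7 : s.reg 7 = D.src f * n)
    (h8 : s.reg 8 = D.tgt f * n) (hc : Classes D f s)
    (h14 : Marks (D.cov f) (s.arr 11) n (s.arr 14))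
    (h15 : Marks (fun v => ¬ D.cov f v) (s.arr 11) n (s.arr 15)) (hW : n ≤ W) (hWm : m + 1 ≤ W) :
    Runs W updateProg s fun t s' => t ≤ 50 * n + 10 ∧ Classes D (f + 1) s' := by
  classical
  refine Runs.for (N := n) (fun k t s' => t ≤ 50 * k ∧ (∀ v : Fin n, s'.arr 11 v =
      if v < k then if D.cov f v then s.arr 14 (s.arr 11 v) else s.arr 15 (s.arr 11 v) else s.arr 11 v) ∧
      ∀ v : Fin n, s'.arr 13 v = if v < k then if D.cov f v then s.arr 13 v + 1 else s.arr 13 v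
        else s.arr 13 v) hW ?_ ?_ ?_ ?_
  · intro s' hF
    rw [Expr.eval, hF.reg 0 rfl, h.graph.r0]
  · simp
  · rintro k t s' hk ⟨h1, h2, h3⟩ h5 hF
    have hev := (h.of_frame hF rfl rfl).eval_pathTest_ne (x := 5) (v := ⟨k, hk⟩) hf
      ((hF.reg 7 rfl).trans h7) ((hF.reg 8 rfl).trans h8) h5
    have a14 := hF.arr 14 rfl
    have a15 := hF.arr 15 rfl
    have e11 : s'.arr 11 k = s.arr 11 k := by simpa using h2 ⟨k, hk⟩
    have e13 : s'.arr 13 k = s.arr 13 k := by simpa using h3 ⟨k, hk⟩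
    have hck := hc.le ⟨k, hk⟩
    have hcard := hc.card ⟨k, hk⟩
    have hcard' := card_sig_le (D := D) f ⟨k, hk⟩
    have hk14 := h14.le hck
    have hk15 := h15.le hck
    simp only at hck hcard hk14 hk15
    have hlt : ∀ v : Fin n, (v : ℕ) ≠ k → (v < k + 1 ↔ v < k) := fun v hv => by omega
    refine .cond (fun hc => ?_) fun hc => ?_
    · have hcov := hev.1 hc
      refine .seq (.write (by simp; omega) (by simp [a14, e11, h5]; omega)
        (.write (by simp; omega) (by simp [h5, e13]; omega) ?_))
      refine ⟨h5, by simp [pathTest]; omega, fun v => ?_, fun v => ?_⟩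
      · by_cases hv : (v : ℕ) = k
        · have : v = ⟨k, hk⟩ := Fin.ext hv
          simp [this, h5, a14, e11, hcov]
        · simp only [hlt v hv]
          simpa [h5, hv] using h2 v
      · by_cases hv : (v : ℕ) = k
        · have : v = ⟨k, hk⟩ := Fin.ext hv
          simp [this, h5, e13, hcov]
        · simp only [hlt v hv]
          simpa [h5, hv] using h3 v
    · have hcov : ¬ D.cov f ⟨k, hk⟩ := fun hh => hev.2 hh hc
      refine .write (by simp; omega) (by simp [a15, e11, h5]; omega) ?_
      refine ⟨h5, by simp [pathTest]; omega, fun v => ?_, fun v => ?_⟩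
      · by_cases hv : (v : ℕ) = k
        · have : v = ⟨k, hk⟩ := Fin.ext hv
          simp [this, h5, a15, e11, hcov]
        · simp only [hlt v hv]
          simpa [h5, hv] using h2 v
      · by_cases hv : (v : ℕ) = k
        · have : v = ⟨k, hk⟩ := Fin.ext hv
          simp [this, h5, e13, hcov]
        · simp only [hlt v hv]
          simpa [h5, hv] using h3 v
  · rintro t s' ⟨h1, h2, h3⟩ hF
    simp only [Fin.is_lt, if_true] at h2 h3
    refine ⟨by simp; omega, fun v => ?_, fun v w => ?_, fun v => ?_⟩
    · rw [h2]
      split_ifs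
      exacts [h14.le (hc.le v), h15.le (hc.le v)]
    · rw [h2, h2, show D.sig (f + 1) v = D.sig (f + 1) w ↔ _ from
        ⟨D.sig_eq_of_succ, fun hh => D.sig_succ_eq hh.1 hh.2⟩, ← hc.eq_iff]
      by_cases hv : D.cov f v <;> by_cases hw : D.cov f w <;>
        simp only [hv, hw, if_true, if_false, iff_true, and_true, and_false, iff_false,
          not_true_eq_false]
      · obtain ⟨e, g1, g2, g3⟩ := h14.exists_of (hc.le v) hv
        obtain ⟨e', g1', g2', g3'⟩ := h14.exists_of (hc.le w) hw
        refine ⟨fun hh => ?_, fun hh => by rw [hh]⟩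
        rw [← g3, ← g3', show e = e' from Fin.ext (by omega)]
      · obtain ⟨e, g1, g2, g3⟩ := h14.exists_of (hc.le v) hv
        obtain ⟨e', g1', g2', g3'⟩ := h15.exists_of (hc.le w) hw
        intro hh
        exact g2' ((show e = e' from Fin.ext (by omega)) ▸ g2)
      · obtain ⟨e, g1, g2, g3⟩ := h15.exists_of (hc.le v) hv
        obtain ⟨e', g1', g2', g3'⟩ := h14.exists_of (hc.le w) hw
        intro hh
        exact g2 ((show e = e' from Fin.ext (by omega)) ▸ g2')
      · obtain ⟨e, g1, g2, g3⟩ := h15.exists_of (hc.le v) hv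
        obtain ⟨e', g1', g2', g3'⟩ := h15.exists_of (hc.le w) hw
        refine ⟨fun hh => ?_, fun hh => by rw [hh]⟩
        rw [← g3, ← g3', show e = e' from Fin.ext (by omega)]
    · rw [h3, hc.card, D.sig_succ]
      split_ifs
      · rw [Finset.card_insert_of_notMem fun hh => (D.mem_sig.1 hh).1.false]
      · rfl

end CycleLattice

namespace CycleLattice

open CycleLattice.RootedTree CycleLattice.RootedTree.Realizes

/-! ### Representatives of the classes that are split -/

def clearLabProg : Prog := .for 5 (.reg 0) (.write 16 (.reg 5) (.const 0))

/-- Increases the labels of the vertices behind the tree edge in register `5`. -/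
def splitProg : Prog :=
  .assign 11 (.const 1) ;; .for 6 (.reg 0)
    (.cond (.neq (.read 9 (.add (.at 8 6) (.reg 5))) (.read 9 (.add (.reg 8) (.reg 5)))) .skip
      (.write 16 (.reg 6) (.add (.at 16 6) (.const 1))))

/-- The innermost test is reached only with a nonzero entry `k` of array `13`, and then `1 - (k -
1)` is nonzero exactly for `k = 1`. A nonzero entry of array `15` signals a member of the class off
the path. -/
def reprStep : Prog :=
  .cond (pathTest 7 8 5)
    (.cond (.neq (.read 14 (.at 11 5)) (.add (.reg 5) (.const 1))) .skip
      (.cond (.at 13 5)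
        (.cond (.add (.sub (.const 1) (.sub (.at 13 5) (.const 1))) (.read 15 (.at 11 5)))
          splitProg .skip) .skip)) .skip

/-- Splits the labels at a representative of each class that has to be split. -/
def reprProg : Prog := .for 5 (.reg 0) reprStep

variable {W n m : ℕ} {s : State} {D : RootedTree n m} {pe : Fin n → Fin m} {f j : Fin m}

theorem runs_clearLab (hn : s.reg 0 = n) (hW : n ≤ W) :
    Runs W clearLabProg s fun t s' => t ≤ 20 * n + 10 ∧ ∀ v < n, s'.arr 16 v = 0 := by
  refine Runs.for (N := n) (fun k t s' => t ≤ 20 * k ∧ ∀ v < k, s'.arr 16 v = 0) hW ?_ (by simp) ?_ ?_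
  · intro s' hF
    simp [hF.reg 0 rfl, hn]
  · rintro k t s' hk ⟨h1, h2⟩ h3 hF
    refine .write (by simp; omega) (by simp) ⟨h3, by simp; omega, fun v hv => ?_⟩
    by_cases hvk : v = k
    · simp [hvk, h3]
    · simpa [hvk, h3] using h2 v (by omega)
  · rintro t s' ⟨h1, h2⟩ hF
    exact ⟨by simp; omega, h2⟩

theorem Stored.val_eq_iff (h : Stored D pe s) {u u' e : Fin n} :
    s.arr 9 (u * n + e) = s.arr 9 (u' * n + e) ↔ (D.anc u e ↔ D.anc u' e) := by
  have h1 := h.a9 u e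
  have h2 := h.a9 u' e
  rw [← h1.2, ← h2.2]
  omega

open Classical in
theorem runs_split (h : Stored D pe s) (h8 : s.reg 8 = D.tgt f * n) {e : Fin n} (h5 : s.reg 5 = e)
    (hlab : ∀ v : Fin n, s.arr 16 v + 1 ≤ W) (hW : n ≤ W) (hW1 : 1 ≤ W) :
    Runs W splitProg s fun t s' => t ≤ 60 * n + 10 ∧ s'.reg 11 = 1 ∧
      ∀ v : Fin n, s'.arr 16 v = s.arr 16 v + if D.far f e v then 1 else 0 := by
  refine .seq (.assign (by simpa using hW1) (Runs.for (N := n) (fun k t s' => t ≤ 60 * k ∧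
    ∀ v : Fin n, s'.arr 16 v = s.arr 16 v + if v < k then (if D.far f e v then 1 else 0) else 0)
    hW ?_ (by simp) ?_ ?_))
  · intro s' hF
    simp [hF.reg 0 rfl, h.graph.r0]
  · rintro k t s' hk ⟨h1, h2⟩ h6 hF
    have r5 : s'.reg 5 = e := (hF.reg 5 rfl).trans h5
    have r8 : s'.reg 8 = D.tgt f * n := (hF.reg 8 rfl).trans h8
    have a8 : s'.arr 8 k = k * n := by rw [hF.arr 8 rfl]; exact h.graph.a8 k hk
    have a9 : s'.arr 9 = s.arr 9 := hF.arr 9 rfl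
    have e16 : s'.arr 16 k = s.arr 16 k := by simpa using h2 ⟨k, hk⟩
    have hl : s.arr 16 k + 1 ≤ W := hlab ⟨k, hk⟩
    have hlt : ∀ v : Fin n, (v : ℕ) ≠ k → (v < k + 1 ↔ v < k) := fun v hv => by omega
    have hev : (Expr.neq (.read 9 (.add (.at 8 6) (.reg 5))) (.read 9 (.add (.reg 8) (.reg 5)))).eval s'
        ≠ 0 ↔ ¬ D.far f e ⟨k, hk⟩ := by
      rw [Expr.eval_neq, far, ← h.val_eq_iff]
      simp [h6, a8, r5, r8, a9]
    refine .cond (fun hc => ?_) fun hc => ?_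
    · have hfar := hev.1 hc
      refine .skip ⟨h6, by simp; omega, fun v => ?_⟩
      by_cases hv : (v : ℕ) = k
      · have : v = ⟨k, hk⟩ := Fin.ext hv
        simp [this, e16, hfar]
      · simp only [hlt v hv]
        exact h2 v
    · have hfar : D.far f e ⟨k, hk⟩ := not_not.1 fun hh => hev.2 hh hc
      refine .write (by simp; omega) (by simp [h6, e16]; omega) ⟨h6, by simp; omega, fun v => ?_⟩
      by_cases hv : (v : ℕ) = k
      · have : v = ⟨k, hk⟩ := Fin.ext hv
        simp [this, e16, hfar, h6]
      · simp only [hlt v hv]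
        simpa [h6, hv] using h2 v
  · rintro t s' ⟨h1, h2⟩ hF
    simp only [Fin.is_lt, if_true] at h2
    refine ⟨by simp; omega, ?_, h2⟩
    rw [hF.reg 11 rfl]
    simp

open Classical in
/-- The representatives chosen by the program. -/
noncomputable def reprs (D : RootedTree n m) (f : Fin m) (s : State) : Finset (Fin n) :=
  {v | D.cov f v ∧ s.arr 14 (s.arr 11 v) = v + 1 ∧ s.arr 13 v ≠ 0 ∧
    (s.arr 13 v = 1 ∨ s.arr 15 (s.arr 11 v) ≠ 0)}

theorem mem_reprs {v : Fin n} : v ∈ reprs D f s ↔ D.cov f v ∧ s.arr 14 (s.arr 11 v) = v + 1 ∧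
    s.arr 13 v ≠ 0 ∧ (s.arr 13 v = 1 ∨ s.arr 15 (s.arr 11 v) ≠ 0) := by
  simp [reprs]

/-- Array `14` singles out one member on the path for each class, which gives both injectivity and
existence. -/
theorem isRepSet_reprs (hc : Classes D f s) (h14 : Marks (D.cov f) (s.arr 11) n (s.arr 14))
    (h15 : Marks (fun v => ¬ D.cov f v) (s.arr 11) n (s.arr 15)) : D.IsRepSet f (reprs D f s) where
  cov e he := (mem_reprs.1 he).1
  nonempty e he := by
    have := (mem_reprs.1 he).2.2.1
    rwa [hc.card, Finset.card_ne_zero] at this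
  inj e he e' he' hee := by
    have h1 := (mem_reprs.1 he).2.1
    have h2 := (mem_reprs.1 he').2.1
    rw [(hc.eq_iff e e').2 hee] at h1
    exact Fin.ext (by omega)
  single_or e he := by
    have := (mem_reprs.1 he).2.2.2
    rw [hc.card, h15.ne_zero_iff (hc.le e)] at this
    refine this.imp_right fun ⟨y, h1, h2⟩ => ⟨y, h1, (hc.eq_iff _ _).1 h2⟩
  exists_rep v hv hor := by
    obtain ⟨e, h1, h2, h3⟩ := h14.exists_of (hc.le v) hv
    have hsig := (hc.eq_iff _ _).1 h3
    refine ⟨e, mem_reprs.2 ⟨h2, by rw [h3, h1], ?_, ?_⟩, hsig⟩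
    · rw [hc.card, hsig]
      omega
    · rw [hc.card, h15.ne_zero_iff (hc.le e), hsig]
      exact hor.imp_right fun ⟨_, y, g1, g2⟩ => ⟨y, g1, (hc.eq_iff _ _).2 (g2.trans hsig.symm)⟩

theorem pos_insert [DecidableEq (Fin n)] {R : Finset (Fin n)} {e : Fin n} (he : e ∉ R) (v : Fin n)
    [Decidable (D.far f e v)] :
    D.pos f (insert e R) v = D.pos f R v + if D.far f e v then 1 else 0 := by
  classical
  rw [pos, pos, Finset.filter_insert]
  split_ifs
  · rw [Finset.card_insert_of_notMem (by simp [he])]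
  · rfl

/-- Each representative adds one to the labels of all vertices behind it, so the labels end up as
positions. Register `11` remembers whether there was any representative. -/
theorem runs_repr (h : Stored D pe s) (hf : ¬ D.tree f) (h7 : s.reg 7 = D.src f * n)
    (h8 : s.reg 8 = D.tgt f * n) (h11 : s.reg 11 = 0) (hlab : ∀ v < n, s.arr 16 v = 0)
    (hW : n + 1 ≤ W) :
    Runs W reprProg s fun t s' => t ≤ 150 * n + 10 + (reprs D f s).card * (60 * n + 10) ∧
      (s'.reg 11 ≠ 0 ↔ (reprs D f s).Nonempty) ∧
      ∀ v : Fin n, s'.arr 16 v = D.pos f (reprs D f s) v := by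
  classical
  have hn : s.reg 0 = n := h.graph.r0
  set R := reprs D f s with hR
  have hR0 : R.filter (fun v => v.val < 0) = ∅ := by simp
  refine Runs.for (N := n) (fun k t s' => t ≤ 150 * k + (R.filter (fun v => v.val < k)).card * (60 * n + 10) ∧
      (s'.reg 11 ≠ 0 ↔ (R.filter (fun v => v.val < k)).Nonempty) ∧
      ∀ v : Fin n, s'.arr 16 v = D.pos f (R.filter (fun v => v.val < k)) v) (by omega) ?_ ?_ ?_ ?_
  · intro s' hF
    rw [Expr.eval, hF.reg 0 rfl, hn]
  · rw [hR0]
    refine ⟨by simp, by simp [h11], fun v => ?_⟩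
    simp [hlab, pos]
  · rintro k t s' hk ⟨h1, h2, h3⟩ h5 hF
    have hev := (h.of_frame hF rfl rfl).eval_pathTest_ne (x := 5) (v := ⟨k, hk⟩) hf
      ((hF.reg 7 rfl).trans h7) ((hF.reg 8 rfl).trans h8) h5
    have hskip : ⟨k, hk⟩ ∉ R → ∀ t', t' ≤ 140 → s'.reg 5 = k ∧
        t + t' + 8 ≤ 150 * (k + 1) + (R.filter (fun v => v.val < k + 1)).card * (60 * n + 10) ∧
        (s'.reg 11 ≠ 0 ↔ (R.filter (fun v => v.val < k + 1)).Nonempty) ∧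
        ∀ v : Fin n, s'.arr 16 v = D.pos f (R.filter (fun v => v.val < k + 1)) v := by
      intro hk' t' ht'
      have : R.filter (fun v => v.val < k + 1) = R.filter (fun v => v.val < k) := by
        refine Finset.filter_congr fun v hv => ?_
        have : v.val ≠ k := fun hh => hk' ((show v = ⟨k, hk⟩ from Fin.ext hh) ▸ hv)
        omega
      rw [this]
      exact ⟨h5, by omega, h2, h3⟩
    have hmem : (⟨k, hk⟩ : Fin n) ∈ R ↔ _ := mem_reprs
    have a11 := hF.arr 11 rfl
    have a13 := hF.arr 13 rfl
    have a14 := hF.arr 14 rfl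
    have a15 := hF.arr 15 rfl
    refine .cond (fun hc => ?_) fun hc => ?_
    swap
    · refine .skip ?_
      have := hskip (fun hh => hev.2 (hmem.1 hh).1 hc) 30 (by norm_num)
      exact ⟨this.1, by simp only [pathTest, Expr.cost, Expr.cost_neq]; omega, this.2.2⟩
    refine .cond (fun hc1 => ?_) fun hc1 => ?_
    · refine .skip ?_
      rw [Expr.eval_neq] at hc1
      have := hskip (fun hh => hc1 (by simpa [h5, a11, a14] using (hmem.1 hh).2.1)) 50 (by norm_num)
      exact ⟨this.1, by simp only [pathTest, Expr.cost, Expr.cost_at, Expr.cost_neq]; omega, this.2.2⟩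
    have hc1' := not_not.1 fun hh => Expr.eval_neq.2 hh hc1
    refine .cond (fun hc2 => ?_) fun hc2 => ?_
    swap
    · refine .skip ?_
      have := hskip (fun hh => (hmem.1 hh).2.2.1 (by simpa [h5, a13] using hc2)) 60 (by norm_num)
      exact ⟨this.1, by simp only [pathTest, Expr.cost, Expr.cost_at, Expr.cost_neq]; omega, this.2.2⟩
    refine .cond (fun hc3 => ?_) fun hc3 => ?_
    swap
    · refine .skip ?_
      have := hskip (fun hh => by
        have g1 := (hmem.1 hh).2.2.1
        have g2 := (hmem.1 hh).2.2.2
        simp only [Expr.eval, Expr.eval_at, h5, a13, a15, a11] at hc3 hc2 g1 g2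
        omega) 80 (by norm_num)
      exact ⟨this.1, by simp only [pathTest, Expr.cost, Expr.cost_at, Expr.cost_neq]; omega, this.2.2⟩
    have hkR : (⟨k, hk⟩ : Fin n) ∈ R := hmem.2 ⟨hev.1 hc, by simpa [h5, a11, a14] using hc1',
      by simpa [h5, a13] using hc2, by
        simp [h5, a13, a15, a11] at hc3 hc2 ⊢
        omega⟩
    have hins : R.filter (fun v => v.val < k + 1) = insert ⟨k, hk⟩ (R.filter (fun v => v.val < k)) := by
      ext v
      simp only [Finset.mem_filter, Finset.mem_insert, Fin.ext_iff]
      constructor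
      · rintro ⟨g1, g2⟩
        by_cases hv : v.val = k
        · exact .inl hv
        · exact .inr ⟨g1, by omega⟩
      · rintro (g1 | ⟨g1, g2⟩)
        · exact ⟨(show v = ⟨k, hk⟩ from Fin.ext g1) ▸ hkR, by omega⟩
        · exact ⟨g1, by omega⟩
    have hnot : (⟨k, hk⟩ : Fin n) ∉ R.filter (fun v => v.val < k) := by simp
    refine (runs_split (e := ⟨k, hk⟩) (f := f) (h.of_frame hF rfl rfl) ((hF.reg 8 rfl).trans h8) h5
      (fun v => ?_) (by omega) (by omega)).frame.mono ?_
    · rw [h3 v]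
      have g1 := pos_le (D := D) (f := f) (R := R.filter (fun v => v.val < k)) v
      have g2 := Finset.card_le_univ (R.filter (fun v => v.val < k))
      rw [Fintype.card_fin] at g2
      omega
    · rintro t₁ s₁ ⟨⟨ht₁, hr, ha⟩, hF₁⟩
      rw [hins, Finset.card_insert_of_notMem hnot]
      refine ⟨(hF₁.reg 5 rfl).trans h5, ?_, ?_, fun v => ?_⟩
      · rw [Nat.add_mul]
        simp [pathTest]
        omega
      · simp [hr]
      · rw [pos_insert hnot, ← h3 v, State.setReg_arr, ha v]
  · rintro t s' ⟨h1, h2⟩ hF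
    have : R.filter (fun v => v.val < n) = R := by simp
    rw [this] at h1 h2
    exact ⟨by simp; omega, h2⟩

/-! ### Merging intervals -/

/-- Replaces the label in register `12` by the label in register `13`. -/
def joinProg : Prog :=
  .for 6 (.reg 0) (.cond (.neq (.at 16 6) (.reg 12)) .skip (.write 16 (.reg 6) (.reg 13)))

/-- Links the labels of the ends of the edge in register `5`, unless they agree. -/
def mergeStep : Prog :=
  .cond (.at 3 5) .skip
    (.assign 12 (.read 16 (.at 6 5)) ;; .assign 13 (.read 16 (.at 7 5)) ;;
      .cond (.neq (.reg 12) (.reg 13))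
        (joinProg ;; .assign 9 (.read 8 (.at 6 5)) ;; .assign 10 (.read 8 (.at 7 5)) ;; emitPair)
        .skip)

def mergeProg : Prog := .for 5 (.reg 4) mergeStep

theorem runs_join (hn : s.reg 0 = n) (hW : n ≤ W) (h13 : s.reg 13 ≤ W) :
    Runs W joinProg s fun t s' => t ≤ 40 * n + 10 ∧ ∀ v < n, s'.arr 16 v =
      if s.arr 16 v = s.reg 12 then s.reg 13 else s.arr 16 v := by
  refine Runs.for (N := n) (fun k t s' => t ≤ 40 * k ∧ ∀ v, s'.arr 16 v =
    if v < k ∧ s.arr 16 v = s.reg 12 then s.reg 13 else s.arr 16 v) hW ?_ (by simp) ?_ ?_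
  · intro s' hF
    simp [hF.reg 0 rfl, hn]
  · rintro k t s' hk ⟨h1, h2⟩ h6 hF
    have r12 := hF.reg 12 rfl
    have r13 := hF.reg 13 rfl
    have e16 : s'.arr 16 k = s.arr 16 k := by simpa using h2 k
    have hlt : ∀ v, v ≠ k → (v < k + 1 ↔ v < k) := fun v hv => by omega
    refine .cond (fun hc => ?_) fun hc => ?_
    · rw [Expr.eval_neq] at hc
      simp only [Expr.eval, Expr.eval_at, h6, e16, r12] at hc
      refine .skip ⟨h6, by simp; omega, fun v => ?_⟩
      by_cases hv : v = k
      · simp [hv, e16, hc]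
      · simp only [hlt v hv]
        exact h2 v
    · have hc' := not_not.1 fun hh => Expr.eval_neq.2 hh hc
      simp only [Expr.eval, Expr.eval_at, h6, e16, r12] at hc'
      refine .write (by simp; omega) (by simpa [r13] using h13) ⟨h6, by simp; omega, fun v => ?_⟩
      by_cases hv : v = k
      · simp [hv, h6, hc', r13]
      · simp only [hlt v hv]
        simpa [h6, hv] using h2 v
  · rintro t s' ⟨h1, h2⟩ hF
    refine ⟨by simp; omega, fun v hv => ?_⟩
    rw [h2]
    simp [hv]

open Classical in
-- Linear time is spent only when a pair is chosen, on relabelling and output; otherwise the step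
-- takes constant time.
theorem runs_mergeStep {gl : List (Fin m ⊕ Fin m × Fin m)} {R : Finset (Fin n)} {M : Finset (Fin m)}
    {lab : Fin n → ℕ} (h : Stored D pe s) (hw : Writes s (outList D pe gl) [])
    (hM : D.IsMerged f R j M lab) (hR : ∀ e ∈ R, D.cov f e)
    (hlab : ∀ v : Fin n, s.arr 16 v = lab v ∧ lab v ≤ W) (hf : ¬ D.tree f)
    (h4 : s.reg 4 = f) (h5 : s.reg 5 = j) (h7 : s.reg 7 = D.src f * n) (h8 : s.reg 8 = D.tgt f * n)
    (hWn : n * n ≤ W) (hWm : m ≤ W) (hW : (gl.length + 1) * (n + 2) ≤ W) :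
    Runs W mergeStep s fun t s' => ∃ M' lab' gl', D.IsMerged f R (j + 1) M' lab' ∧
      (∀ v : Fin n, s'.arr 16 v = lab' v ∧ lab' v ≤ W) ∧ Writes s' (outList D pe gl') [] ∧
      (M' = M ∧ gl' = gl ∧ t ≤ 50 ∨ j ∉ M ∧ M' = insert j M ∧ gl' = gl ++ [.inr (f, j)] ∧
        t ≤ 150 * n + 150) := by
  have a3 := h.graph.a3 j
  have a6 := h.graph.a6 j
  have a7 := h.graph.a7 j
  have ls := hlab (D.src j)
  have lt := hlab (D.tgt j)
  have hn0 : 0 < n := (D.src j).pos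
  have hWn' : n ≤ W := by nlinarith
  refine .cond (fun hc => ?_) fun hc => ?_
  · rw [Expr.eval_at, h5] at hc
    have ht : D.tree j := a3.2.1 (by omega)
    exact .skip ⟨M, lab, gl, hM.succ_of_skip (fun hh => absurd ht hh), hlab, hw,
      .inl ⟨rfl, rfl, by simp⟩⟩
  rw [Expr.eval_at, h5] at hc
  have ht : ¬ D.tree j := fun hh => by have := a3.2.2 hh; omega
  refine .seq (.assign (by simp [h5, a6, ls.1, ls.2]) (.seq (.assign (by simp [h5, a7, lt.1, lt.2]) ?_)))
  set s₁ := (s.setReg 12 _).setReg 13 _ with hs₁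
  have r12 : s₁.reg 12 = lab (D.src j) := by simp [hs₁, h5, a6, ls.1]
  have r13 : s₁.reg 13 = lab (D.tgt j) := by simp [hs₁, h5, a7, lt.1]
  have harr : s₁.arr = s.arr := rfl
  have hreg : ∀ x, x ≠ 12 → x ≠ 13 → s₁.reg x = s.reg x := fun x h1 h2 => by simp [hs₁, h1, h2]
  have hst : Stored D pe s₁ := ⟨h.graph.congr rfl rfl rfl rfl rfl rfl, h.a9, h.a12⟩
  have hw₁ : Writes s₁ (outList D pe gl) [] := hw.congr rfl rfl rfl rfl
  refine .cond (fun hc1 => ?_) fun hc1 => ?_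
  · rw [Expr.eval_neq, Expr.eval, Expr.eval, r12, r13] at hc1
    refine .seq ((runs_join hst.graph.r0 hWn' (r13 ▸ lt.2)).frame.mono ?_)
    rintro t₂ s₂ ⟨⟨ht₂, ha₂⟩, hF₂⟩
    have hst₂ := hst.of_frame hF₂ rfl rfl
    have hw₂ : Writes s₂ (outList D pe gl) [] :=
      hw₁.congr (hF₂.reg 2 rfl) (hF₂.reg 3 rfl) (hF₂.arr 4 rfl) (hF₂.arr 5 rfl)
    have r5 : s₂.reg 5 = j := (hF₂.reg 5 rfl).trans h5
    have b6 := hst₂.graph.a6 j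
    have b7 := hst₂.graph.a7 j
    have b8 := hst₂.graph.a8 _ (D.src j).isLt
    have b8' := hst₂.graph.a8 _ (D.tgt j).isLt
    have c8 := mul_add_lt (D.src j).isLt hn0
    have c8' := mul_add_lt (D.tgt j).isLt hn0
    refine .seq (.assign (by simp [r5, b6, b8]; omega) (.seq (.assign (by simp [r5, b7, b8']; omega) ?_)))
    set s₃ := (s₂.setReg 9 _).setReg 10 _ with hs₃
    have hst₃ : Stored D pe s₃ := ⟨hst₂.graph.congr rfl rfl rfl rfl rfl rfl, hst₂.a9, hst₂.a12⟩
    refine (runs_emitPair (f := f) (j := j) hst₃ (hw₂.congr rfl rfl rfl rfl) hf ht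
      ((hF₂.reg 4 rfl).trans h4) r5 ((hF₂.reg 7 rfl).trans h7) ((hF₂.reg 8 rfl).trans h8)
      (by simp [hs₃, r5, b6, b8]) (by simp [hs₃, r5, b7, b8']) hWm hW).frame.mono ?_
    rintro t₄ s₄ ⟨⟨ht₄, hw₄⟩, hF₄⟩
    refine ⟨_, _, _, hM.succ_of_merge hR ht hc1, fun v => ⟨?_, ?_⟩, hw₄,
      .inr ⟨fun hh => (hM.lt j hh).1.false, rfl, rfl, by simp; omega⟩⟩
    · rw [hF₄.arr 16 rfl]
      refine (ha₂ v v.isLt).trans ?_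
      rw [harr, (hlab v).1, r12, r13]
    · have := (hlab v).2
      split_ifs
      exacts [lt.2, this]
  · have hc1' := not_not.1 fun hh => Expr.eval_neq.2 hh hc1
    rw [Expr.eval, Expr.eval, r12, r13] at hc1'
    exact .skip ⟨M, lab, gl, hM.succ_of_skip (fun _ => hc1'), hlab, hw₁, .inl ⟨rfl, rfl, by simp⟩⟩

end CycleLattice

/-! ### Treatment of one edge, and the loop over all edges -/

namespace CycleLattice

open CycleLattice.RootedTree CycleLattice.RootedTree.Realizes

variable {W n m : ℕ} {s : State} {D : RootedTree n m} {pe : Fin n → Fin m} {f j : Fin m}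

/-- Without representatives all positions are zero and no edge would be chosen. The basis lemma thus
also applies when the program skips the scan. -/
theorem RootedTree.IsMerged.of_eq_empty {R : Finset (Fin n)} (hR : R = ∅) :
    ∀ k ≤ m, D.IsMerged f R k ∅ (D.pos f R)
  | 0, _ => .zero
  | k + 1, hk => by
    refine IsMerged.succ_of_skip (j := ⟨k, hk⟩) (IsMerged.of_eq_empty hR k (by omega)) fun _ => ?_
    simp [hR, pos]

open Classical in
theorem runs_merge {gl : List (Fin m ⊕ Fin m × Fin m)} {R : Finset (Fin n)}
    (h : Stored D pe s) (hw : Writes s (outList D pe gl) []) (hR : ∀ e ∈ R, D.cov f e)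
    (h16 : ∀ v : Fin n, s.arr 16 v = D.pos f R v) (hf : ¬ D.tree f)
    (h4 : s.reg 4 = f) (h7 : s.reg 7 = D.src f * n) (h8 : s.reg 8 = D.tgt f * n)
    (hWn : n * n ≤ W) (hWm : m ≤ W) (hW : (gl.length + n + 2) * (n + 2) ≤ W) :
    Runs W mergeProg s fun t s' => ∃ (Ml : List (Fin m)) (lab : Fin n → ℕ),
      D.IsMerged f R f Ml.toFinset lab ∧ Ml.Nodup ∧
      Writes s' (outList D pe (gl ++ Ml.map fun j => .inr (f, j))) [] ∧
      t ≤ f * 70 + Ml.length * (150 * n + 150) + 10 := by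
  have hRn : R.card ≤ n := (Finset.card_le_univ R).trans_eq (Fintype.card_fin n)
  refine Runs.for (N := f) (fun k t s' => ∃ (Ml : List (Fin m)) (lab : Fin n → ℕ),
      D.IsMerged f R k Ml.toFinset lab ∧ Ml.Nodup ∧ (∀ v : Fin n, s'.arr 16 v = lab v ∧ lab v ≤ W) ∧
      Writes s' (outList D pe (gl ++ Ml.map fun j => .inr (f, j))) [] ∧
      t ≤ k * 70 + Ml.length * (150 * n + 150)) (by omega) ?_ ?_ ?_ ?_
  · intro s' hF
    rw [Expr.eval, hF.reg 4 rfl, h4]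
  · refine ⟨[], _, .zero, by simp, fun v => ⟨h16 v, ?_⟩, ?_, by simp⟩
    · have := pos_le (D := D) (f := f) (R := R) v
      nlinarith
    · rw [List.map_nil, List.append_nil]
      exact hw.congr rfl rfl rfl rfl
  · rintro k t s' hk ⟨Ml, lab, hM, hnd, hlab, hw', ht⟩ h5 hF
    have hkm : k < m := hk.trans f.isLt
    have hlen : Ml.length ≤ n + 1 := by
      have := hM.card
      rw [List.toFinset_card_of_nodup hnd] at this
      omega
    refine (runs_mergeStep (j := ⟨k, hkm⟩) (h.of_frame hF rfl rfl) hw' hM hR hlab hf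
      ((hF.reg 4 rfl).trans h4) h5 ((hF.reg 7 rfl).trans h7) ((hF.reg 8 rfl).trans h8) hWn hWm (by
        refine le_trans (Nat.mul_le_mul_right _ ?_) hW
        simp; omega)).frame.mono ?_
    rintro t₁ s₁ ⟨⟨M', lab', gl', hM', hlab', hw₁, hor⟩, hF₁⟩
    refine ⟨(hF₁.reg 5 rfl).trans h5, ?_⟩
    rcases hor with ⟨rfl, rfl, ht₁⟩ | ⟨hj, rfl, rfl, ht₁⟩
    · exact ⟨Ml, lab', hM', hnd, hlab', hw₁.congr rfl rfl rfl rfl, by simp; omega⟩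
    · refine ⟨Ml ++ [⟨k, hkm⟩], lab', by convert hM' using 1; ext; simp, ?_, hlab', ?_, ?_⟩
      · rw [List.nodup_append]
        simp only [List.mem_toFinset] at hj
        refine ⟨hnd, by simp, fun a ha b hb => ?_⟩
        rw [List.mem_singleton.1 hb]
        exact fun hab => hj (hab ▸ ha)
      · rw [List.map_append, ← List.append_assoc]
        exact hw₁.congr rfl rfl rfl rfl
      · rw [List.length_append, List.length_singleton, Nat.add_mul Ml.length]
        simp only [Expr.cost]
        omega
  · rintro t s' ⟨Ml, lab, hM, hnd, hlab, hw', ht⟩ hF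
    exact ⟨Ml, lab, hM, hnd, hw', by simp; omega⟩

/-- Treats the edge in register `4`, which is not in the tree. -/
def mainStep : Prog :=
  .assign 7 (.read 8 (.at 6 4)) ;; .assign 8 (.read 8 (.at 7 4)) ;; emitFund ;; clearProg ;; markProg ;;
    clearLabProg ;; .assign 11 (.const 0) ;; reprProg ;; updateProg ;; .cond (.reg 11) mergeProg .skip

def mainProg : Prog := .for 4 (.reg 1) (.cond (.at 3 4) .skip mainStep)

open Classical in
-- If there are representatives, at least as many pairs are found, hence at least one. The scan of
-- the earlier edges and the splitting of labels are charged to these pairs; everything else is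
-- linear in `n`.
theorem runs_mainStep {gl : List (Fin m ⊕ Fin m × Fin m)} {Q : Finset (Fin m × Fin m)}
    (h : Stored D pe s) (hw : Writes s (outList D pe gl) []) (hc : Classes D f s)
    (hQ : D.IsPairBasis f Q) (hf : ¬ D.tree f) (h4 : s.reg 4 = f)
    (hW : (gl.length + n + 3) * (n + 2) ≤ W) (hWm : m + 1 ≤ W) :
    Runs W mainStep s fun t s' => ∃ Ml : List (Fin m), Ml.Nodup ∧
      D.IsPairBasis (f + 1) (Q ∪ {f} ×ˢ Ml.toFinset) ∧
      (∀ j ∈ Ml, j < f ∧ ∃ v, D.cov f v ∧ D.cov j v) ∧ Classes D (f + 1) s' ∧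
      Writes s' (outList D pe (gl ++ [.inl f] ++ Ml.map fun j => .inr (f, j))) [] ∧
      t ≤ 600 * n + Ml.length * (500 * (n + m)) := by
  have hn0 : 0 < n := (D.src f).pos
  have hWn : n * n ≤ W := by nlinarith
  have hWn' : n + 1 ≤ W := by nlinarith
  have b6 := h.graph.a6 f
  have b7 := h.graph.a7 f
  have b8 := h.graph.a8 _ (D.src f).isLt
  have b8' := h.graph.a8 _ (D.tgt f).isLt
  have c8 := mul_add_lt (D.src f).isLt hn0
  have c8' := mul_add_lt (D.tgt f).isLt hn0
  refine .seq (.assign (by simp [h4, b6, b8]; omega) (.seq (.assign (by simp [h4, b7, b8']; omega) ?_)))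
  set s₁ := (s.setReg 7 _).setReg 8 _ with hs₁
  have r7 : s₁.reg 7 = D.src f * n := by simp [hs₁, h4, b6, b8]
  have r8 : s₁.reg 8 = D.tgt f * n := by simp [hs₁, h4, b7, b8']
  have r4 : s₁.reg 4 = f := h4
  have hst₁ : Stored D pe s₁ := ⟨h.graph.congr rfl rfl rfl rfl rfl rfl, h.a9, h.a12⟩
  have hc₁ : Classes D f s₁ := hc.congr rfl rfl
  have hw₁ : Writes s₁ (outList D pe gl) [] := hw.congr rfl rfl rfl rfl
  refine .seq ((runs_emitFund hst₁ hw₁ hf r4 r7 r8 (by omega)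
    (le_trans (Nat.mul_le_mul_right _ (by omega)) hW)).frame.mono ?_)
  clear_value s₁
  rintro t₂ s₂ ⟨⟨ht₂, hw₂⟩, hF₂⟩
  refine .seq ((runs_clear ((hF₂.reg 0 rfl).trans hst₁.graph.r0) hWn').frame.mono ?_)
  rintro t₃ s₃ ⟨⟨ht₃, h0⟩, hF₃⟩
  have hst₃ := (hst₁.of_frame hF₂ rfl rfl).of_frame hF₃ rfl rfl
  have r7₃ := (hF₃.reg 7 rfl).trans ((hF₂.reg 7 rfl).trans r7)
  have r8₃ := (hF₃.reg 8 rfl).trans ((hF₂.reg 8 rfl).trans r8)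
  have hc₃ : Classes D f s₃ := (hc₁.congr (hF₂.arr 11 rfl) (hF₂.arr 13 rfl)).congr (hF₃.arr 11 rfl)
    (hF₃.arr 13 rfl)
  refine .seq ((runs_mark hst₃ hf r7₃ r8₃ hc₃.le h0 hWn').frame.mono ?_)
  rintro t₄ s₄ ⟨⟨ht₄, hm, hm'⟩, hF₄⟩
  refine .seq ((runs_clearLab ((hF₄.reg 0 rfl).trans hst₃.graph.r0) (by omega)).frame.mono ?_)
  rintro t₅ s₅ ⟨⟨ht₅, hlab⟩, hF₅⟩
  refine .seq (.assign (by simp) ?_)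
  set s₆ := s₅.setReg 11 _ with hs₆
  have hst₅ := (hst₃.of_frame hF₄ rfl rfl).of_frame hF₅ rfl rfl
  have hst₆ : Stored D pe s₆ := ⟨hst₅.graph.congr rfl rfl rfl rfl rfl rfl, hst₅.a9, hst₅.a12⟩
  have hc₅ : Classes D f s₅ := (hc₃.congr (hF₄.arr 11 rfl) (hF₄.arr 13 rfl)).congr (hF₅.arr 11 rfl)
    (hF₅.arr 13 rfl)
  have hc₆ : Classes D f s₆ := hc₅.congr rfl rfl
  have r7₆ : s₆.reg 7 = D.src f * n := (hF₅.reg 7 rfl).trans ((hF₄.reg 7 rfl).trans r7₃)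
  have r8₆ : s₆.reg 8 = D.tgt f * n := (hF₅.reg 8 rfl).trans ((hF₄.reg 8 rfl).trans r8₃)
  have r11 : s₆.reg 11 = 0 := by simp [hs₆]
  have hm₆ : Marks (D.cov f) (s₆.arr 11) n (s₆.arr 14) := by
    rw [show s₆.arr 11 = s₃.arr 11 from (hF₅.arr 11 rfl).trans (hF₄.arr 11 rfl),
      show s₆.arr 14 = s₄.arr 14 from hF₅.arr 14 rfl]
    exact hm
  have hm₆' : Marks (fun v => ¬ D.cov f v) (s₆.arr 11) n (s₆.arr 15) := by
    rw [show s₆.arr 11 = s₃.arr 11 from (hF₅.arr 11 rfl).trans (hF₄.arr 11 rfl),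
      show s₆.arr 15 = s₄.arr 15 from hF₅.arr 15 rfl]
    exact hm'
  have r4₆ : s₆.reg 4 = f := (hF₅.reg 4 rfl).trans ((hF₄.reg 4 rfl).trans ((hF₃.reg 4 rfl).trans
    ((hF₂.reg 4 rfl).trans r4)))
  have hw₆ : Writes s₆ (outList D pe (gl ++ [.inl f])) [] :=
    ((hw₂.congr (hF₃.reg 2 rfl) (hF₃.reg 3 rfl) (hF₃.arr 4 rfl) (hF₃.arr 5 rfl)).congr
    (hF₄.reg 2 rfl) (hF₄.reg 3 rfl) (hF₄.arr 4 rfl) (hF₄.arr 5 rfl)).congr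
    (hF₅.reg 2 rfl) (hF₅.reg 3 rfl) (hF₅.arr 4 rfl) (hF₅.arr 5 rfl)
  have hlab₆ : ∀ v < n, s₆.arr 16 v = 0 := hlab
  clear_value s₆
  have hR := isRepSet_reprs hc₆ hm₆ hm₆'
  refine .seq ((runs_repr hst₆ hf r7₆ r8₆ r11 hlab₆ hWn').frame.mono ?_)
  rintro t₇ s₇ ⟨⟨ht₇, hr₇, ha₇⟩, hF₇⟩
  have hst₇ := hst₆.of_frame hF₇ rfl rfl
  have e11 := hF₇.arr 11 rfl
  refine .seq ((runs_update hst₇ hf ((hF₇.reg 7 rfl).trans r7₆) ((hF₇.reg 8 rfl).trans r8₆)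
    (hc₆.congr e11 (hF₇.arr 13 rfl)) (by rwa [e11, hF₇.arr 14 rfl]) (by rwa [e11, hF₇.arr 15 rfl])
    (by omega) hWm).frame.mono ?_)
  rintro t₈ s₈ ⟨⟨ht₈, hc₈⟩, hF₈⟩
  have hst₈ := hst₇.of_frame hF₈ rfl rfl
  have hw₈ : Writes s₈ (outList D pe (gl ++ [.inl f])) [] :=
    (hw₆.congr (hF₇.reg 2 rfl) (hF₇.reg 3 rfl) (hF₇.arr 4 rfl) (hF₇.arr 5 rfl)).congr
    (hF₈.reg 2 rfl) (hF₈.reg 3 rfl) (hF₈.arr 4 rfl) (hF₈.arr 5 rfl)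
  have r11' : s₈.reg 11 ≠ 0 ↔ (reprs D f s₆).Nonempty := by rw [hF₈.reg 11 rfl]; exact hr₇
  refine .cond (fun hcond => ?_) fun hcond => ?_
  · have hne := r11'.1 hcond
    refine (runs_merge (R := reprs D f s₆) hst₈ hw₈ hR.cov
      (fun v => by rw [hF₈.arr 16 rfl]; exact ha₇ v) hf
      ((hF₈.reg 4 rfl).trans ((hF₇.reg 4 rfl).trans r4₆))
      ((hF₈.reg 7 rfl).trans ((hF₇.reg 7 rfl).trans r7₆))
      ((hF₈.reg 8 rfl).trans ((hF₇.reg 8 rfl).trans r8₆)) hWn (by omega) (by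
        refine le_trans (Nat.mul_le_mul_right _ ?_) hW
        simp; omega)).frame.mono ?_
    rintro t₉ s₉ ⟨⟨Ml, lab, hM, hnd, hw₉, ht₉⟩, hF₉⟩
    obtain ⟨hB, hle⟩ := hM.basis hf hR hQ
    refine ⟨Ml, hnd, hB, fun j hj => ⟨(hM.lt j (by simpa using hj)).1,
      hM.overlap j (by simpa using hj)⟩, hc₈.congr (hF₉.arr 11 rfl) (hF₉.arr 13 rfl), hw₉, ?_⟩
    rw [List.toFinset_card_of_nodup hnd] at hle
    have hpos : 1 ≤ Ml.length := hne.card_pos.trans_le hle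
    have hfm := f.isLt
    have e1 : (reprs D f s₆).card * (60 * n + 10) ≤ Ml.length * (60 * n + 10) :=
      Nat.mul_le_mul_right _ hle
    have e2 : m ≤ Ml.length * m := Nat.le_mul_of_pos_left _ hpos
    have e3 : Ml.length ≤ Ml.length * n := Nat.le_mul_of_pos_right _ hn0
    simp only [Nat.mul_add, Nat.mul_left_comm Ml.length] at e1 ht₇ ht₉ ⊢
    simp only [Expr.cost, Expr.cost_at]
    omega
  · have hem : reprs D f s₆ = ∅ := Finset.not_nonempty_iff_eq_empty.1 fun hh => r11'.2 hh hcond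
    rw [hem] at hR ht₇
    obtain ⟨hB, hle⟩ := (IsMerged.of_eq_empty rfl f f.isLt.le).basis hf hR hQ
    refine .skip ⟨[], by simp, by simpa using hB, by simp, hc₈, by simpa using hw₈, ?_⟩
    simp at ht₇ ⊢
    omega

theorem Classes.succ_of_tree (h : Classes D f s) (hf : D.tree f) : Classes D (f + 1) s := by
  have : ∀ v, D.sig (f + 1) v = D.sig f v := fun v => by
    rw [D.sig_succ, if_neg fun hh => hh.1 hf]
  obtain ⟨h1, h2, h3⟩ := h
  exact ⟨h1, by simpa only [this], by simpa only [this]⟩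

/-- Each of the `m` edges has a cost linear in `n`, and the remaining cost is `500 * (n + m)` for
each pair, of which there are at most `n`. -/
theorem runs_main (h : Stored D pe s) (hw : Writes s [] []) (hc : Classes D 0 s)
    (hW : (m + 2 * n + 3) * (n + 2) ≤ W) :
    Runs W mainProg s fun t s' => t ≤ m * (700 * n) + n * (500 * (n + m)) + 10 ∧
      ∃ (Q : Finset (Fin m × Fin m)) (gl : List (Fin m ⊕ Fin m × Fin m)), D.IsPairBasis m Q ∧
        IsOverlapping D Q ∧ gl.Nodup ∧ (∀ g, g ∈ gl ↔ g ∈ gens D Q) ∧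
        Writes s' (outList D pe gl) [] := by
  classical
  have hn0 : 0 < n := D.root.pos
  have hWm : m + 1 ≤ W := by nlinarith
  refine Runs.for (N := m) (fun i t s' =>
    ∃ (Q : Finset (Fin m × Fin m)) (gl : List (Fin m ⊕ Fin m × Fin m)), D.IsPairBasis i Q ∧
      IsOverlapping D Q ∧ (∀ q ∈ Q, q.1.val < i) ∧ gl.Nodup ∧
      (∀ f : Fin m, .inl f ∈ gl ↔ f.val < i ∧ ¬ D.tree f) ∧ (∀ q, .inr q ∈ gl ↔ q ∈ Q) ∧
      Writes s' (outList D pe gl) [] ∧ Classes D i s' ∧ gl.length ≤ i + Q.card ∧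
      t ≤ i * (700 * n) + Q.card * (500 * (n + m))) (by omega) ?_ ?_ ?_ ?_
  · intro s' hF
    rw [Expr.eval, hF.reg 1 rfl, h.graph.r1]
  · exact ⟨∅, [], .zero, by simp [IsOverlapping], by simp, by simp, by simp, by simp,
      hw.congr rfl rfl rfl rfl, hc.congr rfl rfl, by simp, by simp⟩
  · rintro i t s' hi ⟨Q, gl, hQ, hov, hlt, hnd, hl, hr, hw', hc', hlen, ht⟩ h4 hF
    have hst := h.of_frame hF rfl rfl
    have a3 := hst.graph.a3 ⟨i, hi⟩
    have hev : (Expr.at 3 4).eval s' = s'.arr 3 i := by rw [Expr.eval_at, h4]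
    refine .cond (fun hcond => ?_) fun hcond => ?_
    · have htree : D.tree ⟨i, hi⟩ := a3.2.1 (by rw [hev] at hcond; simp only at *; omega)
      refine .skip ⟨h4, Q, gl, hQ.succ_of_tree htree, hov, fun q hq => (hlt q hq).trans (by omega), hnd,
        fun g => ?_, hr, hw'.congr rfl rfl rfl rfl,
        (Classes.succ_of_tree (f := ⟨i, hi⟩) (s := s') hc' htree).congr rfl rfl, by omega, by simp; nlinarith⟩
      rw [hl]
      refine and_congr_left fun hg => ?_
      have : g.val ≠ i := fun hh => hg ((show g = ⟨i, hi⟩ from Fin.ext hh) ▸ htree)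
      omega
    · have htree : ¬ D.tree ⟨i, hi⟩ := fun hh => by
        have := a3.2.2 hh
        rw [hev] at hcond
        simp only at *
        omega
      have hQn := hQ.card_le
      refine (runs_mainStep (f := ⟨i, hi⟩) hst hw' hc' hQ htree h4
        (le_trans (Nat.mul_le_mul_right _ (by omega)) hW) hWm).frame.mono ?_
      rintro t₁ s₁ ⟨⟨Ml, hMnd, hB, hM, hc₁, hw₁, ht₁⟩, hF₁⟩
      have hdisj : Disjoint Q (({⟨i, hi⟩} : Finset (Fin m)) ×ˢ Ml.toFinset) := by
        rw [Finset.disjoint_left]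
        intro q hq hq'
        rw [Finset.mem_product, Finset.mem_singleton] at hq'
        have := hlt q hq
        rw [hq'.1] at this
        exact this.false
      have hcard : (Q ∪ ({⟨i, hi⟩} : Finset (Fin m)) ×ˢ Ml.toFinset).card = Q.card + Ml.length := by
        rw [Finset.card_union_of_disjoint hdisj, Finset.card_product, Finset.card_singleton, one_mul,
          List.toFinset_card_of_nodup hMnd]
      refine ⟨(hF₁.reg 4 rfl).trans h4, _, _, hB, ?_, ?_, ?_, ?_, ?_, hw₁.congr rfl rfl rfl rfl,
        hc₁.congr rfl rfl, ?_, ?_⟩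
      · intro q hq
        rcases Finset.mem_union.1 hq with hq | hq
        · exact hov q hq
        · rw [Finset.mem_product, Finset.mem_singleton, List.mem_toFinset] at hq
          obtain ⟨h1, h2⟩ := hM _ hq.2
          rw [hq.1]
          exact ⟨h1.ne, h2⟩
      · intro q hq
        rcases Finset.mem_union.1 hq with hq | hq
        · exact (hlt q hq).trans (Nat.lt_succ_self _)
        · rw [Finset.mem_product, Finset.mem_singleton] at hq
          rw [hq.1]
          exact Nat.lt_succ_self _
      · rw [List.append_assoc, List.nodup_append]
        refine ⟨hnd, ?_, ?_⟩
        · rw [List.singleton_append, List.nodup_cons]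
          refine ⟨by simp, hMnd.map fun a b hab => ?_⟩
          simpa using hab
        · rintro a ha b hb rfl
          rw [List.singleton_append, List.mem_cons, List.mem_map] at hb
          rcases hb with rfl | ⟨j, hj, rfl⟩
          · exact ((hl _).1 ha).1.false
          · exact (hlt _ ((hr _).1 ha)).false
      · intro g
        have : g.val < i + 1 ↔ g.val < i ∨ g = ⟨i, hi⟩ := by
          rw [Fin.ext_iff, Nat.lt_succ_iff_lt_or_eq]
        simp only [List.mem_append, hl, List.mem_singleton, Sum.inl.injEq, List.mem_map, reduceCtorEq,
          and_false, exists_false, or_false, this, or_and_right]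
        refine or_congr_right ⟨?_, And.left⟩
        rintro rfl
        exact ⟨rfl, htree⟩
      · intro q
        simp only [List.mem_append, hr, List.mem_singleton, reduceCtorEq, or_false, List.mem_map,
          Sum.inr.injEq, Finset.mem_union, Finset.mem_product, Finset.mem_singleton, List.mem_toFinset]
        refine or_congr_right ⟨?_, ?_⟩
        · rintro ⟨j, hj, rfl⟩
          exact ⟨rfl, hj⟩
        · rintro ⟨h1, h2⟩
          exact ⟨_, h2, Prod.ext h1.symm rfl⟩
      · rw [hcard]
        simp
        omega
      · rw [hcard, Nat.add_mul, Nat.add_mul]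
        simp only [Expr.cost, Expr.cost_at]
        omega
  · rintro t s' ⟨Q, gl, hQ, hov, hlt, hnd, hl, hr, hw', hc', hlen, ht⟩ hF
    refine ⟨?_, Q, gl, hQ, hov, hnd, fun g => ?_, hw'⟩
    · have := Nat.mul_le_mul_right (500 * (n + m)) hQ.card_le
      simp only [Expr.cost]
      omega
    · rcases g with g | q
      · simp [hl, gens]
      · simp [hr, gens]

end CycleLattice

namespace CycleLattice

open CycleLattice.RootedTree CycleLattice.RootedTree.Realizes

/-! ### The whole program -/

/-- Computes a lattice cycle basis. -/
def basisProg : Prog := rowsProg ;; endsProg ;; growProg ;; mainProg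

variable {α β : Type*} {n m W : ℕ} {G : Graph α β} {T : Set β} {vtx : Fin n ≃ G.vertexSet}
  {edg : Fin m ≃ G.edgeSet} {s : State}

theorem IsSpanningTree.induction (hT : IsSpanningTree G T) {src tgt : Fin m → Fin n}
    (hl : ∀ e, G.IsLink (edg e).1 (vtx (src e)).1 (vtx (tgt e)).1) {S : Fin n → Prop} {r : Fin n}
    (hr : S r) (hS : ∀ e, (edg e).1 ∈ T → (S (src e) ↔ S (tgt e))) (v : Fin n) : S v := by
  have hc : (G.restrict T).toSimpleGraph.Connected := hT.2.1
  obtain ⟨p⟩ := hc.preconnected (vtx r) (vtx v)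
  suffices ∀ {x y : (G.restrict T).vertexSet}, (G.restrict T).toSimpleGraph.Walk x y →
      ∀ u v : Fin n, x.1 = vtx u → y.1 = vtx v → S u → S v from this p r v rfl rfl hr
  intro x y p
  induction p with
  | nil =>
    intro u v hx hy hu
    obtain rfl : u = v := vtx.injective (Subtype.ext (hx.symm.trans hy))
    exact hu
  | @cons x z y hxz p ih =>
    intro u v hx hy hu
    obtain ⟨w, hw⟩ := vtx.surjective ⟨z.1, z.2⟩
    have hz : z.1 = vtx w := by rw [hw]
    have hadj : ∃ e, e ∈ T ∧ G.IsLink e x.1 z.1 := hxz.2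
    obtain ⟨e, heT, he⟩ := hadj
    obtain ⟨f, hf⟩ := edg.surjective ⟨e, he.edge_mem⟩
    have hfe : (edg f).1 = e := by rw [hf]
    rw [hx, hz, ← hfe] at he
    have hSf := hS f (hfe ▸ heT)
    refine ih w v hz hy ?_
    rcases (hl f).eq_and_eq_or_eq_and_eq he with ⟨h1, h2⟩ | ⟨h1, h2⟩
    · rw [← show tgt f = w from vtx.injective (Subtype.ext h2), ← hSf,
        show src f = u from vtx.injective (Subtype.ext h1)]
      exact hu
    · rw [← show src f = w from vtx.injective (Subtype.ext h1), hSf,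
        show tgt f = u from vtx.injective (Subtype.ext h2)]
      exact hu

theorem Grown.exists_realizes [NeZero n] {src tgt : Fin m → Fin n} {par : Fin n → Fin n} (hn : 2 ≤ n)
    (hg : Grown src tgt (fun e => (edg e).1 ∈ T) Finset.univ par s)
    (hs : HoldsGraph src tgt (fun e => (edg e).1 ∈ T) s)
    (hl : ∀ e, G.IsLink (edg e).1 (vtx (src e)).1 (vtx (tgt e)).1) :
    ∃ (D : RootedTree n m) (pe : Fin n → Fin m), D.Realizes G T vtx edg pe ∧ Stored D pe s := by
  have h1 : (⟨1, hn⟩ : Fin n) ≠ 0 := fun hh => one_ne_zero (congrArg Fin.val hh)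
  have hex := fun v => hg.edge v (Finset.mem_univ v)
  -- There is a vertex other than the root; its edge shows that `Fin m` is inhabited, which provides
  -- a default for `pe` at the root.
  have : Nonempty (Fin m) := ⟨(hex _ h1).choose⟩
  choose! pe hpe using hex
  have hrow := fun v => hg.row v (Finset.mem_univ v)
  have hle := fun v => hg.le_one v (Finset.mem_univ v)
  refine ⟨⟨0, par, fun u v => s.arr 9 (u * n + v) = 1, src, tgt, fun e => (edg e).1 ∈ T,
    fun v => ?_, fun v hv w => ?_, fun v hv => ?_⟩, pe, ⟨hl, fun _ => Iff.rfl, fun w hw => ?_,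
    fun w hw => (hpe w hw).2.1⟩, hs, fun u v => ⟨hle u v, Iff.rfl⟩, fun v hv => (hpe v hv).1⟩
  · rw [hg.root_row]
    exact zero_ne_one
  · rw [hrow v hv w]
    by_cases hwv : w = v <;> simp [hwv]
  · rw [hg.row_par v (Finset.mem_univ v) hv]
    exact zero_ne_one
  · rcases (hpe w hw).2.2 with ⟨h2, h3⟩ | ⟨h2, h3⟩
    · have := hl (pe w)
      rwa [h2, h3] at this
    · have := (hl (pe w)).symm
      rwa [h2, h3] at this

/-- This absorbs the quadratic cost of the ancestor matrix into a multiple of `m * n`. -/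
theorem RootedTree.Realizes.le_edges_add_one {D : RootedTree n m} {pe : Fin n → Fin m}
    (h : D.Realizes G T vtx edg pe) : n ≤ m + 1 := by
  have h1 : Set.InjOn pe (Finset.univ.erase D.root : Finset (Fin n)) := by
    intro v hv w hw hvw
    exact h.pe_inj (by simpa using hv) (by simpa using hw) hvw
  have h2 := Finset.card_le_card_of_injOn pe (fun v _ => Finset.mem_coe.2 (Finset.mem_univ _)) h1
  rw [Finset.card_erase_of_mem (Finset.mem_univ _), Finset.card_univ, Finset.card_univ,
    Fintype.card_fin, Fintype.card_fin] at h2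
  omega

theorem runs_basisProg {adj : Fin n → List (Fin m × Fin n)} (hn : 2 ≤ n) (hT : IsSpanningTree G T)
    (hadj : IsAdjList G vtx edg adj) (hW : (m + 2 * n + 3) * (n + 2) ≤ W) :
    Runs W basisProg (inputState adj {e | (edg e).1 ∈ T}) fun t s => t ≤ 3000 * (m * n) ∧
      ∃ (D : RootedTree n m) (pe : Fin n → Fin m) (Q : Finset (Fin m × Fin m))
        (gl : List (Fin m ⊕ Fin m × Fin m)), D.Realizes G T vtx edg pe ∧ D.IsPairBasis m Q ∧
        IsOverlapping D Q ∧ gl.Nodup ∧ (∀ g, g ∈ gl ↔ g ∈ gens D Q) ∧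
        Writes s (outList D pe gl) [] := by
  have : NeZero n := ⟨by omega⟩
  have hWn : n ≤ W := by nlinarith
  have hWm : m ≤ W := by nlinarith
  have hWnn : n * n ≤ W := by nlinarith
  set s₀ := inputState adj {e | (edg e).1 ∈ T} with hs₀
  have a0 : ∀ a, 4 ≤ a → s₀.arr a = fun _ => 0 := by
    intro a ha
    match a, ha with
    | a + 4, _ => rfl
  have a3 : ∀ e : Fin m, s₀.arr 3 e ≤ 1 ∧ (s₀.arr 3 e = 1 ↔ (edg e).1 ∈ T) := by
    intro e
    classical
    have : s₀.arr 3 e = if (edg e).1 ∈ T then 1 else 0 := by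
      show (List.ofFn _).getD e 0 = _
      rw [List.getD_eq_getElem?_getD, List.getElem?_ofFn]
      simp [Set.indicator_apply]
    rw [this]
    split_ifs with h <;> simp [h]
  refine .seq ((runs_rows (n := n) rfl rfl hWnn hWn).frame.mono ?_)
  rintro t₁ s₁ ⟨⟨ht₁, ha8⟩, hF₁⟩
  have hA₁ : HoldsAdj adj s₁ := by
    obtain ⟨h1, h2, h3⟩ := holdsAdj_inputState adj {e | (edg e).1 ∈ T}
    have e0 := hF₁.arr 0 rfl
    have e1 := hF₁.arr 1 rfl
    have e2 := hF₁.arr 2 rfl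
    constructor <;> simpa only [e0, e1, e2]
  refine .seq ((runs_ends (n := n) ((hF₁.reg 0 rfl).trans rfl) hA₁ hadj hWn hWm).frame.mono ?_)
  rintro t₂ s₂ ⟨⟨ht₂, hends⟩, hF₂⟩
  choose src tgt h6 h7 hl using hends
  have hg₂ : HoldsGraph src tgt (fun e => (edg e).1 ∈ T) s₂ := by
    refine ⟨(hF₂.reg 0 rfl).trans ((hF₁.reg 0 rfl).trans rfl),
      (hF₂.reg 1 rfl).trans ((hF₁.reg 1 rfl).trans rfl), ?_, h6, h7, ?_⟩
    · rw [hF₂.arr 3 rfl, hF₁.arr 3 rfl]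
      exact a3
    · rw [hF₂.arr 8 rfl]
      exact ha8
  have z₂ : ∀ a ∈ [4, 5, 9, 10, 11, 12, 13], s₂.arr a = fun _ => 0 := by
    intro a ha
    rw [hF₂.arr a (by revert a; decide), hF₁.arr a (by revert a; decide),
      a0 a (by revert a; decide)]
  refine .seq ((runs_grow (n := n) hg₂ (z₂ 9 (by simp)) (z₂ 10 (by simp)) hWnn hWm
    fun S h0 hS => hT.induction hl h0 hS).frame.mono ?_)
  rintro t₃ s₃ ⟨⟨ht₃, par, hgr⟩, hF₃⟩
  obtain ⟨D, pe, hR, hst⟩ := hgr.exists_realizes (vtx := vtx) hn (hg₂.congr (hF₃.reg 0 rfl)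
    (hF₃.reg 1 rfl) (hF₃.arr 3 rfl) (hF₃.arr 6 rfl) (hF₃.arr 7 rfl) (hF₃.arr 8 rfl)) hl
  have z₃ : ∀ a ∈ [4, 5, 11, 13], s₃.arr a = fun _ => 0 := by
    intro a ha
    rw [hF₃.arr a (by revert a; decide), z₂ a (by revert a; decide)]
  have r₃ : ∀ x ∈ [2, 3], s₃.reg x = 0 := by
    intro x hx
    rw [hF₃.reg x (by revert x; decide), hF₂.reg x (by revert x; decide),
      hF₁.reg x (by revert x; decide)]
    fin_cases hx <;> rfl
  have hw₃ : Writes s₃ [] [] :=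
    ⟨r₃ 2 (by simp), r₃ 3 (by simp), fun i hi => by simp [z₃ 4 (by simp)], by simp⟩
  have hsig : ∀ v, D.sig 0 v = ∅ := fun v => by
    ext f
    simp [D.mem_sig]
  have hc₃ : Classes D 0 s₃ := by
    constructor <;> simp [z₃ 11 (by simp), z₃ 13 (by simp), hsig]
  refine (runs_main hst hw₃ hc₃ hW).mono ?_
  rintro t₄ s₄ ⟨ht₄, Q, gl, hQ, hov, hnd, hmem, hw₄⟩
  refine ⟨?_, D, pe, Q, gl, hR, hQ, hov, hnd, hmem, hw₄⟩
  have hnm := hR.le_edges_add_one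
  have hm : 1 ≤ m := by omega
  have e1 : n ≤ m * n := Nat.le_mul_of_pos_left _ hm
  have e2 : n * n ≤ m * n + n := by nlinarith
  have e3 : m * (700 * n) = 700 * (m * n) := by ring
  have e4 : n * (500 * (n + m)) = 500 * (n * n) + 500 * (m * n) := by ring
  have e5 : n * m = m * n := mul_comm _ _
  omega

theorem nodup_cycleList {D : RootedTree n m} {pe : Fin n → Fin m} (h : D.Realizes G T vtx edg pe)
    {Q : Finset (Fin m × Fin m)} (hQ : IsOverlapping D Q) {g : Fin m ⊕ Fin m × Fin m}
    (hg : g ∈ gens D Q) : (cycleList D pe g).Nodup := by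
  classical
  have key : ∀ (p : Fin n → Prop) [DecidablePred p], (∀ v, p v → v ≠ D.root) →
      (((List.finRange n).filter fun v => p v).map pe).Nodup := by
    intro p _ hp
    refine List.Nodup.map_on (fun v hv w hw hvw => ?_) ((List.nodup_finRange n).filter _)
    simp only [List.mem_filter, List.mem_finRange, true_and, decide_eq_true_eq] at hv hw
    exact h.pe_inj (hp v hv) (hp w hw) hvw
  have htree : ∀ (p : Fin n → Prop) [DecidablePred p], (∀ v, p v → v ≠ D.root) →
      ∀ e ∈ ((List.finRange n).filter fun v => p v).map pe, D.tree e := by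
    intro p _ hp e he
    obtain ⟨v, hv, rfl⟩ := List.mem_map.1 he
    exact h.pe_tree v (hp v (by simpa using hv))
  rcases g with f | p
  · have hf : ¬ D.tree f := by simpa [gens] using hg
    rw [cycleList, List.nodup_append]
    refine ⟨key _ fun v hv => ne_root_of_cov hv, by simp, fun e he e' he' hee => hf ?_⟩
    rw [← List.mem_singleton.1 he', ← hee]
    exact htree _ (fun v hv => ne_root_of_cov hv) e he
  · obtain ⟨hne, v, hv, hv'⟩ := hQ p (by simpa [gens] using hg)
    rw [cycleList, List.nodup_append]
    refine ⟨key _ fun v hv => ne_root_of_not_iff hv, by simpa using hne.symm, fun e he e' he' hee => ?_⟩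
    have := htree _ (fun v hv => ne_root_of_not_iff hv) e he
    rw [hee] at this
    rcases List.mem_cons.1 he' with rfl | he'
    · exact hv.1 this
    · rw [List.mem_singleton.1 he'] at this
      exact hv'.1 this

theorem Writes.isOutput {L : List (List (Fin m))} (h : Writes s (L.map (List.map Fin.val)) []) :
    IsOutput s L := by
  have hfl : (L.map (List.map Fin.val)).flatten = L.flatten.map Fin.val := by
    rw [List.map_flatten]
  have h5 : StartsWith (s.arr 5) (L.flatten.map Fin.val) := fun i hi => by
    have := h.a5 i (by rw [List.append_nil, hfl]; exact hi)
    rw [List.append_nil, hfl, List.getElem?_eq_getElem hi, Option.some_inj] at this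
    exact this.symm
  refine ⟨by simpa using h.r2, fun i hi => ?_, ?_⟩
  · simp only [offsets_eq, List.length_map, List.length_range] at hi
    simp only [offsets_eq, List.getElem_map, List.getElem_range]
    rw [h.a4 i (by simp; omega), ← List.map_take, ← List.map_flatten, List.length_map]
  · convert h5 using 1
    simp [List.map_eq_flatMap]

theorem isLatticeCycleBasis_cycleList {D : RootedTree n m} {pe : Fin n → Fin m}
    (h : D.Realizes G T vtx edg pe) (hT : IsSpanningTree G T) {Q : Finset (Fin m × Fin m)}
    (hQ : IsOverlapping D Q) (hB : D.IsPairBasis m Q) {gl : List (Fin m ⊕ Fin m × Fin m)}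
    (hnd : gl.Nodup) (hmem : ∀ g, g ∈ gl ↔ g ∈ gens D Q) {k : ℕ} (hk : k = gl.length)
    {C : Fin k → Set β} (hC : ∀ i, C i = edgesIn edg (genCycle D pe (gl.get (i.cast hk)))) :
    IsLatticeCycleBasis G C := by
  subst hk
  obtain rfl : C = fun i => edgesIn edg (genCycle D pe (gl.get i)) := funext hC
  refine ⟨fun i => h.isCycle_gens hQ ((hmem _).1 (List.get_mem _ _)), ?_, ?_⟩
  · have := h.linearIndepOn_gens hT hQ hB.1
    exact LinearIndependent.comp (ι := (gens D Q : Set (Fin m ⊕ Fin m × Fin m))) this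
      (fun i => ⟨gl.get i, (hmem _).1 (List.get_mem _ _)⟩)
      fun i j hij => List.nodup_iff_injective_get.1 hnd (congrArg Subtype.val hij)
  · rw [← h.span_gens hT hQ hB.2]
    congr 1
    ext x
    simp only [Set.mem_range, Set.mem_image, Finset.mem_coe, ← hmem, List.mem_iff_get]
    constructor
    · rintro ⟨i, rfl⟩
      exact ⟨_, ⟨i, rfl⟩, rfl⟩
    · rintro ⟨_, ⟨i, rfl⟩, rfl⟩
      exact ⟨i, rfl⟩

/-- The left side leaves room for all addresses into the output. As `n + m ≥ 2`, the constant factor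
`8` costs three more powers. -/
theorem word_bound {n m c : ℕ} (hn : 2 ≤ n) (hc : 5 ≤ c) :
    (m + 2 * n + 3) * (n + 2) ≤ (n + m) ^ c := by
  have h1 : (m + 2 * n + 3) * (n + 2) ≤ (n + m) ^ 5 := by
    have h2 : m + 2 * n + 3 ≤ 4 * (n + m) := by omega
    have h3 : n + 2 ≤ 2 * (n + m) := by omega
    have h4 : 2 ^ 3 ≤ (n + m) ^ 3 := Nat.pow_le_pow_left (by omega) 3
    calc (m + 2 * n + 3) * (n + 2) ≤ 4 * (n + m) * (2 * (n + m)) := Nat.mul_le_mul h2 h3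
      _ = 2 ^ 3 * (n + m) ^ 2 := by ring
      _ ≤ (n + m) ^ 3 * (n + m) ^ 2 := Nat.mul_le_mul_right _ h4
      _ = (n + m) ^ 5 := by ring
  exact h1.trans (Nat.pow_le_pow_right (by omega) hc)

end CycleLattice

theorem mainTheorem9 :
    ∃ (P : CycleLattice.Prog) (c : ℕ),
      ∀ (α β : Type*) (n m : ℕ) (G : Graph α β) (T : Set β)
        (vtx : Fin n ≃ G.vertexSet) (edg : Fin m ≃ G.edgeSet)
        (adj : Fin n → List (Fin m × Fin n)),
        2 ≤ n → CycleLattice.IsConnected G → CycleLattice.IsSpanningTree G T →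
        CycleLattice.IsAdjList G vtx edg adj →
        ∃ (t : ℕ) (s : CycleLattice.State) (L : List (List (Fin m))),
          CycleLattice.Exec ((n + m) ^ c) P
            (CycleLattice.inputState adj {e | (edg e).1 ∈ T}) t s ∧
          t ≤ c * (m * n) ∧
          CycleLattice.IsOutput s L ∧
          (∀ l ∈ L, l.Nodup) ∧
          CycleLattice.IsLatticeCycleBasis G
            (fun i : Fin L.length => CycleLattice.edgesOf edg (L.get i)) ∧
          ∀ i : Fin L.length,
            (CycleLattice.edgesOf edg (L.get i)).ncard ≤ 2 * CycleLattice.treeDiam G T := by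
  -- The number is dictated by the time bound; as an exponent of the word size, `5` would do.
  refine ⟨CycleLattice.basisProg, 3000, ?_⟩
  intro α β n m G T vtx edg adj hn _ hT hadj
  obtain ⟨t, s, he, ht, D, pe, Q, gl, hR, hB, hQ, hnd, hmem, hw⟩ :=
    CycleLattice.runs_basisProg hn hT hadj (CycleLattice.word_bound hn (by norm_num : 5 ≤ 3000))
  have hset : ∀ i : Fin (gl.map (CycleLattice.cycleList D pe)).length,
      CycleLattice.edgesOf edg ((gl.map (CycleLattice.cycleList D pe)).get i) =
        CycleLattice.edgesIn edg (CycleLattice.RootedTree.Realizes.genCycle D pe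
          (gl.get (i.cast (List.length_map _)))) := by
    intro i
    rw [List.get_eq_getElem, List.getElem_map]
    simp only [CycleLattice.edgesOf, CycleLattice.mem_cycleList]
    rfl
  refine ⟨t, s, gl.map (CycleLattice.cycleList D pe), he, ht, CycleLattice.Writes.isOutput ?_, ?_,
    CycleLattice.isLatticeCycleBasis_cycleList hR hT hQ hB hnd hmem _ hset, fun i => ?_⟩
  · rw [List.map_map]
    exact hw
  · intro l hl
    obtain ⟨g, hg, rfl⟩ := List.mem_map.1 hl
    exact CycleLattice.nodup_cycleList hR hQ ((hmem g).1 hg)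
  · rw [hset]
    exact hR.ncard_gens_le hn hT hQ ((hmem _).1 (List.get_mem _ _))
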